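/- Let $n\ge 0$, and let the $n+1$ rays of the fan of $X=\mathbf P^n$ (with primitive generators $\rho_j$: $e_1,\dots,e_n$ and $-(e_1+\cdots+e_n)$) be divided into $r$ blocks, $c(j)\in\{1,\dots,r\}$ being the block of the ray $j\in\mathcal J=\{1,\dots,n+1\}$ and $m_i$ the size of the $i$-th block. Let $x=(x_{1,0},\dots,x_{r,0};x_1,\dots,x_{n+1})$, and let $\mathcal M_A^\beta$ be the GKZ system in the variables $x$, where $A$ has the columns $(\epsilon_i,0)$ for $x_{i,0}$ and $(\epsilon_{c(j)},\rho_j)$ for $x_j$ ($\epsilon_i$ the standard basis of $\mathbf Z^r$), and $\beta=(-\tfrac12,\dots,-\tfrac12,0,\dots,0)$ with $r$ entries $-\tfrac12$. Consider the GLSM with gauge group $G=\mathbf C^*$, fields $\phi_j$ (gauge weight $2$, $R$-weight $0$), $z_j$ (gauge weight $-1$, $R$-weight $1$) and $z_{i,0}$ (gauge weight $-m_i$, $R$-weight $1$), and superpotential $W=\sum_j z_j^2\phi_j+\sum_i z_{i,0}^2 s_i(\phi)$, where $s_i$ is any homogeneous polynomial of degree $m_i$. For $J\subset\mathcal J$ let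 $\mathfrak B_J$ be the brane given by the matrix factorization $$\mathbf T_J=\sum_{j\in J}\bigl(z_j^2\eta_j+\phi_j\bar\eta_j\bigr)+\sum_{j\notin J}\bigl(z_j\eta_j+z_j\phi_j\bar\eta_j\bigr)+\sum_i\bigl(z_{i,0}\eta_{i,0}+z_{i,0}s_i(\phi)\bar\eta_{i,0}\bigr)$$ of $W$ on the module $M$ spanned by the products of the $\bar\eta$'s applied to a vector of gauge and $R$-weight zero, where $\eta,\bar\eta$ satisfy the Clifford relations; let $\rho_M,R_M$ be the representations for which $\mathbf T_J$ is equivariant, and let $f_{\mathfrak B_J}(\sigma)=\operatorname{Tr}\bigl(R_M(e^{\mathrm i\pi})\rho_M(e^{2\pi\sigma})\bigr)$. The A-period, as a function of $t=-\ln q$, is $$Z_{\mathfrak B_J}=\int_L \Gamma(2\mathrm i\sigma)^{n+1}\,\Gamma\!\left(\tfrac12-\mathrm i\sigma\right)^{n+1}\prod_{i=1}^r\Gamma\!\left(\tfrac12-\mathrm i m_i\sigma\right)e^{\mathrm i t\sigma}f_{\mathfrak B_J}(\sigma)\,\mathrm d\sigma .$$ Here $L=\{x+\mathrm i\,y(x)\}$,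 oriented by increasing $x\in\mathbf R$, is any contour with $y\in C^1(\mathbf R)$ which agrees outside a bounded set with the standard contour $y=\tfrac12(1-e^{-2|x|})^n|2x|^k$ for some integer $k\ge1$, and which at $x=0$ passes below the pole $\sigma=0$ and above all the poles of the last two groups of Gamma factors: $-\tfrac12<y(0)<0$ and $m_iy(0)>-\tfrac12$ for all $i$. Then there is a constant $C$, depending only on the partition into blocks, such that the following holds for every choice of the $s_i$ and of $L$. Let $\Omega$ be the set of the $t\in\mathbf C$ with $\operatorname{Re}t>C$ and, if $k=1$, also $\operatorname{Re}t>C+|\operatorname{Im}t|$. 1. For $t\in\Omega$ and every $J$, the integral $Z_{\mathfrak B_J}$ converges absolutely, and it is the sum of the convergent series of the integrals of the same integrand over the circles of radius $\tfrac13$ around $\mathrm i l$, $l=0,1,2,\dots$, taken counterclockwise. Moreover, $Z_{\mathfrak B_J}$ depends only on $m=|J|$. 2. If $m=|J|\le n$, then the term $l=0$ of this series is a polynomial in $\ln q=-t$ of degree exactly $n-m$. 3. Let $U$ be a nonempty connected open set of points $x$ with all coordinates nonzero, with holomorphic branches on $U$ of $t=-\ln q$, where $$q=\prod_{j=1}^{n+1}(-4x_j)\prod_{i=1}^r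 x_{i,0}^{-m_i},$$ and of $\bigl(\prod_i x_{i,0}\bigr)^{1/2}$, such that $t(U)\subset\Omega$. Put $\hat Z_{\mathfrak B_J}(x)=\bigl(\prod_i x_{i,0}\bigr)^{-1/2}Z_{\mathfrak B_J}(t(x))$. Then the linear span of the functions $\hat Z_{\mathfrak B_J}$, $J\subset\mathcal J$, is the full space of holomorphic solutions of $\mathcal M_A^\beta$ on $U$. More precisely, for any subsets $J_0,\dots,J_n$ of $\mathcal J$ with $|J_m|=m$, the $n+1$ functions $\hat Z_{\mathfrak B_{J_0}},\dots,\hat Z_{\mathfrak B_{J_n}}$ form a basis of this solution space. -/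

import Mathlib

open Complex MeasureTheory

/-! ## Rank one gauged linear sigma models and their branes -/

section GLSM

variable {V : Type} [Fintype V]

/-- Rescaling of the variables of a polynomial: `(scaleVars a P)(X) = P(a X)`. -/
noncomputable def scaleVars (a : V → ℂ) : MvPolynomial V ℂ →ₐ[ℂ] MvPolynomial V ℂ :=
  MvPolynomial.aeval fun v => MvPolynomial.C (a v) * MvPolynomial.X v

/-- Nonanomalous GLSM data with gauge group `G = ℂ^*`: the coordinate `v` of the matter space
has gauge weight `Q v` and `R`-weight `R v`; the superpotential `W` is gauge invariant and has
`R`-weight two; the gauge action has determinant one. -/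
structure AbelianGLSM (V : Type) [Fintype V] where
  Q : V → ℤ
  R : V → ℤ
  W : MvPolynomial V ℂ
  nonanomalous : ∑ v, Q v = 0
  W_gauge : ∀ g : ℂ, g ≠ 0 → scaleVars (fun v => g ^ Q v) W = W
  W_R : ∀ l : ℂ, l ≠ 0 → scaleVars (fun v => l ^ R v) W = MvPolynomial.C (l ^ 2) * W

/-- The representation of `ℂ^*` with weights `w`, as diagonal matrices. -/
noncomputable def weightRep {K : Type} [DecidableEq K] (w : K → ℤ) (g : ℂ) : Matrix K K ℂ :=
  Matrix.diagonal fun b => g ^ w b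

/-- The algebraic data of a B-brane: a `ℤ/2`-graded free module with basis `K`, gauge and
`R`-symmetry representations that are diagonal (hence even) in this basis, with weights `wG` and
`wR`, and an odd equivariant matrix factorization `T` of the superpotential. -/
structure Brane (X : AbelianGLSM V) (K : Type) [Fintype K] [DecidableEq K] where
  parity : K → ZMod 2
  wG : K → ℤ
  wR : K → ℤ
  T : Matrix K K (MvPolynomial V ℂ)
  odd : ∀ b b', T b b' ≠ 0 → parity b = parity b' + 1
  sq : T * T = X.W • (1 : Matrix K K (MvPolynomial V ℂ))
  gauge : ∀ g : ℂ, g ≠ 0 →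
    (weightRep wG g⁻¹).map MvPolynomial.C * T.map (scaleVars fun v => g ^ X.Q v) *
      (weightRep wG g).map MvPolynomial.C = T
  rSymm : ∀ l : ℂ, l ≠ 0 →
    (weightRep wR l).map MvPolynomial.C * T.map (scaleVars fun v => l ^ X.R v) *
      (weightRep wR l⁻¹).map MvPolynomial.C = (MvPolynomial.C l : MvPolynomial V ℂ) • T

/-- The brane factor `tr (R_M(e^{iπ}) ρ_M(e^{2πσ}))`. -/
noncomputable def Brane.factor {X : AbelianGLSM V} {K : Type} [Fintype K] [DecidableEq K]
    (B : Brane X K) (σ : ℂ) : ℂ :=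
  (weightRep B.wR (exp (I * Real.pi)) * weightRep B.wG (exp (2 * Real.pi * σ))).trace

/-- The integrand `∏ Γ(i Q_v σ + R_v / 2) e^{i t σ} f_B(σ)` of the hemisphere partition function,
where `e^{i t σ} = q^{-iσ}` for `q = e^{-t}`. -/
noncomputable def Brane.integrand {X : AbelianGLSM V} {K : Type} [Fintype K] [DecidableEq K]
    (B : Brane X K) (t σ : ℂ) : ℂ :=
  (∏ v, Gamma (I * X.Q v * σ + X.R v / 2)) * exp (I * t * σ) * B.factor σ

/-- The height of the standard contour over `x`, in the chamber `Re t > 0` spanned by the positive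
weight `Q j₀`: `Q_{j₀} y = |Q_{j₀} x|^k ∏ (1 - e^{-|Q_j x|})`, the product over the other
positive weights. -/
noncomputable def standardHeight [DecidableEq V] (X : AbelianGLSM V) (j₀ : V) (k : ℕ) (x : ℝ) :
    ℝ :=
  (1 / (X.Q j₀ : ℝ)) * (∏ j ∈ Finset.univ.filter (fun j => j ≠ j₀ ∧ 0 < X.Q j),
    (1 - Real.exp (-|(X.Q j : ℝ) * x|))) * |(X.Q j₀ : ℝ) * x| ^ k

/-- An integration contour `{x + i y(x)}` in the chamber `Re t > 0`: a `C¹` graph which agrees with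
the standard contour outside a bounded set and avoids the poles
`Q_v σ = i (R_v / 2 + l)`, `l ≥ 0`, of the Gamma factors by passing on the side
`Q_v y < R_v / 2` of them. -/
structure Contour [DecidableEq V] (X : AbelianGLSM V) where
  y : ℝ → ℝ
  smooth : ContDiff ℝ 1 y
  j₀ : V
  pos : 0 < X.Q j₀
  k : ℕ
  one_le_k : 1 ≤ k
  avoids : ∀ v x, (X.Q v : ℝ) * x = 0 → (X.Q v : ℝ) * y x < (X.R v : ℝ) / 2
  tail : ∃ ρ : ℝ, ∀ x, ρ ≤ |x| → y x = standardHeight X j₀ k x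

/-- The region `Re t ≫ 1`. When the contour is asymptotically linear (`k = 1`), how large `Re t`
has to be for convergence depends on `Im t`. -/
def Contour.InRegion [DecidableEq V] {X : AbelianGLSM V} (L : Contour X) (c : ℝ) (t : ℂ) : Prop :=
  c < t.re ∧ (L.k = 1 → c + |t.im| < t.re)

/-- The pull-back to `ℝ` of the form `integrand dσ` on the contour. -/
noncomputable def Brane.pullback [DecidableEq V] {X : AbelianGLSM V} {K : Type} [Fintype K]
    [DecidableEq K] (B : Brane X K) (L : Contour X) (t : ℂ) (x : ℝ) : ℂ :=
  B.integrand t (x + I * L.y x) * (1 + I * deriv L.y x)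

/-- The hemisphere partition function, or A-period, `Z_B` as a function of `t = -ln q`. -/
noncomputable def Brane.period [DecidableEq V] {X : AbelianGLSM V} {K : Type} [Fintype K]
    [DecidableEq K] (B : Brane X K) (L : Contour X) (t : ℂ) : ℂ :=
  ∫ x : ℝ, B.pullback L t x

end GLSM

/-! ## GKZ systems -/

section GKZ

variable {ι d : Type} [Fintype ι] [DecidableEq ι]

/-- The partial derivative `∂_a`. -/
noncomputable def partialD (a : ι) (f : (ι → ℂ) → ℂ) : (ι → ℂ) → ℂ :=
  fun x => fderiv ℂ f x (Pi.single a 1)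

/-- The multi-index derivative `∂^u` (the order is immaterial for analytic functions). -/
noncomputable def multiPartial (u : ι → ℕ) (f : (ι → ℂ) → ℂ) : (ι → ℂ) → ℂ :=
  (Finset.univ : Finset ι).toList.foldr (fun a g => (partialD a)^[u a] g) f

/-- Holomorphic solutions on the open set `U` of the GKZ system of `A` and `β`. -/
structure IsGKZSolution (A : Matrix d ι ℤ) (β : d → ℂ) (U : Set (ι → ℂ))
    (f : (ι → ℂ) → ℂ) : Prop where
  analytic : AnalyticOnNhd ℂ f U
  box : ∀ u v : ι → ℕ, (∀ i, ∑ a, A i a * (u a : ℤ) = ∑ a, A i a * (v a : ℤ)) →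
    ∀ x ∈ U, multiPartial u f x = multiPartial v f x
  euler : ∀ i, ∀ x ∈ U, ∑ a, (A i a : ℂ) * x a * partialD a f x = β i * f x

/-- The solutions on `U`, as functions on `U`. -/
def gkzSolutions (A : Matrix d ι ℤ) (β : d → ℂ) (U : Set (ι → ℂ)) : Set (U → ℂ) :=
  {g | ∃ f, IsGKZSolution A β U f ∧ ∀ x : U, g x = f x}

end GKZ

/-! ## Double covers of projective space

A nef-partition of the `n + 1` rays of the fan of `ℙⁿ` into `r` blocks is given by the function
`c` which assigns to each ray its block. The index `Sum.inl i` stands for `(i,0)`, and `Sum.inr j`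
for the pair `(i,j')` that belongs to the ray `j`. -/

section ProjectiveSpace

variable {n r : ℕ}

/-- The index set of the variables `x_{i,j}` and `z_{i,j}`, `j ≥ 0`. -/
abbrev Idx (r n : ℕ) : Type := Fin r ⊕ Fin (n + 1)

/-- The index set of the chiral fields: `φ_j` is `Sum.inl j`, and `z_a` is `Sum.inr a`. -/
abbrev Fields (r n : ℕ) : Type := Fin (n + 1) ⊕ Idx r n

/-- The number `m_i` of rays in the block `i`. -/
def blockSize (c : Fin (n + 1) → Fin r) (i : Fin r) : ℕ :=
  (Finset.univ.filter fun j => c j = i).card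

/-- The primitive generators of the rays of `ℙⁿ`: `e_1, …, e_n` and `-(e_1 + ⋯ + e_n)`. -/
def ray (j : Fin (n + 1)) (k : Fin n) : ℤ :=
  if j = Fin.last n then -1 else if j = k.castSucc then 1 else 0

/-- The matrix with columns `(e_i, 0)` and `(e_{c j}, ρ_j)`. -/
def gkzMatrix (c : Fin (n + 1) → Fin r) : Matrix (Fin r ⊕ Fin n) (Idx r n) ℤ
  | Sum.inl i, Sum.inl i' => if i = i' then 1 else 0
  | Sum.inl i, Sum.inr j => if i = c j then 1 else 0
  | Sum.inr _, Sum.inl _ => 0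
  | Sum.inr k, Sum.inr j => ray j k

/-- The exponent `β = (-1/2, …, -1/2, 0, …, 0)`. -/
noncomputable def gkzBeta (r n : ℕ) : Fin r ⊕ Fin n → ℂ
  | Sum.inl _ => -1 / 2
  | Sum.inr _ => 0

/-- The weights `θ_{i,0} = m_i` and `θ_{i,j} = 1`. -/
def theta (c : Fin (n + 1) → Fin r) : Idx r n → ℤ
  | Sum.inl i => blockSize c i
  | Sum.inr _ => 1

/-- The coefficients of the `z_a²` in the superpotential: `φ_j`, and the sections `s_i(φ)`. -/
noncomputable def coeffW (s : Fin r → MvPolynomial (Fin (n + 1)) ℂ) :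
    Idx r n → MvPolynomial (Fields r n) ℂ
  | Sum.inl i => MvPolynomial.rename Sum.inl (s i)
  | Sum.inr j => MvPolynomial.X (Sum.inl j)

/-- The gauge weights: `2` for `φ_j`, and `-θ_a` for `z_a`. -/
def gaugeW (c : Fin (n + 1) → Fin r) : Fields r n → ℤ
  | Sum.inl _ => 2
  | Sum.inr a => -theta c a

/-- The `R`-weights: `0` for `φ_j`, and `1` for `z_a`. -/
def rW : Fields r n → ℤ
  | Sum.inl _ => 0
  | Sum.inr _ => 1

theorem sum_blockSize (c : Fin (n + 1) → Fin r) : ∑ i, blockSize c i = n + 1 := by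
  have := Finset.card_eq_sum_card_fiberwise (f := c) (s := Finset.univ) (t := Finset.univ)
    (fun _ _ => Finset.mem_coe.2 (Finset.mem_univ _))
  simpa [blockSize] using this.symm

theorem scaleVars_X {V : Type} (a : V → ℂ) (v : V) :
    scaleVars a (MvPolynomial.X v) = MvPolynomial.C (a v) * MvPolynomial.X v := by
  simp [scaleVars]

theorem scaleVars_rename (a : Fields r n → ℂ) (b : ℂ) (hb : ∀ j, a (Sum.inl j) = b)
    {P : MvPolynomial (Fin (n + 1)) ℂ} {m : ℕ} (hP : P.IsHomogeneous m) :
    scaleVars a (MvPolynomial.rename Sum.inl P) =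
      MvPolynomial.C (b ^ m) * MvPolynomial.rename Sum.inl P := by
  have h1 : scaleVars a (MvPolynomial.rename Sum.inl P) = MvPolynomial.rename Sum.inl
      (MvPolynomial.aeval (fun j => MvPolynomial.C b * MvPolynomial.X j) P) := by
    rw [scaleVars, MvPolynomial.aeval_rename, MvPolynomial.comp_aeval_apply]
    congr 2
    funext j
    simp [hb]
  rw [h1]
  have h2 : MvPolynomial.aeval (fun j => MvPolynomial.C b * MvPolynomial.X j) P =
      MvPolynomial.C (b ^ m) * P := by
    conv_rhs => rw [P.as_sum]
    conv_lhs => rw [P.as_sum]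
    rw [map_sum, Finset.mul_sum]
    refine Finset.sum_congr rfl fun e he => ?_
    have hdeg : e.degree = m := by
      have := hP (MvPolynomial.mem_support_iff.1 he)
      rwa [Finsupp.degree_eq_weight_one]
    rw [MvPolynomial.aeval_monomial, MvPolynomial.monomial_eq]
    simp only [Finsupp.prod, mul_pow, Finset.prod_mul_distrib]
    rw [Finset.prod_pow_eq_pow_sum, ← hdeg]
    rw [Finsupp.degree_apply]
    simp only [MvPolynomial.algebraMap_eq, map_pow]
    ring
  rw [h2]
  simp

theorem scaleVars_coeffW (c : Fin (n + 1) → Fin r) {s : Fin r → MvPolynomial (Fin (n + 1)) ℂ}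
    (hs : ∀ i, (s i).IsHomogeneous (blockSize c i)) (a : Fields r n → ℂ) (b : ℂ)
    (hb : ∀ j, a (Sum.inl j) = b) (k : Idx r n) :
    scaleVars a (coeffW s k) = MvPolynomial.C (b ^ theta c k) * coeffW s k := by
  cases k with
  | inl i => simpa [theta, coeffW] using scaleVars_rename a b hb (hs i)
  | inr j => simp [theta, coeffW, scaleVars_X, hb]

/-- The GLSM of the double cover of `ℙⁿ`, with superpotential
`W = ∑ z_j² φ_j + ∑ z_{i,0}² s_i(φ)`. -/
noncomputable def doubleCoverGLSM (c : Fin (n + 1) → Fin r)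
    (s : Fin r → MvPolynomial (Fin (n + 1)) ℂ)
    (hs : ∀ i, (s i).IsHomogeneous (blockSize c i)) : AbelianGLSM (Fields r n) where
  Q := gaugeW c
  R := rW
  W := ∑ a, MvPolynomial.X (Sum.inr a) ^ 2 * coeffW s a
  nonanomalous := by
    have h : ∑ i, (blockSize c i : ℤ) = n + 1 := by exact_mod_cast sum_blockSize c
    simp [Fintype.sum_sum_type, gaugeW, theta, h]
    ring
  W_gauge := by
    intro g hg
    rw [map_sum]
    refine Finset.sum_congr rfl fun a _ => ?_
    rw [map_mul, map_pow, scaleVars_X, scaleVars_coeffW c hs _ (g ^ (2 : ℤ)) (fun _ => rfl)]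
    have : (g ^ gaugeW c (Sum.inr a)) ^ 2 * (g ^ (2 : ℤ)) ^ theta c a = 1 := by
      simp only [gaugeW]
      rw [← zpow_natCast, ← zpow_mul, ← zpow_mul, ← zpow_add₀ hg]
      have : -theta c a * ((2 : ℕ) : ℤ) + 2 * theta c a = 0 := by push_cast; ring
      rw [this, zpow_zero]
    calc _ = MvPolynomial.C ((g ^ gaugeW c (Sum.inr a)) ^ 2 * (g ^ (2 : ℤ)) ^ theta c a) *
          (MvPolynomial.X (Sum.inr a) ^ 2 * coeffW s a) := by
            rw [MvPolynomial.C_mul, MvPolynomial.C_pow]; ring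
      _ = _ := by rw [this]; simp
  W_R := by
    intro l hl
    rw [map_sum, Finset.mul_sum]
    refine Finset.sum_congr rfl fun a _ => ?_
    rw [map_mul, map_pow, scaleVars_X, scaleVars_coeffW c hs _ 1 (fun _ => by simp [rW])]
    simp [rW]
    ring

/-! The fermionic Fock space: the subset `S` of `Idx r n` stands for the basis vector
`\bar η_S v`, the product taken in increasing order. -/

/-- The sign `(-1)^{#{b ∈ S, b < a}}`. -/
def fockSign (a : Idx r n) (S : Finset (Idx r n)) : ℤ :=
  (-1) ^ (S.filter fun b => finSumFinEquiv b < finSumFinEquiv a).card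

/-- The matrix of `\bar η_a`, exterior multiplication by the basis vector `a`. -/
def etaBar (A : Type) [CommRing A] (a : Idx r n) :
    Matrix (Finset (Idx r n)) (Finset (Idx r n)) A :=
  fun S' S => if a ∉ S ∧ S' = insert a S then ((fockSign a S : ℤ) : A) else 0

/-- The matrix of `η_a`, contraction with the basis vector `a`. -/
def etaMat (A : Type) [CommRing A] (a : Idx r n) :
    Matrix (Finset (Idx r n)) (Finset (Idx r n)) A :=
  (etaBar A a).transpose

theorem mul_etaBar {A : Type} [CommRing A] (M : Matrix (Finset (Idx r n)) (Finset (Idx r n)) A)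
    (a : Idx r n) (S' S : Finset (Idx r n)) :
    (M * etaBar A a) S' S = if a ∈ S then 0 else M S' (insert a S) * (fockSign a S : ℤ) := by
  rw [Matrix.mul_apply]
  by_cases h : a ∈ S
  · simp [etaBar, h]
  · simp [etaBar, h]

theorem fockSign_insert_self (a : Idx r n) (S : Finset (Idx r n)) :
    fockSign a (insert a S) = fockSign a S := by
  simp [fockSign, Finset.filter_insert]

theorem fockSign_erase_self (a : Idx r n) (S : Finset (Idx r n)) :
    fockSign a (S.erase a) = fockSign a S := by
  by_cases h : a ∈ S
  · conv_rhs => rw [← Finset.insert_erase h, fockSign_insert_self]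
  · rw [Finset.erase_eq_of_notMem h]

theorem mul_etaMat {A : Type} [CommRing A] (M : Matrix (Finset (Idx r n)) (Finset (Idx r n)) A)
    (a : Idx r n) (S' S : Finset (Idx r n)) :
    (M * etaMat A a) S' S = if a ∈ S then M S' (S.erase a) * (fockSign a S : ℤ) else 0 := by
  rw [Matrix.mul_apply]
  by_cases h : a ∈ S
  · rw [if_pos h, Finset.sum_eq_single (S.erase a)]
    · simp [etaMat, etaBar, Finset.insert_erase h, fockSign_erase_self]
    · intro K _ hK
      have : ¬ (a ∉ K ∧ S = insert a K) := by
        rintro ⟨h1, rfl⟩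
        exact hK (Finset.erase_insert h1).symm
      simp [etaMat, etaBar, this]
    · simp
  · rw [if_neg h]
    refine Finset.sum_eq_zero fun K _ => ?_
    have : ¬ (a ∉ K ∧ S = insert a K) := by
      rintro ⟨_, rfl⟩
      exact h (Finset.mem_insert_self _ _)
    simp [etaMat, etaBar, this]

theorem fockSign_insert {a b : Idx r n} {S : Finset (Idx r n)} (hb : b ∉ S) :
    fockSign a (insert b S) =
      (if finSumFinEquiv b < finSumFinEquiv a then -1 else 1) * fockSign a S := by
  unfold fockSign
  rw [Finset.filter_insert]
  split_ifs with h
  · rw [Finset.card_insert_of_notMem (by simp [hb]), pow_succ]; ring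
  · simp

theorem fockSign_sq (a : Idx r n) (S : Finset (Idx r n)) :
    fockSign a S * fockSign a S = 1 := by
  rw [fockSign, ← mul_pow]; simp

theorem fockSign_swap {a b : Idx r n} (hab : a ≠ b) {S : Finset (Idx r n)} (ha : a ∉ S)
    (hb : b ∉ S) : fockSign a (insert b S) * fockSign b S =
      -(fockSign b (insert a S) * fockSign a S) := by
  rw [fockSign_insert hb, fockSign_insert ha]
  have hne : finSumFinEquiv a ≠ finSumFinEquiv b := fun h => hab (finSumFinEquiv.injective h)
  rcases lt_or_gt_of_ne hne with h | h
  · simp [h, not_lt.2 h.le]; ring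
  · simp [h, not_lt.2 h.le]; ring

theorem etaBar_anticomm (A : Type) [CommRing A] (a b : Idx r n) :
    etaBar A a * etaBar A b + etaBar A b * etaBar A a = 0 := by
  ext S' S
  rw [Matrix.add_apply, mul_etaBar, mul_etaBar, Matrix.zero_apply]
  by_cases hab : a = b
  · subst hab; simp [etaBar]
  by_cases ha : a ∈ S
  · simp [etaBar, ha]
  by_cases hb : b ∈ S
  · simp [etaBar, hb]
  have hba : b ≠ a := fun h => hab h.symm
  simp only [etaBar, ha, hb, Finset.mem_insert, hab, hba, or_self, not_false_eq_true, true_and,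
    if_false, Finset.insert_comm b a S]
  by_cases h : S' = insert a (insert b S)
  · simp only [h, if_true]
    have := fockSign_swap hab ha hb
    rw [← Int.cast_mul, ← Int.cast_mul, ← Int.cast_add, this]
    simp
  · simp [h]

theorem etaMat_anticomm (A : Type) [CommRing A] (a b : Idx r n) :
    etaMat A a * etaMat A b + etaMat A b * etaMat A a = 0 := by
  have := congrArg Matrix.transpose (etaBar_anticomm A b a)
  simpa [etaMat, Matrix.transpose_mul] using this

theorem etaMat_etaBar (A : Type) [CommRing A] (a b : Idx r n) :
    etaMat A a * etaBar A b + etaBar A b * etaMat A a = if a = b then 1 else 0 := by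
  ext S' S
  rw [Matrix.add_apply, mul_etaBar, mul_etaMat]
  by_cases hab : a = b
  · subst hab
    by_cases ha : a ∈ S
    · by_cases h : S' = S
      · subst h
        simp only [ha, if_true, etaBar, Finset.notMem_erase, not_false_eq_true,
          Finset.insert_erase, true_and, fockSign_erase_self]
        rw [← Int.cast_mul, fockSign_sq]; simp
      · simp [ha, etaBar, Finset.insert_erase, h]
    · by_cases h : S' = S
      · subst h
        simp only [ha, if_false, etaMat, Matrix.transpose_apply, etaBar, not_false_eq_true,
          true_and, if_true]
        rw [← Int.cast_mul, fockSign_sq]; simp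
      · have h2 : ¬ (a ∉ S' ∧ insert a S = insert a S') := by
          rintro ⟨h3, h4⟩
          have := congrArg (fun K => Finset.erase K a) h4
          simp only [Finset.erase_insert ha, Finset.erase_insert h3] at this
          exact h this.symm
        simp [ha, etaMat, etaBar, h2, h]
  · have hba : b ≠ a := fun h => hab h.symm
    simp only [hab, if_false, Matrix.zero_apply]
    by_cases hb : b ∈ S
    · simp [hb, etaBar, hba]
    by_cases ha : a ∈ S
    · simp only [hb, ha, if_false, if_true, etaMat, Matrix.transpose_apply, etaBar,
        Finset.mem_erase, and_false, not_false_eq_true, true_and]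
      have hb1 : b ∉ S.erase a := by simp [hb]
      have key : (a ∉ S' ∧ insert b S = insert a S') ↔ S' = insert b (S.erase a) := by
        constructor
        · rintro ⟨h1, h2⟩
          have := congrArg (fun K => Finset.erase K a) h2
          simp only [Finset.erase_insert h1] at this
          rw [← this, Finset.erase_insert_of_ne hba]
        · rintro rfl
          refine ⟨by simp [hab], ?_⟩
          rw [Finset.insert_comm, Finset.insert_erase ha]
      simp only [key]
      by_cases h : S' = insert b (S.erase a)
      · simp only [h, if_true]
        have hs := fockSign_swap hab (S := S.erase a) (by simp) hb1
        rw [Finset.insert_erase ha] at hs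
        have h3 : fockSign a S = fockSign a (S.erase a) := (fockSign_erase_self a S).symm
        have e1 := fockSign_sq a (S.erase a)
        have e2 := fockSign_sq b (S.erase a)
        rw [← Int.cast_mul, ← Int.cast_mul, ← Int.cast_add, h3]
        have : fockSign a (insert b (S.erase a)) * fockSign b S +
            fockSign b (S.erase a) * fockSign a (S.erase a) = 0 := by
          have e3 : fockSign a (insert b (S.erase a)) =
              -(fockSign b S * fockSign a (S.erase a)) * fockSign b (S.erase a) := by
            rw [← hs, mul_assoc, e2, mul_one]
          have e4 := fockSign_sq b S
          rw [e3]
          linear_combination (-(fockSign a (S.erase a) * fockSign b (S.erase a))) * e4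
        rw [this]; simp
      · simp [h]
    · have h2 : ¬ (a ∉ S' ∧ insert b S = insert a S') := by
        rintro ⟨_, h4⟩
        have : a ∈ insert b S := by rw [h4]; exact Finset.mem_insert_self _ _
        rw [Finset.mem_insert] at this
        rcases this with h | h
        · exact hab h
        · exact ha h
      simp [hb, ha, etaMat, etaBar, h2]

/-- The subset `J` of the rays, as a set of indices. -/
def raySet (r : ℕ) (J : Finset (Fin (n + 1))) : Finset (Idx r n) :=
  J.map Function.Embedding.inr

/-- The coefficient of `η_a` in `T_J`: `z_a²` for `a ∈ J`, and `z_a` otherwise. -/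
noncomputable def coeffEta (J : Finset (Fin (n + 1))) (a : Idx r n) :
    MvPolynomial (Fields r n) ℂ :=
  if a ∈ raySet r J then MvPolynomial.X (Sum.inr a) ^ 2 else MvPolynomial.X (Sum.inr a)

/-- The coefficient of `\bar η_a` in `T_J`: `φ_a` for `a ∈ J`, and otherwise `z_a φ_a`, or
`z_a s_i(φ)` for `a = (i,0)`. -/
noncomputable def coeffEtaBar (s : Fin r → MvPolynomial (Fin (n + 1)) ℂ)
    (J : Finset (Fin (n + 1))) (a : Idx r n) : MvPolynomial (Fields r n) ℂ :=
  if a ∈ raySet r J then coeffW s a else MvPolynomial.X (Sum.inr a) * coeffW s a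

/-- The matrix factorization `T_J`. -/
noncomputable def tachyon (s : Fin r → MvPolynomial (Fin (n + 1)) ℂ)
    (J : Finset (Fin (n + 1))) :
    Matrix (Finset (Idx r n)) (Finset (Idx r n)) (MvPolynomial (Fields r n) ℂ) :=
  ∑ a, (coeffEta J a • etaMat _ a + coeffEtaBar s J a • etaBar _ a)

/-- The gauge weight of `\bar η_S v`, where `v` has weight zero. -/
def fockGauge (c : Fin (n + 1) → Fin r) (J : Finset (Fin (n + 1)))
    (S : Finset (Idx r n)) : ℤ :=
  ∑ a ∈ S, if a ∈ raySet r J then 2 * theta c a else theta c a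

/-- The `R`-weight of `\bar η_S v`, where `v` has weight zero. -/
def fockR (J : Finset (Fin (n + 1))) (S : Finset (Idx r n)) : ℤ :=
  ∑ a ∈ S, if a ∈ raySet r J then 1 else 0

theorem sum_smul_mul_sum_smul {κ S A : Type} [Fintype κ] [Fintype S] [CommRing A]
    (p q : κ → A) (e f : κ → Matrix S S A) :
    (∑ a, p a • e a) * (∑ a, q a • f a) = ∑ a, ∑ b, (p a * q b) • (e a * f b) := by
  simp only [Finset.sum_mul_sum, smul_mul_smul_comm]

theorem sq_sum_smul_eq_zero {κ S : Type} [Fintype κ] [Fintype S] {V : Type}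
    (p : κ → MvPolynomial V ℂ) (e : κ → Matrix S S (MvPolynomial V ℂ))
    (he : ∀ a b, e a * e b + e b * e a = 0) : (∑ a, p a • e a) * (∑ a, p a • e a) = 0 := by
  have h := sum_smul_mul_sum_smul p p e e
  have h3 : (∑ a, ∑ b, (p a * p b) • (e a * e b)) = -∑ a, ∑ b, (p a * p b) • (e a * e b) := by
    conv_lhs => rw [Finset.sum_comm]
    simp only [← Finset.sum_neg_distrib]
    refine Finset.sum_congr rfl fun a _ => Finset.sum_congr rfl fun b _ => ?_
    rw [eq_neg_of_add_eq_zero_left (he b a), mul_comm (p b), smul_neg]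
  rw [h]
  apply Matrix.ext
  intro S' S
  have h4 := congrFun (congrFun h3 S') S
  rw [Matrix.neg_apply] at h4
  rw [Matrix.zero_apply]
  exact self_eq_neg.1 h4

theorem tachyon_sq (s : Fin r → MvPolynomial (Fin (n + 1)) ℂ) (J : Finset (Fin (n + 1))) :
    tachyon s J * tachyon s J = (∑ a, MvPolynomial.X (Sum.inr a) ^ 2 * coeffW s a) •
      (1 : Matrix (Finset (Idx r n)) (Finset (Idx r n)) (MvPolynomial (Fields r n) ℂ)) := by
  have hpq : ∀ a : Idx r n, coeffEta J a * coeffEtaBar s J a =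
      MvPolynomial.X (Sum.inr a) ^ 2 * coeffW s a := by
    intro a
    unfold coeffEta coeffEtaBar
    split_ifs <;> ring
  have hxx := sq_sum_smul_eq_zero (coeffEta J)
    (fun a : Idx r n => etaMat (MvPolynomial (Fields r n) ℂ) a) (etaMat_anticomm _)
  have hyy := sq_sum_smul_eq_zero (coeffEtaBar s J)
    (fun a : Idx r n => etaBar (MvPolynomial (Fields r n) ℂ) a) (etaBar_anticomm _)
  have hxy : (∑ a : Idx r n, coeffEta J a • etaMat (MvPolynomial (Fields r n) ℂ) a) *
        (∑ a, coeffEtaBar s J a • etaBar _ a) +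
      (∑ a, coeffEtaBar s J a • etaBar _ a) * (∑ a, coeffEta J a • etaMat _ a) =
      (∑ a, coeffEta J a * coeffEtaBar s J a) • 1 := by
    rw [sum_smul_mul_sum_smul, sum_smul_mul_sum_smul]
    conv_lhs => enter [2]; rw [Finset.sum_comm]
    rw [← Finset.sum_add_distrib, Finset.sum_smul]
    refine Finset.sum_congr rfl fun a _ => ?_
    rw [← Finset.sum_add_distrib, Finset.sum_eq_single a]
    · rw [mul_comm (coeffEtaBar s J a), ← smul_add, etaMat_etaBar, if_pos rfl]
    · intro b _ hb
      rw [mul_comm (coeffEtaBar s J b), ← smul_add, etaMat_etaBar, if_neg (Ne.symm hb), smul_zero]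
    · simp
  have hT : tachyon s J = (∑ a : Idx r n, coeffEta J a • etaMat _ a) +
      ∑ a : Idx r n, coeffEtaBar s J a • etaBar _ a :=
    Finset.sum_add_distrib
  rw [hT, add_mul, mul_add, mul_add, hxx, hyy, zero_add, add_zero, hxy]
  simp only [hpq]

theorem tachyon_apply (s : Fin r → MvPolynomial (Fin (n + 1)) ℂ) (J : Finset (Fin (n + 1)))
    (S' S : Finset (Idx r n)) :
    tachyon s J S' S = ∑ a, (coeffEta J a * etaMat _ a S' S +
      coeffEtaBar s J a * etaBar _ a S' S) := by
  simp [tachyon, Matrix.sum_apply]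

/-- Equivariance of `T_J`: if the coefficients of `η_a` and `\bar η_a` are scaled by `l u_a⁻¹` and
`l u_a`, the twist by the diagonal matrix with entries `∏_{a ∈ S} u_a` absorbs this up to `l`. -/
theorem tachyon_twist (s : Fin r → MvPolynomial (Fin (n + 1)) ℂ) (J : Finset (Fin (n + 1)))
    (x : Fields r n → ℂ) (D E : Finset (Idx r n) → ℂ) (l : ℂ) (u : Idx r n → ℂ)
    (hu : ∀ a, u a ≠ 0)
    (h1 : ∀ a, scaleVars x (coeffEta J a) = MvPolynomial.C (l * (u a)⁻¹) * coeffEta J a)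
    (h2 : ∀ a, scaleVars x (coeffEtaBar s J a) =
      MvPolynomial.C (l * u a) * coeffEtaBar s J a)
    (hDE : ∀ S, D S * E S = 1)
    (hE : ∀ a S, a ∉ S → E (insert a S) = E S * u a) :
    (Matrix.diagonal D).map MvPolynomial.C * (tachyon s J).map (scaleVars x) *
      (Matrix.diagonal E).map MvPolynomial.C =
      (MvPolynomial.C l : MvPolynomial (Fields r n) ℂ) • tachyon s J := by
  have hd : ∀ d : Finset (Idx r n) → ℂ, (Matrix.diagonal d).map MvPolynomial.C =
      Matrix.diagonal fun S => (MvPolynomial.C (d S) : MvPolynomial (Fields r n) ℂ) := by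
    intro d
    exact Matrix.diagonal_map (map_zero _)
  rw [hd, hd]
  refine Matrix.ext fun S' S => ?_
  rw [Matrix.mul_diagonal, Matrix.diagonal_mul, Matrix.map_apply, Matrix.smul_apply,
    tachyon_apply, map_sum, Finset.mul_sum, Finset.sum_mul, smul_eq_mul, Finset.mul_sum]
  refine Finset.sum_congr rfl fun a _ => ?_
  have hsc : ∀ K K', scaleVars x (etaBar (MvPolynomial (Fields r n) ℂ) a K K') =
      etaBar (MvPolynomial (Fields r n) ℂ) a K K' := by
    intro K K'
    unfold etaBar
    split_ifs <;> simp
  have e1 : MvPolynomial.C (D S' * (l * (u a)⁻¹) * E S) * etaMat (MvPolynomial (Fields r n) ℂ) a S' S =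
      MvPolynomial.C l * etaMat (MvPolynomial (Fields r n) ℂ) a S' S := by
    by_cases h : a ∉ S' ∧ S = insert a S'
    · have : D S' * (l * (u a)⁻¹) * E S = l := by
        rw [h.2, hE a S' h.1]
        have := hDE S'
        have hua := hu a
        field_simp
        linear_combination l * this
      rw [this]
    · simp [etaMat, etaBar, h]
  have e2 : MvPolynomial.C (D S' * (l * u a) * E S) * etaBar (MvPolynomial (Fields r n) ℂ) a S' S =
      MvPolynomial.C l * etaBar (MvPolynomial (Fields r n) ℂ) a S' S := by
    by_cases h : a ∉ S ∧ S' = insert a S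
    · have : D S' * (l * u a) * E S = l := by
        have := hDE S'
        rw [h.2, hE a S h.1] at this
        rw [h.2]
        linear_combination l * this
      rw [this]
    · simp [etaBar, h]
  rw [map_add, map_mul, map_mul, h1, h2, hsc]
  have hsc2 : scaleVars x (etaMat (MvPolynomial (Fields r n) ℂ) a S' S) =
      etaMat (MvPolynomial (Fields r n) ℂ) a S' S := hsc S S'
  rw [hsc2]
  simp only [MvPolynomial.C_mul] at e1 e2 ⊢
  linear_combination coeffEta J a * e1 + coeffEtaBar s J a * e2

theorem zpow_sum_insert (w : Idx r n → ℤ) {g : ℂ} (hg : g ≠ 0) {a : Idx r n}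
    {S : Finset (Idx r n)} (ha : a ∉ S) :
    g ^ (∑ b ∈ insert a S, w b) = g ^ (∑ b ∈ S, w b) * g ^ w a := by
  rw [Finset.sum_insert ha, zpow_add₀ hg, mul_comm]

/-- The brane `𝔅_J`. -/
noncomputable def braneOf (c : Fin (n + 1) → Fin r) (s : Fin r → MvPolynomial (Fin (n + 1)) ℂ)
    (hs : ∀ i, (s i).IsHomogeneous (blockSize c i)) (J : Finset (Fin (n + 1))) :
    Brane (doubleCoverGLSM c s hs) (Finset (Idx r n)) where
  parity S := S.card
  wG := fockGauge c J
  wR := fockR J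
  T := tachyon s J
  odd := by
    intro S' S h
    rw [tachyon_apply] at h
    obtain ⟨a, _, ha⟩ := Finset.exists_ne_zero_of_sum_ne_zero h
    by_cases h1 : a ∉ S ∧ S' = insert a S
    · rw [h1.2, Finset.card_insert_of_notMem h1.1]
      push_cast
      ring
    · by_cases h2 : a ∉ S' ∧ S = insert a S'
      · rw [h2.2, Finset.card_insert_of_notMem h2.1]
        push_cast
        rw [add_assoc, show (1 : ZMod 2) + 1 = 0 from rfl, add_zero]
      · simp [etaMat, etaBar, h1, h2] at ha
  sq := tachyon_sq s J
  gauge := by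
    intro g hg
    have key := tachyon_twist s J (fun v => g ^ gaugeW c v)
      (fun S => g⁻¹ ^ fockGauge c J S) (fun S => g ^ fockGauge c J S) 1
      (fun a => g ^ (if a ∈ raySet r J then 2 * theta c a else theta c a))
      (fun a => zpow_ne_zero _ hg) ?_ ?_ ?_ ?_
    · rw [map_one, one_smul] at key
      exact key
    · intro a
      unfold coeffEta
      split_ifs with h
      · rw [map_pow, scaleVars_X, one_mul, mul_pow, ← MvPolynomial.C_pow]
        congr 2
        rw [← zpow_neg, ← zpow_natCast, ← zpow_mul]
        congr 1
        simp only [gaugeW]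
        push_cast
        ring
      · rw [scaleVars_X, one_mul, ← zpow_neg]
        rfl
    · intro a
      unfold coeffEtaBar
      have hc := scaleVars_coeffW c hs (fun v => g ^ gaugeW c v) (g ^ (2 : ℤ)) (fun _ => rfl) a
      split_ifs with h
      · rw [hc, one_mul, ← zpow_mul]
      · rw [map_mul, hc, scaleVars_X, one_mul]
        have : g ^ theta c a = g ^ gaugeW c (Sum.inr a) * (g ^ (2 : ℤ)) ^ theta c a := by
          rw [← zpow_mul, ← zpow_add₀ hg]
          congr 1
          simp only [gaugeW]
          ring
        rw [this, MvPolynomial.C_mul]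
        ring
    · intro S
      rw [← mul_zpow, inv_mul_cancel₀ hg, one_zpow]
    · intro a S ha
      exact zpow_sum_insert _ hg ha
  rSymm := by
    intro l hl
    have key := tachyon_twist s J (fun v => l ^ rW v)
      (fun S => l ^ fockR J S) (fun S => l⁻¹ ^ fockR J S) l
      (fun a => l⁻¹ ^ (if a ∈ raySet r J then (1 : ℤ) else 0))
      (fun a => zpow_ne_zero _ (inv_ne_zero hl)) ?_ ?_ ?_ ?_
    · exact key
    · intro a
      unfold coeffEta
      split_ifs with h
      · rw [map_pow, scaleVars_X]
        simp [rW]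
        ring
      · rw [scaleVars_X]
        simp [rW]
    · intro a
      unfold coeffEtaBar
      have hc := scaleVars_coeffW c hs (fun v => l ^ rW v) 1 (fun _ => by simp [rW]) a
      split_ifs with h
      · rw [hc]
        simp [mul_inv_cancel₀ hl]
      · rw [map_mul, hc, scaleVars_X]
        simp [rW]
        ring
    · intro S
      rw [← mul_zpow, mul_inv_cancel₀ hl, one_zpow]
    · intro a S ha
      exact zpow_sum_insert _ (inv_ne_zero hl) ha

/-- The change of variables `q = ∏ (-4 x_{i,j}) ∏ x_{i,0}^{-m_i}`. -/
noncomputable def qOf (c : Fin (n + 1) → Fin r) (x : Idx r n → ℂ) : ℂ :=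
  (∏ j, (-4 * x (Sum.inr j))) * ∏ i, (x (Sum.inl i) ^ blockSize c i)⁻¹

/-- The normalized A-period `(∏ x_{i,0})^{-1/2} Z_{𝔅_J}(q)` on `U`, with respect to the branches
`t` of `-ln q` and `w` of `(∏ x_{i,0})^{1/2}`. -/
noncomputable def hatZ {c : Fin (n + 1) → Fin r} {s : Fin r → MvPolynomial (Fin (n + 1)) ℂ}
    {hs : ∀ i, (s i).IsHomogeneous (blockSize c i)} (L : Contour (doubleCoverGLSM c s hs))
    (U : Set (Idx r n → ℂ)) (t w : (Idx r n → ℂ) → ℂ) (J : Finset (Fin (n + 1))) : U → ℂ :=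
  fun x => (w x)⁻¹ * (braneOf c s hs J).period L (t x)

end ProjectiveSpace

/-! ## Gauss multiplication and bounds for quotients of Gamma functions -/

/-! Put z = iσ, e = e^{2πσ} and m = |J|. The trace over the Fock space factors, so the brane factor
is (1 - e)^m (1 + e)^{n+1} ∏ (1 + e^{m_i}). By the reflection formula, a factor 1 + e^{m_i} turns
Γ(1/2 - m_i z) into 1/Γ(1/2 + m_i z) up to an exponential; likewise for the n + 1 factors 1 + e,
after which the duplication formula simplifies Γ(2z)/Γ(1/2 + z). What remains (`integrand_braneOf`)
is, up to a constant and an exponential, K(z) (1 - e)^m e^{itσ} with K(z) = ∏ Γ(z)^{m_i} / Γ(1/2 +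
m_i z). Its only poles are σ = il, l ≥ 0.

Gauss multiplication and a beta integral show that K grows at most exponentially in Im σ away from
the poles (`exists_norm_Gamma_pow_le`). For Re t large the factor e^{itσ} wins, both on the tails of
the contour and on the horizontal lines Im σ = N - 1/2, and the contour integral becomes the sum
over the enclosed poles (`integrable_and_tendsto_sum_circleIntegral`). At σ = 0 the pole of order n
+ 1 of K meets the zero of order m of (1 - e)^m, and the residue is a polynomial in t of degree n -
m (`exists_polynomial_leading_term`).

The functional equation P(z + 1) K(z + 1) = z^{n+1} K(z) (`blockPoly_mul_gammaKernel`) lets the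
circle around i(l + 1) be moved to the one around il. This yields a hypergeometric equation of order
n + 1 in t (`circleSum_shift`). For functions w⁻¹ g(t), with w² = ∏ x_{i,0}, the Euler equations
hold automatically, and since the relations between the columns of A form a lattice of rank one, the
shift equations give all box equations (`isGKZSolution_circleSum`).

As t → +∞ along the reals only the terms l = 0 survive; their degrees n - m are distinct for m = 0,
…, n, hence independence (`eq_zero_of_sum_circleSum_eq_zero`). Conversely, the Euler equations force
every solution to be w⁻¹ g(t) locally, and one box equation is an ordinary differential equation of
order n + 1 for g, nonsingular for Re t large. A solution is therefore determined by n + 1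
derivatives at one point (`IsGKZSolution.eqOn_zero`), so the solution space has dimension at most n
+ 1. -/

/-- Bohr–Mollerup: the right side, normalized at s = 1, is log-convex and satisfies the functional
equation of Γ. The constant is left unevaluated, since only bounds are drawn from the formula. -/
theorem Real.exists_prod_Gamma_eq (m : ℕ) (hm : m ≠ 0) :
    ∃ c : ℝ, 0 < c ∧ ∀ s : ℝ, 0 < s →
      Real.Gamma s = c⁻¹ * ((m : ℝ) ^ s * ∏ k ∈ Finset.range m, Real.Gamma ((s + k) / m)) := by
  have hm0 : (0 : ℝ) < m := by exact_mod_cast Nat.pos_of_ne_zero hm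
  set g : ℝ → ℝ := fun s => (m : ℝ) ^ s * ∏ k ∈ Finset.range m, Real.Gamma ((s + k) / m) with hg
  have hpos : ∀ {s : ℝ}, 0 < s → 0 < g s := by
    intro s hs
    refine mul_pos (Real.rpow_pos_of_pos hm0 _) (Finset.prod_pos fun k _ => ?_)
    exact Real.Gamma_pos_of_pos (by positivity)
  have hc := hpos one_pos
  refine ⟨g 1, hc, fun s hs => ?_⟩
  symm
  refine Real.eq_Gamma_of_log_convex (f := fun s => (g 1)⁻¹ * g s) ?_ ?_ ?_ ?_ hs
  · have hlog : Set.EqOn (fun s => (∑ k ∈ Finset.range m, Real.log (Real.Gamma ((s + k) / m))) +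
        s * Real.log m + Real.log (g 1)⁻¹) (Real.log ∘ fun s => (g 1)⁻¹ * g s) (Set.Ioi 0) := by
      intro x hx
      have hx : 0 < x := hx
      have hne : ∀ k ∈ Finset.range m, Real.Gamma ((x + k) / m) ≠ 0 := fun k _ =>
        (Real.Gamma_pos_of_pos (by positivity)).ne'
      simp only [Function.comp]
      rw [Real.log_mul (inv_ne_zero hc.ne') (hpos hx).ne', hg]
      simp only
      rw [Real.log_mul (Real.rpow_pos_of_pos hm0 _).ne' (Finset.prod_ne_zero_iff.2 hne),
        Real.log_prod hne, Real.log_rpow hm0]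
      ring
    refine (((?_ : ConvexOn ℝ _ _).add ?_).add_const _).congr hlog
    -- The number N of factors is decoupled from the denominator m, so that the induction leaves the
    -- arguments of Γ alone.
    · have : ∀ N : ℕ, ConvexOn ℝ (Set.Ioi (0 : ℝ))
          (fun s => ∑ k ∈ Finset.range N, Real.log (Real.Gamma ((s + k) / m))) := by
        intro N
        induction N with
        | zero => simpa using convexOn_const (0 : ℝ) (convex_Ioi (0 : ℝ))
        | succ N ih =>
          simp only [Finset.sum_range_succ]
          refine ih.add ?_
          refine ⟨convex_Ioi _, fun x hx y hy a b ha hb hab => ?_⟩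
          have hx : 0 < x := hx
          have hy : 0 < y := hy
          have h := Real.convexOn_log_Gamma.2 (x := (x + N) / m) (y := (y + N) / m)
            (show (0 : ℝ) < _ by positivity) (show (0 : ℝ) < _ by positivity) ha hb hab
          have e : (a • x + b • y + N) / m = a • ((x + N) / m) + b • ((y + N) / m) := by
            simp only [smul_eq_mul]
            field_simp
            linear_combination (-(N : ℝ)) * hab
          change Real.log (Real.Gamma ((a • x + b • y + N) / m)) ≤ _
          rw [e]
          exact h
      exact this m
    · refine ⟨convex_Ioi _, fun x hx y hy a b ha hb hab => le_of_eq ?_⟩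
      simp only [smul_eq_mul]
      ring
  · intro y hy
    have h1 : ∏ k ∈ Finset.range m, Real.Gamma ((y + 1 + k) / m) =
        y / m * ∏ k ∈ Finset.range m, Real.Gamma ((y + k) / m) := by
      have h2 := Finset.prod_range_succ' (fun k : ℕ => Real.Gamma ((y + k) / m)) m
      rw [Finset.prod_range_succ] at h2
      have h3 : Real.Gamma ((y + m) / m) = y / m * Real.Gamma (y / m) := by
        rw [add_div, div_self hm0.ne', Real.Gamma_add_one (by positivity)]
      have h4 : Real.Gamma (y / m) ≠ 0 := (Real.Gamma_pos_of_pos (by positivity)).ne'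
      have h5 : ∀ k ∈ Finset.range m, Real.Gamma ((y + 1 + k) / m) =
          Real.Gamma ((y + (k + 1 : ℕ)) / m) := by
        intro k _
        congr 2
        push_cast
        ring
      rw [Finset.prod_congr rfl h5]
      simp only [h3, Nat.cast_zero, add_zero] at h2
      apply mul_right_cancel₀ h4
      rw [← h2]
      ring
    simp only [hg]
    rw [h1, Real.rpow_add hm0, Real.rpow_one]
    field_simp
  · intro y hy
    exact mul_pos (inv_pos.2 hc) (hpos hy)
  · exact inv_mul_cancel₀ hc.ne'

/-- Identity theorem: both sides are entire, which is why reciprocals are used, and they agree on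
the positive reals, which accumulate at 1. -/
theorem Complex.exists_inv_Gamma_eq_prod (m : ℕ) (hm : m ≠ 0) :
    ∃ c : ℂ, ∀ s : ℂ, (Gamma s)⁻¹ =
      c * ((m : ℂ) ^ (-s) * ∏ k ∈ Finset.range m, (Gamma ((s + k) / m))⁻¹) := by
  obtain ⟨c, hc, h⟩ := Real.exists_prod_Gamma_eq m hm
  refine ⟨c, fun s => ?_⟩
  have hm0 : (m : ℂ) ≠ 0 := by exact_mod_cast hm
  have h1 : AnalyticOnNhd ℂ (fun z : ℂ => (Gamma z)⁻¹) Set.univ :=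
    differentiable_one_div_Gamma.differentiableOn.analyticOnNhd isOpen_univ
  have h2 : AnalyticOnNhd ℂ (fun s : ℂ => (c : ℂ) * ((m : ℂ) ^ (-s) *
      ∏ k ∈ Finset.range m, (Gamma ((s + k) / m))⁻¹)) Set.univ := by
    refine DifferentiableOn.analyticOnNhd (Differentiable.differentiableOn ?_) isOpen_univ
    refine (differentiable_const _).mul (Differentiable.mul ?_ ?_)
    · exact fun t => DifferentiableAt.const_cpow (by fun_prop) (Or.inl hm0)
    · refine Differentiable.fun_finsetProd fun k _ => ?_
      exact differentiable_one_div_Gamma.comp (by fun_prop : Differentiable ℂ fun s : ℂ => (s + k) / m)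
  have h3 : Filter.Tendsto ((↑) : ℝ → ℂ) (nhdsWithin 1 {1}ᶜ) (nhdsWithin 1 {1}ᶜ) := by
    rw [tendsto_nhdsWithin_iff]; constructor
    · exact tendsto_nhdsWithin_of_tendsto_nhds continuous_ofReal.continuousAt
    · exact eventually_nhdsWithin_iff.mpr
        (Filter.Eventually.of_forall fun t ht => ofReal_ne_one.mpr ht)
  refine congrFun (AnalyticOnNhd.eq_of_frequently_eq h1 h2 (h3.frequently ?_)) s
  refine ((Filter.Eventually.filter_mono nhdsWithin_le_nhds) ?_).frequently
  refine (eventually_gt_nhds zero_lt_one).mp (Filter.Eventually.of_forall fun t ht => ?_)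
  have h4 : ∀ k : ℕ, Gamma (((t : ℂ) + k) / m) = ((Real.Gamma ((t + k) / m) : ℝ) : ℂ) := by
    intro k
    rw [← Gamma_ofReal]
    push_cast
    rfl
  have h5 : (m : ℂ) ^ (-(t : ℂ)) = (((m : ℝ) ^ (-t) : ℝ) : ℂ) := by
    rw [ofReal_cpow (by positivity)]
    push_cast
    rfl
  simp only [h4, h5]
  rw [Gamma_ofReal, h t ht, Real.rpow_neg (by positivity)]
  push_cast
  rw [mul_inv, mul_inv, inv_inv, Finset.prod_inv_distrib]

/-- The modulus of the integrand depends only on the real parts of u and v and decreases in them,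
because x and 1 - x lie in (0, 1). The bound is thus uniform in the imaginary parts. -/
theorem Complex.norm_betaIntegral_le {u v : ℂ} {p q : ℝ} (hp : 0 < p) (hq : 0 < q) (hu : p ≤ u.re)
    (hv : q ≤ v.re) : ‖betaIntegral u v‖ ≤ ∫ x in (0 : ℝ)..1, x ^ (p - 1) * (1 - x) ^ (q - 1) := by
  have hint := betaIntegral_convergent (u := (p : ℂ)) (v := (q : ℂ)) (by simpa) (by simpa)
  have key : ∀ x ∈ Set.Ioo (0 : ℝ) 1,
      ‖(x : ℂ) ^ (u - 1) * (1 - (x : ℂ)) ^ (v - 1)‖ ≤ x ^ (p - 1) * (1 - x) ^ (q - 1) ∧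
      ‖(x : ℂ) ^ ((p : ℂ) - 1) * (1 - (x : ℂ)) ^ ((q : ℂ) - 1)‖ =
        x ^ (p - 1) * (1 - x) ^ (q - 1) := by
    intro x hx
    have hx1 : 0 < 1 - x := by linarith [hx.2]
    have e : (1 - (x : ℂ)) = ((1 - x : ℝ) : ℂ) := by push_cast; rfl
    rw [e]
    simp only [norm_mul, norm_cpow_eq_rpow_re_of_pos hx.1, norm_cpow_eq_rpow_re_of_pos hx1]
    refine ⟨?_, by simp⟩
    refine mul_le_mul ?_ ?_ (Real.rpow_nonneg hx1.le _) (Real.rpow_nonneg hx.1.le _)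
    · exact Real.rpow_le_rpow_of_exponent_ge hx.1 hx.2.le (by simpa using hu)
    · exact Real.rpow_le_rpow_of_exponent_ge hx1 (by linarith [hx.1]) (by simpa using hv)
  have hint' : IntervalIntegrable (fun x : ℝ => x ^ (p - 1) * (1 - x) ^ (q - 1)) volume 0 1 := by
    refine hint.norm.congr_ae ?_
    rw [Set.uIoc_of_le zero_le_one, ← restrict_Ioo_eq_restrict_Ioc]
    filter_upwards [ae_restrict_mem measurableSet_Ioo] with x hx using (key x hx).2
  refine intervalIntegral.norm_integral_le_of_norm_le zero_le_one ?_ hint'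
  have : ∀ᵐ x : ℝ, x ≠ 1 := by simp [ae_iff]
  filter_upwards [this] with x hx1 hx
  exact (key x ⟨hx.1, lt_of_le_of_ne hx.2 hx1⟩).1

/-- Quotients `Γ(z) / Γ(z + a)` are bounded on the left half-plane, away from the integers. -/
theorem Complex.exists_norm_Gamma_div_le {a : ℝ} (ha : 0 < a) (ha1 : a < 1) :
    ∃ K : ℝ, ∀ z : ℂ, z.re ≤ 0 → 1 / 2 ≤ ‖sin (Real.pi * z)‖ →
      ‖Gamma z * (Gamma (z + a))⁻¹‖ ≤ K := by
  set B := ∫ x in (0 : ℝ)..1, x ^ ((1 - a) - 1) * (1 - x) ^ (a - 1)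
  refine ⟨4 * (B / ‖Gamma (a : ℂ)‖), fun z hz hs => ?_⟩
  have hpi : (Real.pi : ℂ) ≠ 0 := by exact_mod_cast Real.pi_ne_zero
  have hs0 : sin (Real.pi * z) ≠ 0 := by
    intro h
    rw [h, norm_zero] at hs
    linarith
  -- B(1 - z - a, a) = Γ(1 - z - a) Γ(a) / Γ(1 - z) is bounded for Re z ≤ 0; reflection turns it
  -- into Γ(z)/Γ(z + a) at the cost of a quotient of sines.
  have hb := norm_betaIntegral_le (u := 1 - z - a) (v := a) (p := 1 - a) (q := a)
    (by linarith) ha (by simp; linarith) (by simp)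
  rw [betaIntegral_eq_Gamma_mul_div _ _ (by simp; linarith) (by simpa),
    show 1 - z - (a : ℂ) + a = 1 - z by ring] at hb
  have hG : Gamma (a : ℂ) ≠ 0 := Gamma_ne_zero_of_re_pos (by simpa)
  have hG1 : Gamma (1 - z) ≠ 0 := Gamma_ne_zero_of_re_pos (by simp; linarith)
  have hG2 : Gamma (1 - z - a) ≠ 0 := Gamma_ne_zero_of_re_pos (by simp; linarith)
  have r1 : Gamma z = Real.pi / sin (Real.pi * z) / Gamma (1 - z) := by
    rw [← Gamma_mul_Gamma_one_sub, mul_div_cancel_right₀ _ hG1]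
  have r2 : (Gamma (z + a))⁻¹ = Gamma (1 - z - a) * (sin (Real.pi * (z + a)) / Real.pi) := by
    have h := Gamma_mul_Gamma_one_sub (z + a)
    rw [show 1 - (z + (a : ℂ)) = 1 - z - a by ring] at h
    have h' := congrArg Inv.inv h
    rw [mul_inv, inv_div] at h'
    rw [← h']
    field_simp
  have e : Gamma z * (Gamma (z + a))⁻¹ = (sin (Real.pi * (z + a)) / sin (Real.pi * z)) *
      ((Gamma (1 - z - a) * Gamma a / Gamma (1 - z)) / Gamma a) := by
    rw [r1, r2]
    field_simp
  rw [e, norm_mul, norm_div _ (Gamma (a : ℂ))]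
  -- The quotient is cos πa + cot(πz) sin πa, and |sin πz| ≥ 1/2 bounds the cotangent by 3.
  have h4 : ‖sin (Real.pi * (z + a)) / sin (Real.pi * z)‖ ≤ 4 := by
    have hs' : 0 < ‖sin (Real.pi * z)‖ := by linarith
    rw [norm_div, div_le_iff₀ hs', mul_add, sin_add]
    have hc : ‖cos (Real.pi * z)‖ ≤ 3 * ‖sin (Real.pi * z)‖ := by
      have h1 : ‖cos (Real.pi * z)‖ ^ 2 ≤ 1 + ‖sin (Real.pi * z)‖ ^ 2 := by
        rw [← norm_pow, ← norm_pow, cos_sq']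
        exact (norm_sub_le _ _).trans (by simp)
      nlinarith [norm_nonneg (cos (Real.pi * z))]
    have hc1 : ‖cos ((Real.pi : ℂ) * a)‖ ≤ 1 := by
      rw [← ofReal_mul, ← ofReal_cos, norm_real]
      exact Real.abs_cos_le_one _
    have hs1 : ‖sin ((Real.pi : ℂ) * a)‖ ≤ 1 := by
      rw [← ofReal_mul, ← ofReal_sin, norm_real]
      exact Real.abs_sin_le_one _
    refine (norm_add_le _ _).trans ?_
    rw [norm_mul, norm_mul]
    nlinarith [norm_nonneg (cos (Real.pi * z)), norm_nonneg (sin ((Real.pi : ℂ) * a)),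
      norm_nonneg (cos ((Real.pi : ℂ) * a))]
  exact mul_le_mul h4 (div_le_div_of_nonneg_right hb (norm_nonneg _)) (by positivity) (by norm_num)

/-- Growth of `Γ(z)^m / Γ(1/2 + m z)` on the left half-plane. -/
theorem Complex.exists_norm_Gamma_pow_le (m : ℕ) :
    ∃ K b : ℝ, 0 < K ∧ 0 ≤ b ∧ ∀ z : ℂ, z.re ≤ 0 → 1 / 2 ≤ ‖sin (Real.pi * z)‖ →
      ‖Gamma z ^ m * (Gamma (1 / 2 + m * z))⁻¹‖ ≤ K * Real.exp (-b * z.re) := by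
  rcases eq_or_ne m 0 with rfl | hm
  · refine ⟨‖(Gamma (1 / 2))⁻¹‖ + 1, 0, by positivity, le_rfl, fun z _ _ => by simp⟩
  have hm0 : (m : ℂ) ≠ 0 := by exact_mod_cast hm
  have hmp : 0 < m := Nat.pos_of_ne_zero hm
  -- At s = 1/2 + mz the m factors of the multiplication formula have arguments z + (1/2 + k)/m with
  -- shifts in (0, 1). Each pairs with one of the m factors Γ(z) to a bounded quotient, and only
  -- m^{-s} grows.
  obtain ⟨c, hc⟩ := exists_inv_Gamma_eq_prod m hm
  have hK : ∀ k : ℕ, ∃ K : ℝ, k < m → ∀ z : ℂ, z.re ≤ 0 → 1 / 2 ≤ ‖sin (Real.pi * z)‖ →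
      ‖Gamma z * (Gamma (z + (((1 / 2 + k) / m : ℝ) : ℂ)))⁻¹‖ ≤ K := by
    intro k
    by_cases hk : k < m
    · obtain ⟨K, hK⟩ := exists_norm_Gamma_div_le (a := (1 / 2 + k) / m) (by positivity) (by
        rw [div_lt_one (by positivity)]
        have : (k : ℝ) + 1 ≤ m := by exact_mod_cast hk
        linarith)
      exact ⟨K, fun _ => hK⟩
    · exact ⟨0, fun h => absurd h hk⟩
  choose K hK using hK
  have hm1 : (1 : ℝ) ≤ m := by exact_mod_cast hmp
  refine ⟨‖c‖ * ((m : ℝ) ^ (-(1 / 2) : ℝ) * ∏ k ∈ Finset.range m, |K k|) + 1,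
    m * Real.log m, by positivity, mul_nonneg (by positivity) (Real.log_nonneg hm1),
    fun z hz hs => ?_⟩
  have e : Gamma z ^ m * (Gamma (1 / 2 + m * z))⁻¹ = c * ((m : ℂ) ^ (-(1 / 2 + m * z)) *
      ∏ k ∈ Finset.range m, (Gamma z * (Gamma (z + (((1 / 2 + k) / m : ℝ) : ℂ)))⁻¹)) := by
    rw [hc, Finset.prod_mul_distrib, Finset.prod_const, Finset.card_range]
    have : ∀ k ∈ Finset.range m, (Gamma ((1 / 2 + m * z + k) / m))⁻¹ =
        (Gamma (z + (((1 / 2 + k) / m : ℝ) : ℂ)))⁻¹ := by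
      intro k _
      congr 2
      push_cast
      field_simp
      ring
    rw [Finset.prod_congr rfl this]
    ring
  have h2 : ‖(m : ℂ) ^ (-(1 / 2 + m * z))‖ = (m : ℝ) ^ (-(1 / 2) : ℝ) *
      Real.exp (-(m * Real.log m) * z.re) := by
    have hmr : (0 : ℝ) < m := by positivity
    rw [show (m : ℂ) = ((m : ℝ) : ℂ) by simp, norm_cpow_eq_rpow_re_of_pos hmr,
      show (-(1 / 2 + ((m : ℝ) : ℂ) * z)).re = -(1 / 2) + -(m * z.re) by simp; ring,
      Real.rpow_add hmr, Real.rpow_def_of_pos hmr (-(m * z.re))]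
    congr 2
    ring
  rw [e, norm_mul, norm_mul, h2, norm_prod]
  have h3 : ∏ k ∈ Finset.range m, ‖Gamma z * (Gamma (z + (((1 / 2 + k) / m : ℝ) : ℂ)))⁻¹‖ ≤
      ∏ k ∈ Finset.range m, |K k| :=
    Finset.prod_le_prod (fun _ _ => norm_nonneg _) fun k hk =>
      (hK k (Finset.mem_range.1 hk) z hz hs).trans (le_abs_self _)
  calc _ ≤ ‖c‖ * ((m : ℝ) ^ (-(1 / 2) : ℝ) * Real.exp (-(m * Real.log m) * z.re) *
        ∏ k ∈ Finset.range m, |K k|) := by gcongr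
    _ = ‖c‖ * ((m : ℝ) ^ (-(1 / 2) : ℝ) * ∏ k ∈ Finset.range m, |K k|) *
        Real.exp (-(m * Real.log m) * z.re) := by ring
    _ ≤ _ := by gcongr; linarith

/-! ## Sums of residues along a vertical sequence of poles -/

/-- The fundamental theorem along a path. Integrability is recorded because pieces with different
primitives are concatenated later. -/
theorem integral_comp_mul_deriv_of_primitive {P F : ℂ → ℂ} {S : Set ℂ}
    (hP : ∀ z ∈ S, HasDerivAt P (F z) z) (hF : ContinuousOn F S) {γ γ' : ℝ → ℂ} {a b : ℝ}
    (hγ : ∀ x, HasDerivAt γ (γ' x) x) (hγ' : Continuous γ')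
    (hmem : ∀ x ∈ Set.uIcc a b, γ x ∈ S) :
    IntervalIntegrable (fun x => F (γ x) * γ' x) volume a b ∧
      ∫ x in a..b, F (γ x) * γ' x = P (γ b) - P (γ a) := by
  have hc : Continuous γ := continuous_iff_continuousAt.2 fun x => (hγ x).continuousAt
  have hi : IntervalIntegrable (fun x => F (γ x) * γ' x) volume a b :=
    ((hF.comp hc.continuousOn hmem).mul hγ'.continuousOn).intervalIntegrable
  exact ⟨hi, intervalIntegral.integral_eq_sub_of_hasDerivAt (f := fun x => P (γ x))
    (fun x hx => (hP _ (hmem x hx)).comp_of_eq x (hγ x) rfl) hi⟩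

/-- The open strip between the points `I (l - 1)` and `I l`; a half-plane for `l = 0`. -/
def poleStrip (l : ℕ) : Set ℂ := {z | z.im < l ∧ (l ≠ 0 → (l : ℝ) - 1 < z.im)}

theorem isOpen_poleStrip (l : ℕ) : IsOpen (poleStrip l) := by
  unfold poleStrip
  rcases eq_or_ne l 0 with h | h
  · simpa [h] using isOpen_lt continuous_im continuous_const
  · simpa [h] using! (isOpen_lt continuous_im (continuous_const (y := (l : ℝ)))).inter
      (isOpen_lt (continuous_const (y := (l : ℝ) - 1)) continuous_im)

theorem convex_poleStrip (l : ℕ) : Convex ℝ (poleStrip l) := by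
  unfold poleStrip
  rcases eq_or_ne l 0 with h | h
  · simpa [h] using convex_halfSpace_im_lt 0
  · simpa [h] using! (convex_halfSpace_im_lt (l : ℝ)).inter (convex_halfSpace_im_gt ((l : ℝ) - 1))

theorem exists_const_of_primitives {P Q F : ℂ → ℂ} {S T : Set ℂ} (hS : IsOpen S) (hT : IsOpen T)
    (hSc : Convex ℝ S) (hTc : Convex ℝ T) (hP : ∀ z ∈ S, HasDerivAt P (F z) z)
    (hQ : ∀ z ∈ T, HasDerivAt Q (F z) z) : ∃ a : ℂ, ∀ z ∈ S ∩ T, P z = Q z + a := by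
  obtain ⟨a, ha⟩ := (hS.inter hT).exists_is_const_of_deriv_eq_zero (f := fun z => P z - Q z)
    (hSc.inter hTc).isPreconnected
    (fun z hz => ((hP z hz.1).sub (hQ z hz.2)).differentiableAt.differentiableWithinAt)
    (fun z hz => by
      have := ((hP z hz.1).sub (hQ z hz.2)).deriv
      rw [sub_self] at this
      exact this)
  exact ⟨a, fun z hz => by rw [← ha z hz]; ring⟩

theorem circleMap_re' (c : ℂ) (R θ : ℝ) : (circleMap c R θ).re = c.re + R * Real.cos θ := by
  rw [circleMap, exp_mul_I, add_re, re_ofReal_mul, add_re, mul_re, I_re, I_im, sin_ofReal_im,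
    cos_ofReal_re]
  ring

theorem circleMap_im' (c : ℂ) (R θ : ℝ) : (circleMap c R θ).im = c.im + R * Real.sin θ := by
  rw [circleMap, exp_mul_I, add_im, im_ofReal_mul, add_im, mul_im, I_re, I_im, sin_ofReal_re,
    cos_ofReal_im]
  ring

/-- The circle is cut at the odd multiples of π/4 into four arcs, each inside one of the convex
regions (right half-plane, strip above, left half-plane, strip below) on which F has a primitive.
The endpoint values cancel, and only the constants between the primitives remain. The order of the
pole plays no role. -/
theorem circleIntegral_eq_of_primitives {F PR PL P P' : ℂ → ℂ} {R : ℝ} (hR : 0 < R) (hR1 : R < 1)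
    (l : ℕ) (hF : ∀ z : ℂ, (∀ l : ℕ, z ≠ I * l) → ContinuousAt F z)
    (hPR : ∀ z : ℂ, 0 < z.re → HasDerivAt PR (F z) z)
    (hPL : ∀ z : ℂ, z.re < 0 → HasDerivAt PL (F z) z)
    (hP : ∀ z ∈ poleStrip l, HasDerivAt P (F z) z)
    (hP' : ∀ z ∈ poleStrip (l + 1), HasDerivAt P' (F z) z)
    {α α' β β' : ℂ}
    (hα : ∀ z ∈ {z : ℂ | 0 < z.re} ∩ poleStrip l, PR z = P z + α)
    (hβ : ∀ z ∈ {z : ℂ | z.re < 0} ∩ poleStrip l, PL z = P z + β)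
    (hα' : ∀ z ∈ {z : ℂ | 0 < z.re} ∩ poleStrip (l + 1), PR z = P' z + α')
    (hβ' : ∀ z ∈ {z : ℂ | z.re < 0} ∩ poleStrip (l + 1), PL z = P' z + β') :
    circleIntegral F (I * l) R = (α' - β') - (α - β) := by
  have hpi := Real.pi_pos
  have hre : ∀ θ, (circleMap (I * l) R θ).re = R * Real.cos θ := fun θ => by
    simp [circleMap_re']
  have him : ∀ θ, (circleMap (I * l) R θ).im = l + R * Real.sin θ := fun θ => by
    simp [circleMap_im']
  have hne : ∀ z : ℂ, z.re ≠ 0 → ∀ l : ℕ, z ≠ I * l := by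
    rintro z hz k rfl
    simp at hz
  have hsne : ∀ k : ℕ, ∀ z ∈ poleStrip k, ∀ l : ℕ, z ≠ I * l := by
    rintro k z ⟨h1, h2⟩ j rfl
    simp only [mul_im, I_re, natCast_im, mul_zero, I_im, natCast_re, one_mul, zero_add] at h1 h2
    have h1' : j < k := by exact_mod_cast h1
    have h2' := h2 (by omega)
    have : (j : ℝ) + 1 ≤ k := by exact_mod_cast h1'
    linarith
  set γ := circleMap (I * l) R with hγ
  set γ' : ℝ → ℂ := fun θ => circleMap 0 R θ * I with hγ'
  have hd : ∀ θ, HasDerivAt γ (γ' θ) θ := fun θ => hasDerivAt_circleMap _ _ _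
  have hc' : Continuous γ' := by fun_prop
  have mR : ∀ θ, 0 < Real.cos θ → 0 < (γ θ).re := fun θ h => by rw [hre]; positivity
  have mL : ∀ θ, Real.cos θ < 0 → (γ θ).re < 0 := fun θ h => by
    rw [hre]; exact mul_neg_of_pos_of_neg hR h
  have mT : ∀ θ, 0 < Real.sin θ → γ θ ∈ poleStrip (l + 1) := fun θ h => by
    refine ⟨?_, fun _ => ?_⟩
    · rw [him]; push_cast; nlinarith [Real.sin_le_one θ]
    · rw [him]; push_cast; nlinarith
  have mB : ∀ θ, Real.sin θ < 0 → γ θ ∈ poleStrip l := fun θ h => by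
    refine ⟨?_, fun _ => ?_⟩
    · rw [him]; nlinarith
    · rw [him]; nlinarith [Real.neg_one_le_sin θ]
  have c1 : ∀ θ ∈ Set.uIcc (-(Real.pi / 4)) (Real.pi / 4), 0 < Real.cos θ := fun θ h => by
    rw [Set.uIcc_of_le (by linarith)] at h
    exact Real.cos_pos_of_mem_Ioo ⟨by linarith [h.1], by linarith [h.2]⟩
  have c2 : ∀ θ ∈ Set.uIcc (Real.pi / 4) (3 * Real.pi / 4), 0 < Real.sin θ := fun θ h => by
    rw [Set.uIcc_of_le (by linarith)] at h
    exact Real.sin_pos_of_pos_of_lt_pi (by linarith [h.1]) (by linarith [h.2])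
  have c3 : ∀ θ ∈ Set.uIcc (3 * Real.pi / 4) (5 * Real.pi / 4), Real.cos θ < 0 := fun θ h => by
    rw [Set.uIcc_of_le (by linarith)] at h
    exact Real.cos_neg_of_pi_div_two_lt_of_lt (by linarith [h.1]) (by linarith [h.2])
  have c4 : ∀ θ ∈ Set.uIcc (5 * Real.pi / 4) (7 * Real.pi / 4), Real.sin θ < 0 := fun θ h => by
    rw [Set.uIcc_of_le (by linarith)] at h
    have := Real.sin_pos_of_pos_of_lt_pi (x := θ - Real.pi) (by linarith [h.1]) (by linarith [h.2])
    rw [Real.sin_sub_pi] at this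
    linarith
  have i1 := integral_comp_mul_deriv_of_primitive (S := {z : ℂ | 0 < z.re}) hPR
    (fun z hz => (hF z (hne z (ne_of_gt hz))).continuousWithinAt) hd hc' (fun θ h => mR θ (c1 θ h))
  have i2 := integral_comp_mul_deriv_of_primitive (S := poleStrip (l + 1)) hP'
    (fun z hz => (hF z (hsne _ z hz)).continuousWithinAt) hd hc' (fun θ h => mT θ (c2 θ h))
  have i3 := integral_comp_mul_deriv_of_primitive (S := {z : ℂ | z.re < 0}) hPL
    (fun z hz => (hF z (hne z (ne_of_lt hz))).continuousWithinAt) hd hc' (fun θ h => mL θ (c3 θ h))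
  have i4 := integral_comp_mul_deriv_of_primitive (S := poleStrip l) hP
    (fun z hz => (hF z (hsne _ z hz)).continuousWithinAt) hd hc' (fun θ h => mB θ (c4 θ h))
  -- By periodicity the parametrization may start at -π/4, an endpoint of one of the arcs.
  have hcirc : circleIntegral F (I * l) R =
      ∫ θ in (-(Real.pi / 4))..(7 * Real.pi / 4), F (γ θ) * γ' θ := by
    have hper : Function.Periodic (fun θ => F (γ θ) * γ' θ) (2 * Real.pi) := by
      intro θ
      simp only [hγ, hγ', (periodic_circleMap _ _) θ]
    have h1 := hper.intervalIntegral_add_eq 0 (-(Real.pi / 4))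
    rw [zero_add, show -(Real.pi / 4) + 2 * Real.pi = 7 * Real.pi / 4 by ring] at h1
    rw [← h1, circleIntegral]
    refine intervalIntegral.integral_congr fun θ _ => ?_
    simp only [deriv_circleMap, smul_eq_mul, hγ, hγ']
    ring
  rw [hcirc, ← intervalIntegral.integral_add_adjacent_intervals
      ((i1.1.trans i2.1).trans i3.1) i4.1,
    ← intervalIntegral.integral_add_adjacent_intervals (i1.1.trans i2.1) i3.1,
    ← intervalIntegral.integral_add_adjacent_intervals i1.1 i2.1, i1.2, i2.2, i3.2, i4.2]
  have e : γ (7 * Real.pi / 4) = γ (-(Real.pi / 4)) := by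
    have h := periodic_circleMap (I * l) R (-(Real.pi / 4))
    rw [← hγ] at h
    rw [← h]
    congr 1
    ring
  have q1 := hα' (γ (Real.pi / 4)) ⟨mR _ (c1 _ Set.right_mem_uIcc), mT _ (c2 _ Set.left_mem_uIcc)⟩
  have q2 := hβ' (γ (3 * Real.pi / 4))
    ⟨mL _ (c3 _ Set.left_mem_uIcc), mT _ (c2 _ Set.right_mem_uIcc)⟩
  have q3 := hβ (γ (5 * Real.pi / 4))
    ⟨mL _ (c3 _ Set.right_mem_uIcc), mB _ (c4 _ Set.left_mem_uIcc)⟩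
  have q4 := hα (γ (-(Real.pi / 4)))
    ⟨mR _ (c1 _ Set.left_mem_uIcc), e ▸ mB _ (c4 _ Set.right_mem_uIcc)⟩
  rw [e, q1, q2, q3, q4]
  ring

/-- The integral over the part of a graph below a horizontal line is the sum of the residues at the
enclosed poles, up to the integral over the line. -/
theorem integral_graph_eq_sum_circleIntegral {F : ℂ → ℂ}
    (hF : ∀ z : ℂ, (∀ l : ℕ, z ≠ I * l) → DifferentiableAt ℂ F z) {y : ℝ → ℝ}
    (hy : ContDiff ℝ 1 y) (hy0 : y 0 < 0) {X : ℝ} (hX : 0 < X) {N : ℕ} (hN : N ≠ 0) {R : ℝ}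
    (hR : 0 < R) (hR1 : R < 1)
    (h1 : y X = N - 1 / 2) (h2 : y (-X) = N - 1 / 2) :
    ∫ x in (-X)..X, F (x + I * y x) * (1 + I * deriv y x) =
      ∑ l ∈ Finset.range N, circleIntegral F (I * l) R +
        ∫ x in (-X)..X, F (x + I * ((N - 1 / 2 : ℝ) : ℂ)) := by
  have hne : ∀ z : ℂ, z.re ≠ 0 → ∀ l : ℕ, z ≠ I * l := by
    rintro z hz k rfl
    simp at hz
  have hsne : ∀ k : ℕ, ∀ z ∈ poleStrip k, ∀ l : ℕ, z ≠ I * l := by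
    rintro k z ⟨h1, h2⟩ j rfl
    simp only [mul_im, I_re, natCast_im, mul_zero, I_im, natCast_re, one_mul, zero_add] at h1 h2
    have h1' : j < k := by exact_mod_cast h1
    have h2' := h2 (by omega)
    have : (j : ℝ) + 1 ≤ k := by exact_mod_cast h1'
    linarith
  -- The half-planes Re z > 0 and Re z < 0 and the strips between the poles are convex and free of
  -- poles. Each circle integral is the jump of α - β at one pole, so their sum telescopes.
  have prim : ∀ S : Set ℂ, IsOpen S → Convex ℝ S → (∀ z ∈ S, ∀ l : ℕ, z ≠ I * l) →
      ∃ P : ℂ → ℂ, ∀ z ∈ S, HasDerivAt P (F z) z := by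
    intro S hS hSc hz
    obtain ⟨P, hP⟩ := hSc.exists_forall_hasDerivWithinAt (f := F)
      fun z hzS => (hF z (hz z hzS)).differentiableWithinAt
    exact ⟨P, fun z hzS => (hP z hzS).hasDerivAt (hS.mem_nhds hzS)⟩
  have oR : IsOpen {z : ℂ | 0 < z.re} := isOpen_lt continuous_const continuous_re
  have oL : IsOpen {z : ℂ | z.re < 0} := isOpen_lt continuous_re continuous_const
  have kR : Convex ℝ {z : ℂ | 0 < z.re} := convex_halfSpace_re_gt 0
  have kL : Convex ℝ {z : ℂ | z.re < 0} := convex_halfSpace_re_lt 0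
  obtain ⟨PR, hPR⟩ := prim _ oR kR fun z hz => hne z (ne_of_gt hz)
  obtain ⟨PL, hPL⟩ := prim _ oL kL fun z hz => hne z (ne_of_lt hz)
  choose P hP using fun l => prim _ (isOpen_poleStrip l) (convex_poleStrip l) (hsne l)
  choose α hα using fun l => exists_const_of_primitives oR (isOpen_poleStrip l) kR
    (convex_poleStrip l) hPR (hP l)
  choose β hβ using fun l => exists_const_of_primitives oL (isOpen_poleStrip l) kL
    (convex_poleStrip l) hPL (hP l)
  have hcirc : ∀ l : ℕ, circleIntegral F (I * l) R = (α (l + 1) - β (l + 1)) - (α l - β l) :=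
    fun l => circleIntegral_eq_of_primitives hR hR1 l
      (fun z hz => (hF z hz).continuousAt) hPR hPL (hP l) (hP (l + 1)) (hα l) (hβ l) (hα (l + 1))
      (hβ (l + 1))
  rw [Finset.sum_congr rfl fun l _ => hcirc l, Finset.sum_range_sub fun l => α l - β l]
  -- Near x = 0 the graph runs below all poles, in strip 0; elsewhere it stays in one of the two
  -- half-planes.
  obtain ⟨δ, hδ, hδy⟩ : ∃ δ > 0, ∀ x ∈ Set.uIcc (-δ) δ, y x < 0 := by
    obtain ⟨ε, hε, h⟩ := Metric.mem_nhds_iff.1 (hy.continuous.continuousAt.eventually_lt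
      continuousAt_const hy0)
    refine ⟨ε / 2, by positivity, fun x hx => h ?_⟩
    rw [Set.uIcc_of_le (by linarith)] at hx
    rw [Metric.mem_ball, dist_zero_right, Real.norm_eq_abs]
    exact (abs_le.2 hx).trans_lt (by linarith)
  have hN1 : (1 : ℝ) ≤ N := by exact_mod_cast Nat.one_le_iff_ne_zero.2 hN
  have hδX : δ < X := by
    by_contra hcon
    have := hδy X (by rw [Set.uIcc_of_le (by linarith)]; constructor <;> linarith)
    rw [h1] at this
    linarith
  set γ : ℝ → ℂ := fun x => x + I * y x with hγ
  set γ' : ℝ → ℂ := fun x => 1 + I * deriv y x with hγ'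
  have hd : ∀ x, HasDerivAt γ (γ' x) x := by
    intro x
    refine HasDerivAt.add ofRealCLM.hasDerivAt (HasDerivAt.const_mul I ?_)
    exact ((hy.differentiable one_ne_zero) x).hasDerivAt.ofReal_comp
  have hc' : Continuous γ' := by
    have := hy.continuous_deriv le_rfl
    fun_prop
  have hre : ∀ x, (γ x).re = x := fun x => by simp [hγ]
  have him : ∀ x, (γ x).im = y x := fun x => by simp [hγ]
  have i1 := integral_comp_mul_deriv_of_primitive (a := -X) (b := -δ) hPL
    (fun z hz => (hF z (hne z (ne_of_lt hz))).continuousAt.continuousWithinAt) hd hc'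
    (fun x hx => by
      rw [Set.uIcc_of_le (by linarith)] at hx
      simp only [Set.mem_ofPred_eq, hre]
      linarith [hx.2])
  have mem0 : ∀ x ∈ Set.uIcc (-δ) δ, γ x ∈ poleStrip 0 := fun x hx =>
    ⟨by rw [him]; simpa using hδy x hx, fun h => absurd rfl h⟩
  have i2 := integral_comp_mul_deriv_of_primitive (a := -δ) (b := δ) (hP 0)
    (fun z hz => (hF z (hsne _ z hz)).continuousAt.continuousWithinAt) hd hc' mem0
  have i3 := integral_comp_mul_deriv_of_primitive (a := δ) (b := X) hPR
    (fun z hz => (hF z (hne z (ne_of_gt hz))).continuousAt.continuousWithinAt) hd hc'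
    (fun x hx => by
      rw [Set.uIcc_of_le (by linarith)] at hx
      simp only [Set.mem_ofPred_eq, hre]
      linarith [hx.1])
  -- The horizontal line crosses the imaginary axis in strip N, so it sees the constants α N and β N
  -- where the graph sees α 0 and β 0.
  have memN : ∀ x : ℝ, (x : ℂ) + I * ((N - 1 / 2 : ℝ) : ℂ) ∈ poleStrip N := by
    intro x
    have e : ((x : ℂ) + I * ((N - 1 / 2 : ℝ) : ℂ)).im = N - 1 / 2 := by
      rw [add_im, ofReal_im, mul_im, I_re, I_im, ofReal_re, ofReal_im]
      ring
    refine ⟨?_, fun _ => ?_⟩ <;> rw [e] <;> linarith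
  have i4 := integral_comp_mul_deriv_of_primitive (a := -X) (b := X) (hP N)
    (γ := fun x : ℝ => (x : ℂ) + I * ((N - 1 / 2 : ℝ) : ℂ)) (γ' := fun _ => 1)
    (fun z hz => (hF z (hsne _ z hz)).continuousAt.continuousWithinAt)
    (fun x => (ofRealCLM.hasDerivAt (x := x)).add_const _) continuous_const (fun x _ => memN x)
  simp only [mul_one] at i4
  rw [i4.2, ← intervalIntegral.integral_add_adjacent_intervals (i1.1.trans i2.1) i3.1,
    ← intervalIntegral.integral_add_adjacent_intervals i1.1 i2.1, i1.2, i2.2, i3.2]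
  have e1 : γ X = (X : ℂ) + I * ((N - 1 / 2 : ℝ) : ℂ) := by simp only [hγ, h1]
  have e2 : γ (-X) = ((-X : ℝ) : ℂ) + I * ((N - 1 / 2 : ℝ) : ℂ) := by simp only [hγ, h2]
  have q1 := hβ 0 (γ (-δ)) ⟨by simp only [Set.mem_ofPred_eq, hre]; linarith, mem0 _ Set.left_mem_uIcc⟩
  have q2 := hα 0 (γ δ) ⟨by simp only [Set.mem_ofPred_eq, hre]; linarith, mem0 _ Set.right_mem_uIcc⟩
  have q3 := hβ N (γ (-X)) ⟨by simp only [Set.mem_ofPred_eq, hre]; linarith, e2 ▸ memN (-X)⟩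
  have q4 := hα N (γ X) ⟨by simp only [Set.mem_ofPred_eq, hre]; linarith, e1 ▸ memN X⟩
  rw [q1, q2, q3, q4, ← e1, ← e2]
  ring

/-! ## The integrand of the A-periods -/

section Integrand

variable {n r : ℕ}

/-- Since 1 + e^{-2πiz} = 2 e^{-πiz} cos πz, this is the reflection formula. It lets the brane
factor absorb the poles of Γ(1/2 - z), which are excluded only because `Gamma` has a default value
there. -/
theorem Complex.Gamma_half_sub_mul_one_add_exp {z : ℂ} (hz : ∀ k : ℕ, 1 / 2 - z ≠ -k) :
    Gamma (1 / 2 - z) * (1 + exp (-(2 * Real.pi * I * z))) =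
      2 * Real.pi * exp (-(Real.pi * I * z)) * (Gamma (1 / 2 + z))⁻¹ := by
  have hG : Gamma (1 / 2 - z) ≠ 0 := Gamma_ne_zero hz
  have h1 := Gamma_mul_Gamma_one_sub (1 / 2 + z)
  rw [show 1 - (1 / 2 + z) = 1 / 2 - z by ring,
    show (Real.pi : ℂ) * (1 / 2 + z) = Real.pi * z + Real.pi / 2 by ring, sin_add_pi_div_two] at h1
  have h2 : (1 + exp (-(2 * Real.pi * I * z))) = 2 * exp (-(Real.pi * I * z)) *
      cos (Real.pi * z) := by
    rw [cos, show ∀ a b : ℂ, 2 * a * (b / 2) = a * b by intro a b; ring, mul_add, ← exp_add,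
      ← exp_add]
    congr 1
    · rw [← exp_zero]; congr 1; ring
    · congr 1; ring
  rw [h2]
  -- If the cosine vanishes, 1/2 + z is a pole of Γ; the defaults Γ = 0 and 0⁻¹ = 0 then give the
  -- true value 0 of 1/Γ.
  by_cases hc : cos (Real.pi * z) = 0
  · rw [hc, div_zero] at h1
    rw [hc, (mul_eq_zero.1 h1).resolve_right hG]
    simp
  · have hpi : (Real.pi : ℂ) ≠ 0 := by exact_mod_cast Real.pi_ne_zero
    have hG2 : Gamma (1 / 2 + z) ≠ 0 := by
      intro h0
      rw [h0, zero_mul] at h1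
      exact div_ne_zero hpi hc h1.symm
    rw [eq_div_iff hc] at h1
    linear_combination (-2 * exp (-(Real.pi * I * z)) * Gamma (1 / 2 - z) * cos (Real.pi * z)) *
      mul_inv_cancel₀ hG2 + 2 * exp (-(Real.pi * I * z)) * (Gamma (1 / 2 + z))⁻¹ * h1

/-- Legendre duplication, solved for the quotient that appears once Γ(1/2 - z) has been reflected.
The factor 4^z is the source of the 4 in q. -/
theorem Complex.Gamma_two_mul_mul_inv {z : ℂ} (hz : ∀ k : ℕ, 1 / 2 + z ≠ -k) :
    Gamma (2 * z) * (2 * (Gamma (1 / 2 + z))⁻¹) =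
      Gamma z * exp (Real.log 4 * z) * (Real.sqrt Real.pi : ℂ)⁻¹ := by
  have hG : Gamma (1 / 2 + z) ≠ 0 := Gamma_ne_zero hz
  have h := Gamma_mul_Gamma_add_half z
  have hpi : (Real.sqrt Real.pi : ℂ) ≠ 0 := by
    exact_mod_cast (Real.sqrt_pos.2 Real.pi_pos).ne'
  have h2 : (2 : ℂ) ^ (1 - 2 * z) * exp (Real.log 4 * z) = 2 := by
    have : (Real.log 4 : ℂ) = 2 * log 2 := by
      rw [show (4 : ℝ) = 2 ^ 2 by norm_num, Real.log_pow, ofReal_mul,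
        ofReal_log zero_le_two]
      norm_num
    rw [cpow_def_of_ne_zero two_ne_zero, ← exp_add, this]
    rw [show log 2 * (1 - 2 * z) + 2 * log 2 * z = log 2 by ring, exp_log two_ne_zero]
  rw [add_comm] at hG
  rw [add_comm (1 / 2 : ℂ) z]
  rw [eq_mul_inv_iff_mul_eq₀ hpi]
  linear_combination (-exp (Real.log 4 * z) * (Gamma (z + 1 / 2))⁻¹) * h -
    Gamma (2 * z) * (Real.sqrt Real.pi : ℂ) * (Gamma (z + 1 / 2))⁻¹ * h2 +
    exp (Real.log 4 * z) * Gamma z * mul_inv_cancel₀ hG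

/-- The quotient of Gamma functions in the integrand of the A-periods, as a function of
`z = iσ`. -/
noncomputable def gammaKernel (c : Fin (n + 1) → Fin r) (z : ℂ) : ℂ :=
  ∏ i, (Gamma z ^ blockSize c i * (Gamma (1 / 2 + blockSize c i * z))⁻¹)

/-- The exponential factors in the integrand of the A-period of a brane with `|J| = m`. -/
noncomputable def expFactor (n m : ℕ) (σ : ℂ) : ℂ :=
  exp ((n + 1) * (Real.log 4 * I + 2 * Real.pi) * σ) * (1 - exp (2 * Real.pi * σ)) ^ m

/-- The constant factor of the integrand of the A-periods. -/
noncomputable def periodConst (r n : ℕ) : ℂ :=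
  (2 * Real.pi) ^ r * (Real.sqrt Real.pi : ℂ) ^ (n + 1)

/-- The factor of the integrand of the A-periods which does not depend on `t`. -/
noncomputable def periodWeight (c : Fin (n + 1) → Fin r) (m : ℕ) (σ : ℂ) : ℂ :=
  periodConst r n * gammaKernel c (I * σ) * expFactor n m σ

/-- The integrand of the A-period of a brane with `|J| = m`, without the spurious singularities. -/
noncomputable def periodIntegrand (c : Fin (n + 1) → Fin r) (m : ℕ) (t σ : ℂ) : ℂ :=
  periodWeight c m σ * exp (I * t * σ)

/-- The trace is a sum over subsets of products of weights, hence a product of factors 1 + weight. A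
ray in J contributes 1 - e² = (1 - e)(1 + e), any other ray 1 + e. -/
theorem factor_braneOf (c : Fin (n + 1) → Fin r) (s : Fin r → MvPolynomial (Fin (n + 1)) ℂ)
    (hs : ∀ i, (s i).IsHomogeneous (blockSize c i)) (J : Finset (Fin (n + 1))) (σ : ℂ) :
    (braneOf c s hs J).factor σ = (1 - exp (2 * Real.pi * σ)) ^ J.card *
      (1 + exp (2 * Real.pi * σ)) ^ (n + 1) *
        ∏ i, (1 + exp (blockSize c i * (2 * Real.pi * σ))) := by
  set e := exp (2 * Real.pi * σ) with he
  have he0 : e ≠ 0 := exp_ne_zero _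
  have h1 : (braneOf c s hs J).factor σ = ∑ S : Finset (Idx r n), ∏ a ∈ S,
      ((-1) ^ (if a ∈ raySet r J then (1 : ℤ) else 0) *
        e ^ (if a ∈ raySet r J then 2 * theta c a else theta c a)) := by
    simp only [Brane.factor, weightRep, Matrix.diagonal_mul_diagonal, Matrix.trace_diagonal]
    refine Finset.sum_congr rfl fun S _ => ?_
    rw [Finset.prod_mul_distrib]
    have : exp (I * Real.pi) = -1 := by rw [mul_comm, exp_pi_mul_I]
    rw [this]
    congr 1
    · change (-1 : ℂ) ^ (∑ a ∈ S, _) = _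
      clear * - he0
      induction S using Finset.induction_on with
      | empty => simp
      | insert a S ha ih => rw [Finset.prod_insert ha, ← ih, zpow_sum_insert _ (by simp) ha, mul_comm]
    · change e ^ (∑ a ∈ S, _) = _
      clear * - he0
      induction S using Finset.induction_on with
      | empty => simp
      | insert a S ha ih => rw [Finset.prod_insert ha, ← ih, zpow_sum_insert _ he0 ha, mul_comm]
  rw [h1, ← Finset.powerset_univ, ← Finset.prod_one_add, Fintype.prod_sum_type]
  have h2 : ∀ i : Fin r, (Sum.inl i : Idx r n) ∉ raySet r J := by simp [raySet]
  have h3 : ∀ j : Fin (n + 1), (Sum.inr j : Idx r n) ∈ raySet r J ↔ j ∈ J := by simp [raySet]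
  simp only [h2, h3, if_false, theta, mul_one, zpow_zero, one_mul, zpow_natCast]
  have h4 : ∀ i, e ^ blockSize c i = exp (blockSize c i * (2 * Real.pi * σ)) := fun i => by
    rw [exp_nat_mul]
  have h5 : ∀ j : Fin (n + 1), (1 + (-1 : ℂ) ^ (if j ∈ J then (1 : ℤ) else 0) *
      e ^ (if j ∈ J then (2 : ℤ) else 1)) = (if j ∈ J then 1 - e else 1) * (1 + e) := by
    intro j
    split_ifs
    · rw [zpow_one, show (2 : ℤ) = ((2 : ℕ) : ℤ) by rfl, zpow_natCast]; ring
    · simp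
  simp only [h4, h5]
  rw [Finset.prod_mul_distrib, Finset.prod_const, Finset.card_univ, Fintype.card_fin,
    Finset.prod_ite_mem, Finset.univ_inter, Finset.prod_const]
  ring

/-- An equality of functions, with no condition at the poles, so the periods agree for every t,
convergent or not. -/
theorem integrand_braneOf_eq_of_card_eq (c : Fin (n + 1) → Fin r)
    (s : Fin r → MvPolynomial (Fin (n + 1)) ℂ) (hs : ∀ i, (s i).IsHomogeneous (blockSize c i))
    {J J' : Finset (Fin (n + 1))} (h : J.card = J'.card) :
    (braneOf c s hs J).integrand = (braneOf c s hs J').integrand := by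
  funext t σ
  simp only [Brane.integrand, factor_braneOf, h]

/-- Reflection is applied to every Γ(1/2 - m_i z), then reflection and duplication to Γ(2z) Γ(1/2 -
z)(1 + e). The hypotheses exclude the points where these formulas meet a default value of `Gamma`.
-/
theorem integrand_braneOf (c : Fin (n + 1) → Fin r) (s : Fin r → MvPolynomial (Fin (n + 1)) ℂ)
    (hs : ∀ i, (s i).IsHomogeneous (blockSize c i)) (J : Finset (Fin (n + 1))) (t : ℂ) {σ : ℂ}
    (h1 : ∀ i (k : ℕ), 1 / 2 - blockSize c i * (I * σ) ≠ -k)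
    (h2 : ∀ k : ℕ, 1 / 2 - I * σ ≠ -k) (h3 : ∀ k : ℕ, 1 / 2 + I * σ ≠ -k) :
    (braneOf c s hs J).integrand t σ = periodIntegrand c J.card t σ := by
  have hpi : (Real.sqrt Real.pi : ℂ) ≠ 0 := by
    exact_mod_cast (Real.sqrt_pos.2 Real.pi_pos).ne'
  have hpi2 : (Real.sqrt Real.pi : ℂ) ^ 2 = Real.pi := by
    rw [← ofReal_pow, Real.sq_sqrt Real.pi_pos.le]
  have hQ : ∏ v, Gamma (I * (doubleCoverGLSM c s hs).Q v * σ + (doubleCoverGLSM c s hs).R v / 2) =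
      Gamma (2 * (I * σ)) ^ (n + 1) * ((∏ i, Gamma (1 / 2 - blockSize c i * (I * σ))) *
        Gamma (1 / 2 - I * σ) ^ (n + 1)) := by
    simp only [doubleCoverGLSM, Fintype.prod_sum_type, gaugeW, rW, theta]
    simp only [Finset.prod_const, Finset.card_univ, Fintype.card_fin]
    congr 2
    · congr 1; push_cast; ring
    · refine Finset.prod_congr rfl fun i _ => ?_
      congr 1; push_cast; ring
    · congr 2; push_cast; ring
  have hA : ∏ i, (Gamma (1 / 2 - blockSize c i * (I * σ)) *
      (1 + exp (blockSize c i * (2 * Real.pi * σ)))) =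
      (2 * Real.pi) ^ r * exp (Real.pi * σ) ^ (n + 1) *
        ∏ i, (Gamma (1 / 2 + blockSize c i * (I * σ)))⁻¹ := by
    have : ∀ i ∈ (Finset.univ : Finset (Fin r)), (Gamma (1 / 2 - blockSize c i * (I * σ)) *
        (1 + exp (blockSize c i * (2 * Real.pi * σ)))) =
        2 * Real.pi * exp (Real.pi * σ) ^ blockSize c i *
          (Gamma (1 / 2 + blockSize c i * (I * σ)))⁻¹ := by
      intro i _
      rw [← exp_nat_mul]
      convert Gamma_half_sub_mul_one_add_exp (h1 i) using 5
      · linear_combination (2 * Real.pi * blockSize c i * σ) * I_mul_I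
      · linear_combination (Real.pi * blockSize c i * σ) * I_mul_I
    rw [Finset.prod_congr rfl this, Finset.prod_mul_distrib, Finset.prod_mul_distrib,
      Finset.prod_const, Finset.card_univ, Fintype.card_fin, Finset.prod_pow_eq_pow_sum,
      sum_blockSize]
  -- The contribution of a single ray; its (n + 1)-st power enters the integrand.
  have hB : Gamma (2 * (I * σ)) * (Gamma (1 / 2 - I * σ) * (1 + exp (2 * Real.pi * σ))) =
      Real.sqrt Real.pi * (Gamma (I * σ) * exp (Real.log 4 * (I * σ)) * exp (Real.pi * σ)) := by
    have e1 := Gamma_half_sub_mul_one_add_exp h2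
    rw [show -(2 * Real.pi * I * (I * σ)) = 2 * Real.pi * σ by
        linear_combination (-2 * Real.pi * σ) * I_mul_I,
      show -(Real.pi * I * (I * σ)) = Real.pi * σ by
        linear_combination (-Real.pi * σ) * I_mul_I] at e1
    have e2 := Gamma_two_mul_mul_inv h3
    rw [e1, show Gamma (2 * (I * σ)) * (2 * Real.pi * exp (Real.pi * σ) *
      (Gamma (1 / 2 + I * σ))⁻¹) = Gamma (2 * (I * σ)) * (2 * (Gamma (1 / 2 + I * σ))⁻¹) *
      (Real.pi * exp (Real.pi * σ)) by ring, e2, ← hpi2]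
    field_simp
  rw [Brane.integrand, hQ, factor_braneOf, periodIntegrand, periodWeight, periodConst, gammaKernel, expFactor,
    Finset.prod_mul_distrib, Finset.prod_pow_eq_pow_sum, sum_blockSize]
  rw [Finset.prod_mul_distrib] at hA
  have hE : exp ((n + 1) * (Real.log 4 * I + 2 * Real.pi) * σ) =
      (exp (Real.log 4 * (I * σ)) * exp (Real.pi * σ)) ^ (n + 1) * exp (Real.pi * σ) ^ (n + 1) := by
    rw [← mul_pow, ← exp_add, ← exp_add, ← exp_nat_mul]
    congr 1
    push_cast
    ring
  rw [hE]
  have hB' := congrArg (· ^ (n + 1)) hB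
  simp only [mul_pow] at hB'
  linear_combination (exp (I * t * σ) * (1 - exp (2 * Real.pi * σ)) ^ J.card) *
    ((∏ i, Gamma (1 / 2 - blockSize c i * (I * σ))) *
        ∏ i, (1 + exp (blockSize c i * (2 * Real.pi * σ)))) * hB' +
    (exp (I * t * σ) * (1 - exp (2 * Real.pi * σ)) ^ J.card) *
    (Real.sqrt Real.pi : ℂ) ^ (n + 1) * (Gamma (I * σ) ^ (n + 1) *
      exp (Real.log 4 * (I * σ)) ^ (n + 1) * exp (Real.pi * σ) ^ (n + 1)) * hA

theorem differentiableAt_inv_Gamma_affine (a b z : ℂ) :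
    DifferentiableAt ℂ (fun z => (Gamma (a + b * z))⁻¹) z :=
  (differentiable_one_div_Gamma.comp
    (by fun_prop : Differentiable ℂ fun z : ℂ => a + b * z)) z

theorem differentiableAt_gammaKernel (c : Fin (n + 1) → Fin r) {z : ℂ} (hz : ∀ l : ℕ, z ≠ -l) :
    DifferentiableAt ℂ (gammaKernel c) z := by
  refine DifferentiableAt.fun_finsetProd fun i _ => ?_
  exact ((differentiableAt_Gamma z hz).pow _).mul (differentiableAt_inv_Gamma_affine _ _ _)

theorem differentiable_expFactor (n m : ℕ) : Differentiable ℂ (expFactor n m) := by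
  unfold expFactor
  fun_prop

theorem differentiableAt_periodWeight (c : Fin (n + 1) → Fin r) (m : ℕ) {σ : ℂ}
    (hσ : ∀ l : ℕ, σ ≠ I * l) : DifferentiableAt ℂ (periodWeight c m) σ := by
  have h : ∀ l : ℕ, I * σ ≠ -l := by
    intro l hl
    apply hσ l
    linear_combination (-I) * hl + σ * I_mul_I
  unfold periodWeight
  have := (differentiableAt_gammaKernel c h).fun_comp' σ
    (by fun_prop : DifferentiableAt ℂ (fun σ : ℂ => I * σ) σ)
  have h2 := differentiable_expFactor n m
  fun_prop

theorem differentiableAt_periodIntegrand (c : Fin (n + 1) → Fin r) (m : ℕ) (t : ℂ) {σ : ℂ}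
    (hσ : ∀ l : ℕ, σ ≠ I * l) : DifferentiableAt ℂ (periodIntegrand c m t) σ :=
  (differentiableAt_periodWeight c m hσ).mul (by fun_prop)

end Integrand

/-! ## Sums of integrals over small circles around the poles -/

section CircleSum

/-- The integral of `φ(σ) e^{itσ}` over the circle of radius `1/3` around `il`. -/
noncomputable def circleTerm (φ : ℂ → ℂ) (l : ℕ) (t : ℂ) : ℂ :=
  circleIntegral (fun σ => φ σ * exp (I * t * σ)) (I * l) (1 / 3)

/-- The sum over `l` of the integrals of `φ(σ) e^{itσ}` over the circles around `il`. -/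
noncomputable def circleSum (φ : ℂ → ℂ) (t : ℂ) : ℂ := ∑' l : ℕ, circleTerm φ l t

/-- `φ` is continuous on the circles around `il` and grows at most like `e^{bl}` there. -/
def CircleBound (φ : ℂ → ℂ) (b : ℝ) : Prop :=
  (∀ l : ℕ, ContinuousOn φ (Metric.sphere (I * l) (1 / 3))) ∧
    ∃ K : ℝ, ∀ l : ℕ, ∀ σ ∈ Metric.sphere (I * l : ℂ) (1 / 3), ‖φ σ‖ ≤ K * Real.exp (b * l)

theorem re_im_of_mem_sphere {l : ℕ} {σ : ℂ} (h : σ ∈ Metric.sphere (I * l : ℂ) (1 / 3)) :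
    |σ.re| ≤ 1 / 3 ∧ |σ.im - l| ≤ 1 / 3 ∧ σ.re ^ 2 + (σ.im - l) ^ 2 = 1 / 9 := by
  rw [mem_sphere_iff_norm] at h
  have h1 := abs_re_le_norm (σ - I * l)
  have h2 := abs_im_le_norm (σ - I * l)
  have h3 := congrArg (· ^ 2) h
  simp only [← normSq_eq_norm_sq, normSq_apply] at h3
  simp at h h1 h2 h3
  rw [h] at h1 h2
  norm_num at h1 h2 h3
  refine ⟨by linarith, by linarith, by linarith⟩

theorem norm_exp_I_mul (t σ : ℂ) :
    ‖exp (I * t * σ)‖ = Real.exp (-(t.re * σ.im + t.im * σ.re)) := by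
  rw [norm_exp]
  congr 1
  simp
  ring

/-- On e^{itσ} the operator d/dt is multiplication by iσ. Differentiation under the integral is
dominated by compactness of the circle times a closed disc of parameters. -/
theorem hasDerivAt_circleTerm {φ : ℂ → ℂ} {l : ℕ}
    (hφ : ContinuousOn φ (Metric.sphere (I * l) (1 / 3))) (t : ℂ) :
    HasDerivAt (circleTerm φ l) (circleTerm (fun σ => I * σ * φ σ) l t) t := by
  obtain ⟨γ, hγ⟩ : ∃ γ, γ = circleMap (I * l : ℂ) (1 / 3) := ⟨_, rfl⟩
  have hmem : ∀ θ, γ θ ∈ Metric.sphere (I * l : ℂ) (1 / 3) := fun θ =>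
    hγ ▸ circleMap_mem_sphere _ (by norm_num) θ
  have hγc : Continuous γ := hγ ▸ continuous_circleMap _ _
  have hφc : Continuous fun θ => φ (γ θ) :=
    continuousOn_univ.1 (hφ.comp hγc.continuousOn fun θ _ => hmem θ)
  have hγ' : Continuous (deriv γ) := by
    have : deriv γ = fun θ => circleMap 0 (1 / 3) θ * I := by
      funext θ
      rw [hγ]
      exact deriv_circleMap _ _ _
    rw [this]
    fun_prop
  obtain ⟨δ, hδ⟩ : ∃ δ, δ = deriv γ := ⟨_, rfl⟩
  rw [← hδ] at hγ'
  set F : ℂ → ℝ → ℂ := fun t θ => δ θ • (φ (γ θ) * exp (I * t * γ θ)) with hF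
  set F' : ℂ → ℝ → ℂ := fun t θ => δ θ • (I * γ θ * φ (γ θ) * exp (I * t * γ θ)) with hF'
  have hcF' : Continuous fun p : ℂ × ℝ => F' p.1 p.2 := by
    simp only [hF', smul_eq_mul]
    have h1 := hφc.comp (continuous_snd (X := ℂ) (Y := ℝ))
    have h2 := hγ'.comp (continuous_snd (X := ℂ) (Y := ℝ))
    have h3 := hγc.comp (continuous_snd (X := ℂ) (Y := ℝ))
    simp only [Function.comp_def] at h1 h2 h3
    exact h2.mul (((continuous_const.mul h3).mul h1).mul (by fun_prop))
  obtain ⟨M, hM⟩ := ((isCompact_closedBall t 1).prod (isCompact_Icc (a := (0 : ℝ))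
    (b := 2 * Real.pi))).exists_bound_of_continuousOn hcF'.continuousOn
  have key := (intervalIntegral.hasDerivAt_integral_of_dominated_loc_of_deriv_le (μ := volume)
    (a := 0) (b := 2 * Real.pi) (F := F) (F' := F') (x₀ := t) (s := Metric.ball t 1)
    (bound := fun _ => M) (Metric.ball_mem_nhds _ one_pos) ?_ ?_ ?_ ?_ ?_ ?_).2
  · rw [hF, hF', hδ, hγ] at key
    exact key
  · refine Filter.Eventually.of_forall fun t => Continuous.aestronglyMeasurable ?_
    simp only [hF, smul_eq_mul]
    exact hγ'.mul (hφc.mul (by fun_prop))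
  · refine Continuous.intervalIntegrable ?_ _ _
    simp only [hF, smul_eq_mul]
    exact hγ'.mul (hφc.mul (by fun_prop))
  · exact (hcF'.comp (continuous_const.prodMk continuous_id)).aestronglyMeasurable
  · refine Filter.Eventually.of_forall fun θ hθ x hx => hM (x, θ) ⟨Metric.ball_subset_closedBall hx, ?_⟩
    rw [Set.uIoc_of_le (by positivity)] at hθ
    exact Set.Ioc_subset_Icc_self hθ
  · exact _root_.intervalIntegrable_const
  · refine Filter.Eventually.of_forall fun θ _ x _ => ?_
    simp only [hF, hF', smul_eq_mul]
    have h : HasDerivAt (fun x => exp (I * x * γ θ)) (exp (I * x * γ θ) * (I * 1 * γ θ)) x :=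
      (((hasDerivAt_id x).const_mul I).mul_const (γ θ)).cexp
    refine ((h.const_mul (φ (γ θ))).const_mul (δ θ)).congr_deriv ?_
    ring

/-- On the circle Im σ ≥ l - 1/3 and |Re σ| ≤ 1/3. This gives a geometric majorant with ratio e^{b -
Re t}, locally uniform in t. -/
theorem CircleBound.norm_circleTerm_le {φ : ℂ → ℂ} {b : ℝ} (h : CircleBound φ b) :
    ∃ K : ℝ, 0 ≤ K ∧ ∀ (l : ℕ) (t : ℂ), 0 ≤ t.re → ‖circleTerm φ l t‖ ≤
      K * Real.exp ((t.re + |t.im|) / 3) * Real.exp (b - t.re) ^ l := by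
  obtain ⟨_, K, hK⟩ := h
  refine ⟨2 * Real.pi * (1 / 3) * |K|, by positivity, fun l t ht => ?_⟩
  have := circleIntegral.norm_integral_le_of_norm_le_const (c := (I * l : ℂ)) (R := 1 / 3)
    (f := fun σ => φ σ * exp (I * t * σ))
    (C := |K| * Real.exp ((t.re + |t.im|) / 3) * Real.exp (b - t.re) ^ l) (by norm_num) ?_
  · refine this.trans (le_of_eq (by ring))
  · intro σ hσ
    obtain ⟨h1, h2, -⟩ := re_im_of_mem_sphere hσ
    rw [norm_mul, norm_exp_I_mul, mul_assoc, ← Real.exp_nat_mul, ← Real.exp_add]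
    have h3 : -(t.im * σ.re) ≤ |t.im| / 3 := by
      refine (neg_le_abs _).trans ?_
      rw [abs_mul]
      nlinarith [abs_nonneg t.im]
    calc _ ≤ |K| * Real.exp (b * l) * Real.exp (-(t.re * σ.im + t.im * σ.re)) := by
          gcongr
          exact (hK l σ hσ).trans (by gcongr; exact le_abs_self K)
      _ = |K| * Real.exp (b * l + -(t.re * σ.im + t.im * σ.re)) := by
          rw [Real.exp_add]; ring
      _ ≤ _ := by
          refine mul_le_mul_of_nonneg_left (Real.exp_le_exp.2 ?_) (abs_nonneg K)
          have := (abs_le.1 h2).1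
          nlinarith

theorem CircleBound.summable_norm {φ : ℂ → ℂ} {b : ℝ} (h : CircleBound φ b) {t : ℂ}
    (ht0 : 0 ≤ t.re) (ht : b < t.re) : Summable fun l => ‖circleTerm φ l t‖ := by
  obtain ⟨K, hK, hb⟩ := h.norm_circleTerm_le
  refine Summable.of_nonneg_of_le (fun _ => norm_nonneg _) (fun l => hb l t ht0) ?_
  refine (summable_geometric_of_lt_one (Real.exp_nonneg _) ?_).mul_left _
  rw [Real.exp_lt_one_iff]
  linarith

theorem CircleBound.hasSum {φ : ℂ → ℂ} {b : ℝ} (h : CircleBound φ b) {t : ℂ}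
    (ht0 : 0 ≤ t.re) (ht : b < t.re) : HasSum (fun l => circleTerm φ l t) (circleSum φ t) :=
  (h.summable_norm ht0 ht).of_norm.hasSum

theorem CircleBound.hasDerivAt {φ : ℂ → ℂ} {b : ℝ} (h : CircleBound φ b) {t : ℂ}
    (ht0 : 0 < t.re) (ht : b < t.re) :
    HasDerivAt (circleSum φ) (circleSum (fun σ => I * σ * φ σ) t) t := by
  obtain ⟨K, hK, hb⟩ := h.norm_circleTerm_le
  -- On the half-plane Re s > p the ratio is at most e^{b - p} < 1; the unit ball bounds the
  -- prefactor. So the series may be differentiated termwise.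
  obtain ⟨p, hp, hp2⟩ := exists_between (max_lt ht0 ht)
  rw [max_lt_iff] at hp
  set U : Set ℂ := {s | p < s.re} ∩ Metric.ball t 1 with hU
  have hUo : IsOpen U := (isOpen_lt continuous_const continuous_re).inter Metric.isOpen_ball
  have htU : t ∈ U := ⟨hp2, Metric.mem_ball_self one_pos⟩
  set M := K * Real.exp ((‖t‖ + 1 + (‖t‖ + 1)) / 3) with hM
  have hsum : Summable fun l : ℕ => M * Real.exp (b - p) ^ l :=
    (summable_geometric_of_lt_one (Real.exp_nonneg _)
      (by rw [Real.exp_lt_one_iff]; linarith)).mul_left _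
  have hle : ∀ (l : ℕ) (s : ℂ), s ∈ U → ‖circleTerm φ l s‖ ≤ M * Real.exp (b - p) ^ l := by
    rintro l s ⟨hs1, hs2⟩
    have hs1 : p < s.re := hs1
    have hn : ‖s‖ ≤ ‖t‖ + 1 := by
      rw [mem_ball_iff_norm] at hs2
      have := norm_le_norm_add_norm_sub' s t
      linarith
    have h1 := (re_le_norm s).trans hn
    have h2 := (abs_im_le_norm s).trans hn
    refine (hb l s (by linarith)).trans ?_
    rw [hM]
    gcongr
  have hd : ∀ l : ℕ, DifferentiableOn ℂ (circleTerm φ l) U := fun l s _ =>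
    (hasDerivAt_circleTerm (h.1 l) s).differentiableAt.differentiableWithinAt
  have h1 := hasSum_deriv_of_summable_norm hsum hd hUo hle htU
  have h2 := (differentiableOn_tsum_of_summable_norm hsum hd hUo hle).differentiableAt
    (hUo.mem_nhds htU)
  have h3 := h2.hasDerivAt
  rw [← h1.tsum_eq] at h3
  simp only [fun l => (hasDerivAt_circleTerm (h.1 l) t).deriv] at h3
  exact h3

theorem CircleBound.mul {φ ψ : ℂ → ℂ} {b d : ℝ} (h : CircleBound φ b) (h' : CircleBound ψ d) :
    CircleBound (fun σ => φ σ * ψ σ) (b + d) := by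
  obtain ⟨h1, K, hK⟩ := h
  obtain ⟨h2, M, hM⟩ := h'
  refine ⟨fun l => (h1 l).mul (h2 l), |K| * |M|, fun l σ hσ => ?_⟩
  rw [norm_mul, add_mul, Real.exp_add]
  calc _ ≤ (|K| * Real.exp (b * l)) * (|M| * Real.exp (d * l)) := by
        gcongr
        · exact (hK l σ hσ).trans (by gcongr; exact le_abs_self K)
        · exact (hM l σ hσ).trans (by gcongr; exact le_abs_self M)
    _ = _ := by ring

/-- Polynomial growth is absorbed by e^l. The exponent 1 is what later turns b < Re t into b + 1 <
Re t whenever derivatives are taken. -/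
theorem circleBound_eval (p : Polynomial ℂ) : CircleBound (fun σ => p.eval (I * σ)) 1 := by
  refine ⟨fun l => by fun_prop, ?_⟩
  induction p using Polynomial.induction_on' with
  | add p q hp hq =>
    obtain ⟨K, hK⟩ := hp
    obtain ⟨M, hM⟩ := hq
    refine ⟨K + M, fun l σ hσ => ?_⟩
    simp only [Polynomial.eval_add, add_mul]
    exact (norm_add_le _ _).trans (add_le_add (hK l σ hσ) (hM l σ hσ))
  | monomial k a =>
    refine ⟨‖a‖ * (k.factorial * Real.exp 1), fun l σ hσ => ?_⟩
    simp only [Polynomial.eval_monomial]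
    rw [norm_mul, norm_pow, norm_mul, norm_I, one_mul, mul_assoc]
    have h1 : ‖σ‖ ≤ l + 1 := by
      rw [mem_sphere_iff_norm] at hσ
      have := norm_le_norm_add_norm_sub' σ (I * l)
      rw [hσ, norm_mul, norm_I, one_mul, norm_natCast] at this
      linarith
    have h2 := Real.pow_div_factorial_le_exp ‖σ‖ (norm_nonneg _) k
    rw [div_le_iff₀ (by positivity)] at h2
    gcongr
    calc ‖σ‖ ^ k ≤ Real.exp ‖σ‖ * k.factorial := h2
      _ ≤ Real.exp (l + 1) * k.factorial := by gcongr
      _ = _ := by rw [Real.exp_add, one_mul]; ring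

end CircleSum

/-! ## Bounds for the weight -/

/-- From |sin(x + iy)|² = sin² x + sinh² y. -/
theorem Complex.abs_sin_re_le_norm_sin (z : ℂ) : |Real.sin z.re| ≤ ‖sin z‖ ∧ |z.im| ≤ ‖sin z‖ := by
  have h : ‖sin z‖ ^ 2 = Real.sin z.re ^ 2 + Real.sinh z.im ^ 2 := by
    rw [← normSq_eq_norm_sq, sin_eq, ← ofReal_sin, ← ofReal_cosh, ← ofReal_cos, ← ofReal_sinh,
      ← ofReal_mul, ← ofReal_mul, normSq_add_mul_I]
    have h1 := Real.sin_sq_add_cos_sq z.re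
    have h2 := Real.cosh_sq z.im
    rw [mul_pow, mul_pow, h2]
    linear_combination Real.sinh z.im ^ 2 * h1
  refine ⟨abs_le_of_sq_le_sq (by nlinarith) (norm_nonneg _),
    abs_le_of_sq_le_sq ?_ (norm_nonneg _)⟩
  rw [h]
  have : z.im ^ 2 ≤ Real.sinh z.im ^ 2 := by
    rw [sq_le_sq, Real.abs_sinh]
    exact Real.self_le_sinh_iff.2 (abs_nonneg _)
  nlinarith [sq_nonneg (Real.sin z.re)]

/-- Either |Re σ| ≥ 1/6, and the imaginary part π Re σ of the argument suffices; or |Im σ - l| ≥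
1/4, and Jordan's inequality gives |sin| ≥ 2 · 1/4. -/
theorem half_le_norm_sin_of_mem_sphere {l : ℕ} {σ : ℂ}
    (h : σ ∈ Metric.sphere (I * l : ℂ) (1 / 3)) : 1 / 2 ≤ ‖sin (Real.pi * (I * σ))‖ := by
  obtain ⟨h1, h2, h3⟩ := re_im_of_mem_sphere h
  have h4 := abs_sin_re_le_norm_sin (Real.pi * (I * σ))
  simp at h4
  have hpi := Real.pi_gt_three
  rw [abs_of_pos Real.pi_pos] at h4
  rcases le_total (1 / 6) |σ.re| with h5 | h5
  · nlinarith [h4.2]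
  · have h6 : 1 / 12 ≤ (σ.im - l) ^ 2 := by
      have : σ.re ^ 2 ≤ 1 / 36 := by rw [← sq_abs]; nlinarith [abs_nonneg σ.re]
      linarith
    have h7 : 1 / 4 ≤ |σ.im - l| := by
      by_contra hcon
      have : (σ.im - l) ^ 2 < 1 / 12 := by
        rw [← sq_abs]
        nlinarith [abs_nonneg (σ.im - l)]
      linarith
    have h8 := Real.mul_abs_le_abs_sin (x := Real.pi * (σ.im - l)) (by
      rw [abs_mul, abs_of_pos Real.pi_pos]
      nlinarith)
    rw [abs_mul, abs_of_pos Real.pi_pos, ← mul_assoc, div_mul_cancel₀ _ Real.pi_ne_zero] at h8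
    have h9 : |Real.sin (Real.pi * (σ.im - l))| = |Real.sin (Real.pi * σ.im)| := by
      rw [mul_sub, mul_comm Real.pi (l : ℝ), Real.sin_sub_nat_mul_pi, abs_mul, abs_pow, abs_neg,
        abs_one, one_pow, one_mul]
    rw [h9] at h8
    linarith [h4.1]

section Weight

variable {n r : ℕ}

theorem exists_norm_gammaKernel_le (c : Fin (n + 1) → Fin r) :
    ∃ K b : ℝ, 0 < K ∧ 0 ≤ b ∧ ∀ z : ℂ, z.re ≤ 0 → 1 / 2 ≤ ‖sin (Real.pi * z)‖ →
      ‖gammaKernel c z‖ ≤ K * Real.exp (-b * z.re) := by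
  choose K b hK hb h using fun i => exists_norm_Gamma_pow_le (blockSize c i)
  refine ⟨∏ i, K i, ∑ i, b i, Finset.prod_pos fun i _ => hK i, Finset.sum_nonneg fun i _ => hb i,
    fun z hz hs => ?_⟩
  rw [gammaKernel, norm_prod, ← Finset.sum_neg_distrib, Finset.sum_mul, Real.exp_sum,
    ← Finset.prod_mul_distrib]
  exact Finset.prod_le_prod (fun _ _ => norm_nonneg _) fun i _ => h i z hz hs

/-- In the upper half-plane |4^{iσ}| ≤ 1, and |e^{2πσ}| depends on Re σ alone. -/
theorem norm_expFactor_le {m : ℕ} (hm : m ≤ n + 1) {σ : ℂ} (hσ : 0 ≤ σ.im) :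
    ‖expFactor n m σ‖ ≤ 2 ^ (n + 1) * Real.exp (4 * Real.pi * (n + 1) * |σ.re|) := by
  have hpi := Real.pi_pos
  rw [expFactor, norm_mul, norm_pow, norm_exp]
  have h1 : ((n + 1) * (Real.log 4 * I + 2 * Real.pi) * σ : ℂ).re =
      (n + 1) * (2 * Real.pi * σ.re - Real.log 4 * σ.im) := by
    have e : ((n + 1) * (Real.log 4 * I + 2 * Real.pi) * σ : ℂ) =
        (((n + 1) * Real.log 4 : ℝ) : ℂ) * (I * σ) + (((n + 1) * (2 * Real.pi) : ℝ) : ℂ) * σ := by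
      push_cast
      ring
    rw [e, add_re, re_ofReal_mul, re_ofReal_mul, I_mul_re]
    ring
  have h2 : ‖1 - exp (2 * Real.pi * σ)‖ ≤ 2 * Real.exp (2 * Real.pi * |σ.re|) := by
    refine (norm_sub_le _ _).trans ?_
    rw [norm_exp, norm_one, show (2 * Real.pi * σ : ℂ).re = 2 * Real.pi * σ.re by simp]
    have h3 : (1 : ℝ) ≤ Real.exp (2 * Real.pi * |σ.re|) := Real.one_le_exp (by positivity)
    have h4 : Real.exp (2 * Real.pi * σ.re) ≤ Real.exp (2 * Real.pi * |σ.re|) := by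
      gcongr
      exact le_abs_self _
    linarith
  have h5 : (1 : ℝ) ≤ 2 * Real.exp (2 * Real.pi * |σ.re|) := by
    have h3 : (1 : ℝ) ≤ Real.exp (2 * Real.pi * |σ.re|) := Real.one_le_exp (by positivity)
    linarith
  calc _ ≤ Real.exp ((n + 1) * (2 * Real.pi * |σ.re|)) *
        (2 * Real.exp (2 * Real.pi * |σ.re|)) ^ (n + 1) := by
        gcongr
        · rw [h1]
          have : 0 ≤ Real.log 4 * σ.im := mul_nonneg (Real.log_nonneg (by norm_num)) hσ
          have : σ.re ≤ |σ.re| := le_abs_self _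
          gcongr
          nlinarith
        · exact (pow_le_pow_left₀ (norm_nonneg _) h2 m).trans (pow_le_pow_right₀ h5 hm)
    _ = _ := by
        rw [mul_pow, ← Real.exp_nat_mul, mul_left_comm, ← Real.exp_add]
        congr 2
        push_cast
        ring

theorem exists_norm_periodWeight_le (c : Fin (n + 1) → Fin r) :
    ∃ b : ℝ, 0 ≤ b ∧ ∃ K : ℝ, 0 < K ∧ ∀ m ≤ n + 1, ∀ σ : ℂ, 0 ≤ σ.im →
      1 / 2 ≤ ‖sin (Real.pi * (I * σ))‖ → ‖periodWeight c m σ‖ ≤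
        K * Real.exp (b * σ.im + 4 * Real.pi * (n + 1) * |σ.re|) := by
  obtain ⟨K, b, hK, hb, h⟩ := exists_norm_gammaKernel_le c
  refine ⟨b, hb, (‖periodConst r n‖ + 1) * K * 2 ^ (n + 1), by positivity,
    fun m hm σ hσ hs => ?_⟩
  have h1 := h (I * σ) (by simpa using hσ) hs
  rw [show -b * (I * σ).re = b * σ.im by simp] at h1
  rw [periodWeight, norm_mul, norm_mul, Real.exp_add]
  calc _ ≤ (‖periodConst r n‖ + 1) * (K * Real.exp (b * σ.im)) *
        (2 ^ (n + 1) * Real.exp (4 * Real.pi * (n + 1) * |σ.re|)) := by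
        gcongr
        · linarith
        · exact norm_expFactor_le hm hσ
    _ = _ := by ring

theorem sphere_ne_pole {l : ℕ} {σ : ℂ} (h : σ ∈ Metric.sphere (I * l : ℂ) (1 / 3)) (k : ℕ) :
    σ ≠ I * k := by
  intro hk
  have := half_le_norm_sin_of_mem_sphere h
  rw [hk, show (Real.pi : ℂ) * (I * (I * k)) = -((k : ℕ) * Real.pi) by
    linear_combination (Real.pi * k : ℂ) * I_mul_I, sin_neg, sin_nat_mul_pi] at this
  norm_num at this

/-- The circles with l ≥ 1 lie in the upper half-plane, where the growth bound applies; the circle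
around 0 does not, and is treated by compactness. -/
theorem circleBound_periodWeight (c : Fin (n + 1) → Fin r) :
    ∃ b : ℝ, 0 ≤ b ∧ ∀ m ≤ n + 1, CircleBound (periodWeight c m) b := by
  obtain ⟨b, hb, K, hK, h⟩ := exists_norm_periodWeight_le c
  refine ⟨b, hb, fun m hm => ?_⟩
  have hc : ∀ l : ℕ, ContinuousOn (periodWeight c m) (Metric.sphere (I * l) (1 / 3)) :=
    fun l σ hσ => (differentiableAt_periodWeight c m
      (sphere_ne_pole hσ)).continuousAt.continuousWithinAt
  obtain ⟨M, hM⟩ := (isCompact_sphere (I * (0 : ℕ) : ℂ) (1 / 3)).exists_bound_of_continuousOn (hc 0)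
  refine ⟨hc, max M (K * Real.exp (b + 4 * Real.pi * (n + 1))), fun l σ hσ => ?_⟩
  rcases Nat.eq_zero_or_pos l with rfl | hl
  · rw [Nat.cast_zero, mul_zero, Real.exp_zero, mul_one]
    exact (hM σ hσ).trans (le_max_left _ _)
  · obtain ⟨h1, h2, -⟩ := re_im_of_mem_sphere hσ
    have hl1 : (1 : ℝ) ≤ l := by exact_mod_cast hl
    have h3 := abs_le.1 h2
    refine (h m hm σ (by linarith) (half_le_norm_sin_of_mem_sphere hσ)).trans ?_
    calc _ ≤ K * Real.exp (b * (l + 1) + 4 * Real.pi * (n + 1) * 1) := by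
          have := Real.pi_pos
          gcongr <;> linarith
      _ = K * Real.exp (b + 4 * Real.pi * (n + 1)) * Real.exp (b * l) := by
          rw [mul_assoc K, ← Real.exp_add]; ring_nf
      _ ≤ _ := by gcongr; exact le_max_right _ _

end Weight

/-! ## Convergence of the A-periods, and their expansion into residues -/

section TailHeight

/-- The height `1/2 (1 - e^{-2|x|})^n |2x|^k` of the standard contour. -/
noncomputable def tailHeight (n k : ℕ) (x : ℝ) : ℝ :=
  1 / 2 * ((1 - Real.exp (-(2 * |x|))) ^ n * (2 * |x|) ^ k)

/-- Bernoulli's inequality, together with u e^{-2u} ≤ 1. -/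
theorem abs_sub_le_mul_one_sub_exp_pow (n : ℕ) (x : ℝ) :
    |x| - n ≤ |x| * (1 - Real.exp (-(2 * |x|))) ^ n := by
  set u := |x|
  have hu : 0 ≤ u := abs_nonneg x
  have he : Real.exp (-(2 * u)) ≤ 1 := Real.exp_le_one_iff.2 (by linarith)
  have h1 := one_add_mul_le_pow (a := -Real.exp (-(2 * u))) (by linarith) n
  have h2 : u * Real.exp (-(2 * u)) ≤ 1 := by
    rw [Real.exp_neg, ← div_eq_mul_inv, div_le_one (Real.exp_pos _)]
    linarith [Real.add_one_le_exp (2 * u)]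
  rw [← sub_eq_add_neg] at h1
  nlinarith [mul_le_mul_of_nonneg_left h1 hu, Nat.cast_nonneg (α := ℝ) n]

theorem tailHeight_ge {n k j : ℕ} {x : ℝ} (hx : 1 ≤ |x|) (hj : j + 1 ≤ k) :
    (2 * |x|) ^ j * (|x| - n) ≤ tailHeight n k x := by
  have h1 := abs_sub_le_mul_one_sub_exp_pow n x
  have h2 : (2 * |x|) ^ (j + 1) ≤ (2 * |x|) ^ k := pow_le_pow_right₀ (by linarith) hj
  have h3 : 0 ≤ (1 - Real.exp (-(2 * |x|))) ^ n :=
    pow_nonneg (by linarith [Real.exp_le_one_iff.2 (show -(2 * |x|) ≤ 0 by linarith)]) _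
  calc _ ≤ (2 * |x|) ^ j * (|x| * (1 - Real.exp (-(2 * |x|))) ^ n) := by gcongr
    _ = 1 / 2 * ((1 - Real.exp (-(2 * |x|))) ^ n * (2 * |x|) ^ (j + 1)) := by ring
    _ ≤ _ := by unfold tailHeight; gcongr

/-- For k ≥ 2 the height grows at least quadratically and beats E|x| for any D > 0. For k = 1 it is
only |x| up to a constant, so D must exceed E by 1; with D and E coming from Re t and |Im t|, this
is the extra condition on t. -/
theorem exists_tailHeight_exponent_le {n k : ℕ} (hk : 1 ≤ k) {D E : ℝ} (hD : 0 < D) (hE : 0 ≤ E)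
    (h : k = 1 → E + 1 ≤ D) :
    ∃ A X : ℝ, ∀ x : ℝ, X ≤ |x| → -(D * tailHeight n k x) + E * |x| ≤ A - |x| := by
  rcases eq_or_ne k 1 with rfl | hk1
  · refine ⟨n * D, 1, fun x hx => ?_⟩
    have h1 := tailHeight_ge (n := n) (j := 0) (k := 1) hx le_rfl
    rw [pow_zero, one_mul] at h1
    nlinarith [h rfl, mul_le_mul_of_nonneg_left h1 hD.le]
  · refine ⟨0, max 1 (n + (E + 1) / D), fun x hx => ?_⟩
    rw [max_le_iff] at hx
    have h1 := tailHeight_ge (n := n) (j := 1) (k := k) hx.1 (by omega)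
    rw [pow_one] at h1
    have h2 : E + 1 ≤ D * (|x| - n) := by
      rw [mul_comm, ← div_le_iff₀ hD]
      linarith [hx.2]
    have h3 := mul_le_mul_of_nonneg_left h1 hD.le
    nlinarith [hx.1]

theorem tendsto_tailHeight {n k : ℕ} (hk : 1 ≤ k) :
    Filter.Tendsto (tailHeight n k) Filter.atTop Filter.atTop := by
  refine Filter.tendsto_atTop_mono' _ ?_
    (Filter.tendsto_atTop_add_const_right _ (-(n : ℝ)) Filter.tendsto_id)
  filter_upwards [Filter.eventually_ge_atTop 1] with x hx
  have h := tailHeight_ge (n := n) (j := 0) (k := k) (x := x) (by rwa [abs_of_pos (by linarith)])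
    (by omega)
  rw [abs_of_pos (by linarith), pow_zero, one_mul] at h
  exact h

/-- The slope of the tail grows polynomially. Bounding it by e^{|x|/2} uses up half of the decay
e^{-|x|} of the integrand. -/
theorem exists_abs_deriv_le_of_tail {y : ℝ → ℝ} {n k : ℕ} {ρ : ℝ}
    (hy : ∀ x, ρ ≤ |x| → y x = tailHeight n k x) :
    ∃ M X : ℝ, 0 ≤ M ∧ ∀ x : ℝ, X ≤ |x| → |deriv y x| ≤ M * Real.exp (|x| / 2) := by
  set f : ℝ → ℝ := fun u => 1 / 2 * ((1 - Real.exp (-(2 * u))) ^ n * (2 * u) ^ k) with hf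
  have hbound : ∀ u : ℝ, 1 ≤ u → ∃ f' : ℝ, HasDerivAt f f' u ∧
      |f'| ≤ (n + k) * (4 ^ k * k.factorial) * Real.exp (u / 2) := by
    intro u hu
    have h1 : HasDerivAt (fun u : ℝ => 1 - Real.exp (-(2 * u)))
        (-(Real.exp (-(2 * u)) * (-(2 * 1)))) u :=
      ((((hasDerivAt_id u).const_mul 2).neg).exp).const_sub 1
    have h2 : HasDerivAt (fun u : ℝ => 2 * u) (2 * 1) u := (hasDerivAt_id u).const_mul 2
    refine ⟨_, ((h1.pow n).mul (h2.pow k)).const_mul (1 / 2), ?_⟩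
    set e := Real.exp (-(2 * u))
    have he0 : 0 < e := Real.exp_pos _
    have he1 : e ≤ 1 := Real.exp_le_one_iff.2 (by linarith)
    have hq : ∀ j : ℕ, 0 ≤ (1 - e) ^ j ∧ (1 - e) ^ j ≤ 1 := fun j =>
      ⟨pow_nonneg (by linarith) _, pow_le_one₀ (by linarith) (by linarith)⟩
    have hk : (2 * u) ^ k ≤ 4 ^ k * k.factorial * Real.exp (u / 2) := by
      have := Real.pow_div_factorial_le_exp (u / 2) (by linarith) k
      rw [div_le_iff₀ (by positivity)] at this
      rw [show 2 * u = 4 * (u / 2) by ring, mul_pow, mul_assoc]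
      gcongr
      linarith
    have hk1 : (2 * u) ^ (k - 1) ≤ (2 * u) ^ k := pow_le_pow_right₀ (by linarith) (by omega)
    have hp1 : 0 ≤ (2 * u) ^ (k - 1) := by positivity
    have hp : 0 ≤ (2 * u) ^ k := by positivity
    have t1 : e * ((1 - e) ^ (n - 1) * (2 * u) ^ k) ≤ (2 * u) ^ k := by
      have : (1 - e) ^ (n - 1) * (2 * u) ^ k ≤ 1 * (2 * u) ^ k := by gcongr; exact (hq _).2
      nlinarith [mul_nonneg (hq (n - 1)).1 hp]
    have t2 : (1 - e) ^ n * (2 * u) ^ (k - 1) ≤ (2 * u) ^ k := by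
      have : (1 - e) ^ n * (2 * u) ^ (k - 1) ≤ 1 * (2 * u) ^ k := by gcongr; exact (hq _).2
      linarith
    have t3 : 0 ≤ e * ((1 - e) ^ (n - 1) * (2 * u) ^ k) :=
      mul_nonneg he0.le (mul_nonneg (hq _).1 hp)
    have t4 : 0 ≤ (1 - e) ^ n * (2 * u) ^ (k - 1) := mul_nonneg (hq _).1 hp1
    have eq : 1 / 2 * (n * (1 - e) ^ (n - 1) * -(e * -(2 * 1)) * (2 * u) ^ k +
        (1 - e) ^ n * (k * (2 * u) ^ (k - 1) * (2 * 1))) =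
        n * (e * ((1 - e) ^ (n - 1) * (2 * u) ^ k)) + k * ((1 - e) ^ n * (2 * u) ^ (k - 1)) := by
      ring
    change |1 / 2 * (n * (1 - e) ^ (n - 1) * -(e * -(2 * 1)) * (2 * u) ^ k +
        (1 - e) ^ n * (k * (2 * u) ^ (k - 1) * (2 * 1)))| ≤ _
    rw [eq, abs_of_nonneg (by positivity)]
    calc _ ≤ n * (2 * u) ^ k + k * (2 * u) ^ k := by gcongr
      _ = (n + k) * (2 * u) ^ k := by ring
      _ ≤ (n + k) * (4 ^ k * k.factorial * Real.exp (u / 2)) := by gcongr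
      _ = _ := by ring
  refine ⟨(n + k) * (4 ^ k * k.factorial), max 1 (|ρ| + 1), by positivity, fun x hx => ?_⟩
  rw [max_le_iff] at hx
  obtain ⟨f', hf', hle⟩ := hbound |x| hx.1
  -- Near x the sign of u is that of x, so |u| is u or -u and the tail is differentiable.
  have hev : ∀ᶠ u in nhds x, ρ ≤ |u| ∧ 0 < u * x := by
    have c1 : ContinuousAt (fun u : ℝ => |u|) x := by fun_prop
    have c2 : ContinuousAt (fun u : ℝ => u * x) x := by fun_prop
    have hx0 : x ≠ 0 := by rintro rfl; simp at hx; linarith [hx.1]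
    filter_upwards [c1.eventually_const_lt (show ρ < |x| by linarith [le_abs_self ρ, hx.2]),
      c2.eventually_const_lt (mul_self_pos.2 hx0)] with u h1 h2 using ⟨h1.le, h2⟩
  rcases le_total 0 x with h0 | h0
  · rw [abs_of_nonneg h0] at hf' hle ⊢
    have : y =ᶠ[nhds x] f := by
      filter_upwards [hev] with u hu
      have : 0 ≤ u := by
        by_contra hcon
        nlinarith [hu.2]
      rw [hy u hu.1, tailHeight, abs_of_nonneg this]
    rw [this.deriv_eq, hf'.deriv]
    exact hle
  · rw [abs_of_nonpos h0] at hf' hle ⊢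
    have : y =ᶠ[nhds x] fun u => f (-u) := by
      filter_upwards [hev] with u hu
      have : u ≤ 0 := by
        by_contra hcon
        nlinarith [hu.2]
      rw [hy u hu.1, tailHeight, abs_of_nonpos this]
    rw [this.deriv_eq, deriv_comp_neg, hf'.deriv, abs_neg]
    exact hle

theorem integrable_exp_neg_abs_div_two : Integrable fun x : ℝ => Real.exp (-(|x| / 2)) := by
  have h1 : IntegrableOn (fun x : ℝ => Real.exp (-(|x| / 2))) (Set.Ioi 0) := by
    refine (integrableOn_exp_mul_Ioi (a := -(1 / 2)) (by norm_num) 0).congr_fun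
      (fun x hx => ?_) measurableSet_Ioi
    have hx : 0 < x := hx
    simp only [abs_of_pos hx]
    ring_nf
  have h2 : IntegrableOn (fun x : ℝ => Real.exp (-(|x| / 2))) (Set.Iic 0) := by
    refine (integrableOn_exp_mul_Iic (a := 1 / 2) (by norm_num) 0).congr_fun
      (fun x hx => ?_) measurableSet_Iic
    have hx : x ≤ 0 := hx
    simp only [abs_of_nonpos hx]
    ring_nf
  rw [← integrableOn_univ, ← Set.Iic_union_Ioi (a := (0 : ℝ))]
  exact h2.union h1

end TailHeight

section Convergence

/-- Convergence of the integral over a contour with the standard tail, for an integrand of at most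
exponential growth with the poles `il`. -/
theorem integrable_and_tendsto_sum_circleIntegral {F : ℂ → ℂ}
    (hF : ∀ z : ℂ, (∀ l : ℕ, z ≠ I * l) → DifferentiableAt ℂ F z)
    {K D E : ℝ} (hK : 0 ≤ K) (hD : 0 < D) (hE : 0 ≤ E)
    (hbd : ∀ σ : ℂ, 0 ≤ σ.im → 1 / 2 ≤ ‖sin (Real.pi * (I * σ))‖ →
      ‖F σ‖ ≤ K * Real.exp (-(D * σ.im) + E * |σ.re|))
    {y : ℝ → ℝ} (hy : ContDiff ℝ 1 y) (hy0 : y 0 < 0) {n k : ℕ} (hk : 1 ≤ k)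
    (hDE : k = 1 → E + 1 ≤ D) {ρ : ℝ} (htail : ∀ x, ρ ≤ |x| → y x = tailHeight n k x) :
    Integrable (fun x : ℝ => F (x + I * y x) * (1 + I * deriv y x)) ∧
      Filter.Tendsto (fun N => ∑ l ∈ Finset.range N, circleIntegral F (I * l) (1 / 3)) Filter.atTop
        (nhds (∫ x : ℝ, F (x + I * y x) * (1 + I * deriv y x))) := by
  obtain ⟨A, X0, hA⟩ := exists_tailHeight_exponent_le (n := n) hk hD hE hDE
  obtain ⟨M, X1, hM, hy'⟩ := exists_abs_deriv_le_of_tail htail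
  set X := max (max 1 ρ) (max X0 X1) with hX
  have hXs : ∀ x : ℝ, X ≤ x → 1 ≤ x ∧ ρ ≤ x ∧ X0 ≤ x ∧ X1 ≤ x := by
    intro x hx
    rw [hX, max_le_iff, max_le_iff, max_le_iff] at hx
    exact ⟨hx.1.1, hx.1.2, hx.2.1, hx.2.2⟩
  have htail0 : ∀ x, 0 ≤ tailHeight n k x := by
    intro x
    have : Real.exp (-(2 * |x|)) ≤ 1 := Real.exp_le_one_iff.2 (by linarith [abs_nonneg x])
    have := pow_nonneg (sub_nonneg.2 this) n
    unfold tailHeight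
    positivity
  have hFb : ∀ x : ℝ, X ≤ |x| → ‖F (x + I * y x)‖ ≤ K * Real.exp (A - |x|) := by
    intro x hx
    obtain ⟨h1, h2, h3, -⟩ := hXs _ hx
    have him : ((x : ℂ) + I * y x).im = tailHeight n k x := by simp [htail x h2]
    have hre : ((x : ℂ) + I * y x).re = x := by simp
    refine (hbd _ (him ▸ htail0 x) ?_).trans ?_
    -- On the tail the sine is bounded below through the imaginary part of its argument: π|x| ≥ 1/2.
    · refine le_trans ?_ (abs_sin_re_le_norm_sin _).2
      rw [im_ofReal_mul, I_mul_im, hre, abs_mul, abs_of_pos Real.pi_pos]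
      nlinarith [Real.pi_gt_three]
    · rw [him, hre]
      gcongr
      exact hA x h3
  have hγF : Continuous fun x : ℝ => F (x + I * y x) := by
    -- The graph could meet a pole only over x = 0, where y is negative.
    refine continuous_iff_continuousAt.2 fun x => ContinuousAt.comp' (g := F) ?_ ?_
    · refine (hF _ fun l hl => ?_).continuousAt
      have hre := congrArg re hl
      have him := congrArg im hl
      simp at hre him
      rw [hre] at him
      have : (0 : ℝ) ≤ l := Nat.cast_nonneg l
      linarith
    · have := hy.continuous
      fun_prop
  have hc : Continuous fun x : ℝ => F (x + I * y x) * (1 + I * deriv y x) := by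
    have := hy.continuous_deriv le_rfl
    exact hγF.mul (by fun_prop)
  have hint : Integrable (fun x : ℝ => F (x + I * y x) * (1 + I * deriv y x)) := by
    obtain ⟨B, hB⟩ := (isCompact_Icc (a := -X) (b := X)).exists_bound_of_continuousOn hc.continuousOn
    set B' := max (B * Real.exp (X / 2)) (K * Real.exp A * (1 + M))
    refine Integrable.mono' (integrable_exp_neg_abs_div_two.const_mul B') hc.aestronglyMeasurable
      (Filter.Eventually.of_forall fun x => ?_)
    rcases le_total X |x| with hx | hx
    · have h1 := hFb x hx
      have h2 := hy' x (hXs _ hx).2.2.2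
      have h3 : ‖(1 + I * deriv y x : ℂ)‖ ≤ (1 + M) * Real.exp (|x| / 2) := by
        refine (norm_add_le _ _).trans ?_
        rw [norm_one, norm_mul, norm_I, one_mul, norm_real, Real.norm_eq_abs]
        have := Real.one_le_exp (x := |x| / 2) (by positivity)
        linarith
      rw [norm_mul]
      calc _ ≤ K * Real.exp (A - |x|) * ((1 + M) * Real.exp (|x| / 2)) := by gcongr
        _ = K * Real.exp A * (1 + M) * Real.exp (-(|x| / 2)) := by
          rw [show A - |x| = A + (-(|x| / 2) + -(|x| / 2)) by ring, Real.exp_add, Real.exp_add]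
          have : Real.exp (-(|x| / 2)) * Real.exp (|x| / 2) = 1 := by
            rw [← Real.exp_add]; simp
          linear_combination (K * Real.exp A * (1 + M) * Real.exp (-(|x| / 2))) * this
        _ ≤ _ := by gcongr; exact le_max_right _ _
    · have h1 := hB x (abs_le.1 hx)
      have hB0 : 0 ≤ B := (norm_nonneg _).trans h1
      calc _ ≤ B * 1 := by linarith
        _ ≤ B * Real.exp (X / 2 + -(|x| / 2)) := by
          gcongr
          exact Real.one_le_exp (by linarith)
        _ = B * Real.exp (X / 2) * Real.exp (-(|x| / 2)) := by rw [Real.exp_add]; ring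
        _ ≤ _ := by gcongr; exact le_max_left _ _
  refine ⟨hint, ?_⟩
  have hlim1 := intervalIntegral_tendsto_integral hint Filter.tendsto_neg_atTop_atBot
    Filter.tendsto_id
  have hlim2 : Filter.Tendsto (fun x : ℝ => K * Real.exp A * 2 * (x ^ 1 * Real.exp (-x)))
      Filter.atTop (nhds (K * Real.exp A * 2 * 0)) :=
    (Real.tendsto_pow_mul_exp_neg_atTop_nhds_zero 1).const_mul _
  rw [mul_zero] at hlim2
  rw [Metric.tendsto_atTop]
  intro ε hε
  obtain ⟨R1, hR1⟩ := (Metric.tendsto_atTop.1 hlim1) (ε / 2) (by positivity)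
  obtain ⟨R2, hR2⟩ := (Metric.tendsto_atTop.1 hlim2) (ε / 2) (by positivity)
  set R := max X (max R1 R2) with hR
  obtain ⟨N0, hN0⟩ := exists_nat_gt (|tailHeight n k R| + 1)
  refine ⟨N0, fun N hN => ?_⟩
  have hN' : |tailHeight n k R| + 1 < N := hN0.trans_le (by exact_mod_cast hN)
  have hcont : Continuous (tailHeight n k) := by
    unfold tailHeight
    fun_prop
  -- The truncation point x ≥ R is chosen so that the tail has height exactly N - 1/2 there, halfway
  -- between two poles.
  obtain ⟨x, hxR, hx⟩ := intermediate_value_Ici (a := R) hcont.continuousOn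
    (tendsto_tailHeight hk) (show (N : ℝ) - 1 / 2 ∈ Set.Ici (tailHeight n k R) by
      rw [Set.mem_Ici]; linarith [le_abs_self (tailHeight n k R)])
  have hxR : R ≤ x := hxR
  have hxX : X ≤ x := (le_max_left _ _).trans hxR
  have hx1 : R1 ≤ x := (le_max_left _ _).trans ((le_max_right X _).trans hxR)
  have hx2 : R2 ≤ x := (le_max_right _ _).trans ((le_max_right X _).trans hxR)
  obtain ⟨h1, h2, h3, h4⟩ := hXs x hxX
  have hx0 : 0 < x := by linarith
  have habs : |x| = x := abs_of_pos hx0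
  have e1 : y x = N - 1 / 2 := by rw [htail x (by rwa [habs]), hx]
  have e2 : y (-x) = N - 1 / 2 := by
    rw [htail (-x) (by rwa [abs_neg, habs]), ← hx, tailHeight, tailHeight, abs_neg]
  have hN1 : N ≠ 0 := by
    rintro rfl
    have := abs_nonneg (tailHeight n k R)
    norm_num at hN'
    linarith
  have key := integral_graph_eq_sum_circleIntegral hF hy hy0 hx0 hN1 (R := 1 / 3) (by norm_num)
    (by norm_num) e1 e2
  -- On the horizontal segment the real part of the argument of the sine is π/2 modulo π, and the
  -- exponent is largest at the endpoints, which lie on the contour. So F is at most K e^{A - x} on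
  -- a segment of length 2x.
  have htop : ‖∫ u in (-x)..x, F (u + I * ((N - 1 / 2 : ℝ) : ℂ))‖ ≤
      K * Real.exp A * 2 * (x ^ 1 * Real.exp (-x)) := by
    have := intervalIntegral.norm_integral_le_of_norm_le_const (a := -x) (b := x)
      (f := fun u : ℝ => F (u + I * ((N - 1 / 2 : ℝ) : ℂ))) (C := K * Real.exp (A - x)) ?_
    · refine this.trans (le_of_eq ?_)
      rw [sub_neg_eq_add, abs_of_pos (by linarith), sub_eq_add_neg, Real.exp_add]
      ring
    · intro u hu
      rw [Set.uIoc_of_le (by linarith)] at hu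
      have hux : |u| ≤ x := abs_le.2 ⟨hu.1.le, hu.2⟩
      have him : ((u : ℂ) + I * ((N - 1 / 2 : ℝ) : ℂ)).im = N - 1 / 2 := by
        rw [add_im, ofReal_im, I_mul_im, ofReal_re, zero_add]
      have hre : ((u : ℂ) + I * ((N - 1 / 2 : ℝ) : ℂ)).re = u := by
        rw [add_re, ofReal_re, I_mul_re, ofReal_im, neg_zero, add_zero]
      refine (hbd _ (by rw [him, ← hx]; exact htail0 x) ?_).trans ?_
      · refine le_trans ?_ (abs_sin_re_le_norm_sin _).1
        rw [re_ofReal_mul, I_mul_re, him, show Real.pi * -((N : ℝ) - 1 / 2) =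
          Real.pi / 2 - N * Real.pi by ring, Real.sin_sub_nat_mul_pi, Real.sin_pi_div_two]
        simp
        norm_num
      · rw [him, hre, ← hx]
        have := hA x (by rwa [habs])
        rw [habs] at this
        gcongr
        nlinarith
  have hd1 := hR1 x hx1
  have hd2 := hR2 x hx2
  rw [dist_zero_right, Real.norm_of_nonneg (by positivity)] at hd2
  rw [dist_eq_norm] at hd1 ⊢
  rw [id, key] at hd1
  rw [show ∀ a b t : ℂ, a - b = (a + t - b) - t by intros; ring]
  refine (norm_sub_le _ (∫ u in (-x)..x, F (u + I * ((N - 1 / 2 : ℝ) : ℂ)))).trans_lt ?_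
  linarith

/-! ### The contours and circles of the double cover -/

variable {n r : ℕ}

/-- The positive weights are the n + 1 equal weights 2 of the fields φ_j, so the distinguished field
does not matter and n factors are left in the product. -/
theorem standardHeight_doubleCover (c : Fin (n + 1) → Fin r)
    (s : Fin r → MvPolynomial (Fin (n + 1)) ℂ) (hs : ∀ i, (s i).IsHomogeneous (blockSize c i))
    {j₀ : Fields r n} (hj : 0 < (doubleCoverGLSM c s hs).Q j₀) (k : ℕ) (x : ℝ) :
    standardHeight (doubleCoverGLSM c s hs) j₀ k x = tailHeight n k x := by
  have hQ : ∀ a, (doubleCoverGLSM c s hs).Q (Sum.inr a) ≤ 0 := by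
    intro a
    change -theta c a ≤ 0
    cases a <;> simp [theta]
  have hQl : ∀ j, (doubleCoverGLSM c s hs).Q (Sum.inl j) = 2 := fun _ => rfl
  cases j₀ with
  | inr a => exact absurd hj (not_lt.2 (hQ a))
  | inl j₀ =>
    have hset : Finset.univ.filter (fun j : Fields r n => j ≠ Sum.inl j₀ ∧
        0 < (doubleCoverGLSM c s hs).Q j) =
        (Finset.univ.erase j₀).map Function.Embedding.inl := by
      ext j
      cases j with
      | inl j => simp [hQl]
      | inr a => simp [not_lt.2 (hQ a)]
    rw [standardHeight, hset, Finset.prod_map, tailHeight, hQl]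
    simp only [Function.Embedding.inl_apply, hQl]
    rw [Finset.prod_const, Finset.card_erase_of_mem (Finset.mem_univ _), Finset.card_univ,
      Fintype.card_fin, abs_mul]
    norm_num
    ring

theorem Contour.y_zero_neg {c : Fin (n + 1) → Fin r} {s : Fin r → MvPolynomial (Fin (n + 1)) ℂ}
    {hs : ∀ i, (s i).IsHomogeneous (blockSize c i)} (L : Contour (doubleCoverGLSM c s hs)) :
    L.y 0 < 0 := by
  have := L.avoids (Sum.inl 0) 0 (mul_zero _)
  simp [doubleCoverGLSM, gaugeW, rW] at this
  linarith

/-- The Gamma arguments in question are non-real for x ≠ 0, unless the block is empty and the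
argument is 1/2. Over x = 0 the condition `avoids` keeps them positive. So the simplified integrand
is valid on the whole contour. -/
theorem pullback_braneOf {c : Fin (n + 1) → Fin r} {s : Fin r → MvPolynomial (Fin (n + 1)) ℂ}
    {hs : ∀ i, (s i).IsHomogeneous (blockSize c i)} (L : Contour (doubleCoverGLSM c s hs))
    (J : Finset (Fin (n + 1))) (t : ℂ) :
    (braneOf c s hs J).pullback L t = fun x : ℝ =>
      periodIntegrand c J.card t (x + I * L.y x) * (1 + I * deriv L.y x) := by
  funext x
  rw [Brane.pullback]
  congr 1
  have hy0 := L.y_zero_neg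
  have h1 : ∀ a : Idx r n, -(theta c a : ℝ) * L.y 0 < 1 / 2 := by
    intro a
    have := L.avoids (Sum.inr a) 0 (mul_zero _)
    simpa [doubleCoverGLSM, gaugeW, rW] using this
  have hz : I * ((x : ℂ) + I * L.y x) = -L.y x + I * x := by
    linear_combination (L.y x : ℂ) * I_mul_I
  have aux : ∀ (m : ℕ) (k : ℕ), -(m : ℝ) * L.y 0 < 1 / 2 →
      1 / 2 - m * (I * ((x : ℂ) + I * L.y x)) ≠ -k := by
    intro m k hm h
    rw [hz] at h
    have hre := congrArg re h
    have him := congrArg im h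
    simp at hre him
    have hk : (0 : ℝ) ≤ k := Nat.cast_nonneg k
    rcases him with rfl | rfl
    · norm_num at hre
      linarith
    · linarith
  refine integrand_braneOf c s hs J t (fun i k => aux _ k ?_) (fun k => ?_) fun k h => ?_
  · simpa [theta] using h1 (Sum.inl i)
  · have := aux 1 k (by simpa [theta] using h1 (Sum.inr 0))
    rwa [Nat.cast_one, one_mul] at this
  · rw [hz] at h
    have hre := congrArg re h
    have him := congrArg im h
    simp at hre him
    have hk : (0 : ℝ) ≤ k := Nat.cast_nonneg k
    subst him
    linarith

/-- The spurious points -i(2k + 1)/(2m) may lie inside the circle around 0, but not on it: it meets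
the negative imaginary axis at -i/3, and 3(2k + 1) = 2m is impossible by parity. The points i(k +
1/2) are at distance at least 1/2 from every il. This is what the radius 1/3 is good for. -/
theorem circleIntegral_integrand_braneOf (c : Fin (n + 1) → Fin r)
    (s : Fin r → MvPolynomial (Fin (n + 1)) ℂ) (hs : ∀ i, (s i).IsHomogeneous (blockSize c i))
    (J : Finset (Fin (n + 1))) (l : ℕ) (t : ℂ) :
    circleIntegral ((braneOf c s hs J).integrand t) (I * l) (1 / 3) =
      circleTerm (periodWeight c J.card) l t := by
  refine circleIntegral.integral_congr (by norm_num) fun σ hσ => ?_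
  obtain ⟨g1, g2, g3⟩ := re_im_of_mem_sphere hσ
  have aux : ∀ m k : ℕ, 1 / 2 - m * (I * σ) ≠ -k := by
    intro m k h
    have hre := congrArg re h
    have him := congrArg im h
    simp at hre him
    have hk : (0 : ℝ) ≤ k := Nat.cast_nonneg k
    rcases him with rfl | him
    · norm_num at hre
      linarith
    · rw [him] at g3
      have h5 := abs_le.1 g2
      have hl : (0 : ℝ) ≤ l := Nat.cast_nonneg l
      have hm : (0 : ℝ) ≤ m := Nat.cast_nonneg m
      have h4 : σ.im = l + 1 / 3 ∨ σ.im = l - 1 / 3 := by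
        have : (σ.im - (l + 1 / 3)) * (σ.im - (l - 1 / 3)) = 0 := by linarith
        rcases mul_eq_zero.1 this with h | h
        · left; linarith
        · right; linarith
      have h6 : σ.im < 0 := by
        by_contra hcon
        nlinarith
      have hl0 : l = 0 := by
        by_contra hcon
        have : (1 : ℝ) ≤ l := by exact_mod_cast Nat.one_le_iff_ne_zero.2 hcon
        linarith [h5.1]
      subst hl0
      have h7 : σ.im = -(1 / 3) := by
        rcases h4 with h | h <;> rw [Nat.cast_zero] at h <;> linarith
      rw [h7] at hre
      have h8 : (3 : ℝ) + 6 * k = 2 * m := by linarith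
      have h9 : 3 + 6 * k = 2 * m := by exact_mod_cast h8
      omega
  have h := integrand_braneOf c s hs J t (σ := σ) (fun i k => aux _ k)
    (fun k => by simpa using aux 1 k) fun k h => ?_
  · exact h
  · have hre := congrArg re h
    have him := congrArg im h
    simp at hre him
    rw [him] at g3
    have h4 : ((σ.im - l) - 1 / 3) * ((σ.im - l) + 1 / 3) = 0 := by linarith
    have hi : σ.im = k + 1 / 2 := by linarith
    rw [hi] at h4
    rcases mul_eq_zero.1 h4 with h | h
    · have : (6 : ℝ) * k + 1 = 6 * l := by linarith
      have : 6 * k + 1 = 6 * l := by exact_mod_cast this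
      omega
    · have : (6 : ℝ) * k + 5 = 6 * l := by linarith
      have : 6 * k + 5 = 6 * l := by exact_mod_cast this
      omega

/-- The A-periods converge, and they are sums of residues. -/
theorem exists_integrable_and_hasSum_period (c : Fin (n + 1) → Fin r) :
    ∃ b : ℝ, 0 ≤ b ∧ (∀ m ≤ n + 1, CircleBound (periodWeight c m) b) ∧
      ∀ (s : Fin r → MvPolynomial (Fin (n + 1)) ℂ)
        (hs : ∀ i, (s i).IsHomogeneous (blockSize c i)) (L : Contour (doubleCoverGLSM c s hs))
        (C : ℝ), b ≤ C → ∀ t, L.InRegion C t → ∀ J : Finset (Fin (n + 1)),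
        Integrable ((braneOf c s hs J).pullback L t) ∧
          (braneOf c s hs J).period L t = circleSum (periodWeight c J.card) t := by
  obtain ⟨b1, hb1, h1⟩ := circleBound_periodWeight c
  obtain ⟨b2, hb2, K, hK, h2⟩ := exists_norm_periodWeight_le c
  have hpi := Real.pi_pos
  set B := 4 * Real.pi * (n + 1) with hB
  have hB0 : 0 ≤ B := by positivity
  -- b1 makes the series over the circles converge; b2 + B + 1 gives the contour integral D > 0 and,
  -- if k = 1, D ≥ E + 1, for D = Re t - b2 and E = B + |Im t|.
  refine ⟨b1 + b2 + B + 1, by positivity, fun m hm => ⟨(h1 m hm).1, ?_⟩, ?_⟩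
  · obtain ⟨M, hM⟩ := (h1 m hm).2
    refine ⟨|M|, fun l σ hσ => (hM l σ hσ).trans ?_⟩
    have : M ≤ |M| := le_abs_self M
    gcongr
    linarith
  intro s hs L C hC t ht J
  have hm : J.card ≤ n + 1 := by simpa using Finset.card_le_univ J
  obtain ⟨ρ, hρ⟩ := L.tail
  have htail : ∀ x, ρ ≤ |x| → L.y x = tailHeight n L.k x := fun x hx => by
    rw [hρ x hx, standardHeight_doubleCover c s hs L.pos]
  have htre : b1 + b2 + B + 1 < t.re := hC.trans_lt ht.1
  have key := integrable_and_tendsto_sum_circleIntegral (F := periodIntegrand c J.card t)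
    (fun z hz => differentiableAt_periodIntegrand c _ t hz) (K := K) (D := t.re - b2)
    (E := B + |t.im|) hK.le (by linarith) (by positivity) (fun σ hσ hsin => ?_)
    L.smooth L.y_zero_neg L.one_le_k (fun hk => by linarith [ht.2 hk]) htail
  · refine ⟨by rw [pullback_braneOf]; exact key.1, ?_⟩
    rw [Brane.period, pullback_braneOf]
    have hsum := (h1 _ hm).hasSum (t := t) (by linarith) (by linarith)
    exact tendsto_nhds_unique key.2 hsum.tendsto_sum_nat
  · rw [periodIntegrand, norm_mul, norm_exp_I_mul]
    have h3 : -(t.im * σ.re) ≤ |t.im| * |σ.re| := (neg_le_abs _).trans (abs_mul _ _).le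
    calc _ ≤ K * Real.exp (b2 * σ.im + B * |σ.re|) *
          Real.exp (-(t.re * σ.im + t.im * σ.re)) := by
          gcongr
          exact h2 _ hm σ hσ hsin
      _ = K * Real.exp (b2 * σ.im + B * |σ.re| + -(t.re * σ.im + t.im * σ.re)) := by
          rw [Real.exp_add (_ + _), mul_assoc]
      _ ≤ _ := by
          refine mul_le_mul_of_nonneg_left (Real.exp_le_exp.2 ?_) hK.le
          nlinarith

end Convergence

/-! ## The leading term and the shift equation -/

section LeadingTerm

variable {n r : ℕ}

/-- The numerator `∏ Γ(z + 1)^{m_i} / Γ(1/2 + m_i z)` of the kernel `gammaKernel`. -/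
noncomputable def regKernel (c : Fin (n + 1) → Fin r) (z : ℂ) : ℂ :=
  ∏ i, (Gamma (z + 1) ^ blockSize c i * (Gamma (1 / 2 + blockSize c i * z))⁻¹)

/-- By zΓ(z) = Γ(z + 1) and ∑ m_i = n + 1. It exhibits the pole of order n + 1 of the kernel at 0.
-/
theorem pow_mul_gammaKernel (c : Fin (n + 1) → Fin r) {z : ℂ} (hz : z ≠ 0) :
    z ^ (n + 1) * gammaKernel c z = regKernel c z := by
  rw [gammaKernel, regKernel, ← sum_blockSize c, ← Finset.prod_pow_eq_pow_sum,
    ← Finset.prod_mul_distrib]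
  refine Finset.prod_congr rfl fun i _ => ?_
  rw [Gamma_add_one z hz, mul_pow]
  ring

theorem differentiableAt_regKernel (c : Fin (n + 1) → Fin r) {z : ℂ} (hz : -1 < z.re) :
    DifferentiableAt ℂ (regKernel c) z := by
  refine DifferentiableAt.fun_finsetProd fun i _ => ?_
  refine DifferentiableAt.mul (DifferentiableAt.pow ?_ _) (differentiableAt_inv_Gamma_affine _ _ _)
  refine DifferentiableAt.fun_comp' (g := Gamma) z (differentiableAt_Gamma _ fun m hm => ?_)
    (by fun_prop)
  have := congrArg re hm
  simp at this
  have hm0 : (0 : ℝ) ≤ m := Nat.cast_nonneg m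
  linarith

theorem neg_one_lt_re_of_mem_closedBall {σ : ℂ} (h : σ ∈ Metric.closedBall (0 : ℂ) (1 / 3)) :
    -1 < (I * σ).re := by
  rw [mem_closedBall_zero_iff] at h
  rw [I_mul_re]
  linarith [(abs_le.1 ((abs_im_le_norm σ).trans h)).2]

theorem differentiableAt_regKernel_I_mul (c : Fin (n + 1) → Fin r) {σ : ℂ}
    (h : σ ∈ Metric.closedBall (0 : ℂ) (1 / 3)) :
    DifferentiableAt ℂ (fun σ => regKernel c (I * σ)) σ :=
  (differentiableAt_regKernel c (neg_one_lt_re_of_mem_closedBall h)).fun_comp' σ (by fun_prop)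

theorem ne_zero_of_mem_sphere_third {σ : ℂ} (h : σ ∈ Metric.sphere (0 : ℂ) (1 / 3)) : σ ≠ 0 := by
  rintro rfl
  norm_num at h

/-- The integral over the circle around `0` is a polynomial in `t` whose degree is the order of the
pole minus one. -/
theorem exists_polynomial_circleIntegral {h : ℂ → ℂ} {R : ℝ} (hR : 0 < R)
    (hh : DifferentiableOn ℂ h (Metric.closedBall 0 R)) (h0 : h 0 ≠ 0) (p : ℕ) :
    ∃ P : Polynomial ℂ, P.degree = (p : WithBot ℕ) ∧
      ∀ t : ℂ, circleIntegral (fun σ => 1 / σ ^ (p + 1) * (h σ * exp (I * t * σ))) 0 R =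
        P.eval t := by
  -- Cauchy's formula gives the p-th derivative of h(σ) e^{itσ} at 0, expanded by the Leibniz rule.
  -- The term k = 0 carries t^p, with coefficient a nonzero multiple of h(0).
  set a : ℕ → ℂ := fun k => 2 * Real.pi * I / p.factorial * (p.choose k * iteratedDeriv k h 0 *
    I ^ (p - k)) with ha
  refine ⟨∑ k ∈ Finset.range (p + 1), Polynomial.C (a k) * Polynomial.X ^ (p - k), ?_, fun t => ?_⟩
  · refine Polynomial.degree_eq_of_le_of_coeff_ne_zero ?_ ?_
    · refine (Polynomial.degree_sum_le _ _).trans (Finset.sup_le fun k _ => ?_)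
      refine (Polynomial.degree_C_mul_X_pow_le _ _).trans ?_
      exact_mod_cast Nat.sub_le p k
    · rw [Polynomial.finsetSum_coeff, Finset.sum_eq_single 0]
      · rw [Nat.sub_zero, Polynomial.coeff_C_mul_X_pow, if_pos rfl]
        simp [ha, h0, Real.pi_ne_zero, Nat.factorial_ne_zero]
      · intro k hk hk0
        rw [Polynomial.coeff_C_mul_X_pow, if_neg]
        have := Finset.mem_range.1 hk
        omega
      · simp
  · have hd : DifferentiableOn ℂ (fun σ => h σ * exp (I * t * σ)) (Metric.closedBall 0 R) :=
      hh.mul (by fun_prop)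
    have key := hd.circleIntegral_one_div_sub_center_pow_smul hR p
    simp only [sub_zero, smul_eq_mul] at key
    rw [key]
    have hh0 : ContDiffAt ℂ p h 0 :=
      ((hh.mono Metric.ball_subset_closedBall).analyticAt (Metric.ball_mem_nhds 0 hR)).contDiffAt
    have hexp : ContDiffAt ℂ p (fun σ => exp (I * t * σ)) 0 := by fun_prop
    have hmul := iteratedDeriv_mul hh0 hexp
    have hmul' : iteratedDeriv p (fun σ => h σ * exp (I * t * σ)) 0 = _ := hmul
    rw [hmul', Polynomial.eval_finsetSum, Finset.mul_sum]
    refine Finset.sum_congr rfl fun k _ => ?_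
    simp only [iteratedDeriv_cexp_const_mul, ha, Polynomial.eval_mul, Polynomial.eval_C,
      Polynomial.eval_pow, Polynomial.eval_X, mul_zero, exp_zero, mul_one, mul_pow]
    ring

/-- The simple zero of 1 - e^{2πσ} at 0 lowers the order of the pole from n + 1 to n - m + 1, which
is positive as m ≤ n. -/
theorem exists_polynomial_leading_term (c : Fin (n + 1) → Fin r) {m : ℕ} (hm : m ≤ n) :
    ∃ P : Polynomial ℂ, P.degree = ((n - m : ℕ) : WithBot ℕ) ∧
      ∀ t : ℂ, circleTerm (periodWeight c m) 0 t = P.eval t := by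
  -- The entire function (1 - e^{2πσ})/σ, with value -2π at 0.
  set e : ℂ → ℂ := dslope (fun σ => 1 - exp (2 * Real.pi * σ)) 0 with he
  have hed : Differentiable ℂ e := by
    rw [← differentiableOn_univ, he, Complex.differentiableOn_dslope Filter.univ_mem,
      differentiableOn_univ]
    fun_prop
  have he0 : e 0 = -(2 * Real.pi) := by
    rw [he, dslope_same]
    have h : HasDerivAt (fun σ : ℂ => 1 - exp (2 * Real.pi * σ))
        (-(exp (2 * Real.pi * 0) * (2 * Real.pi * 1))) 0 :=
      (((hasDerivAt_id (0 : ℂ)).const_mul (2 * Real.pi : ℂ)).cexp).const_sub 1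
    rw [h.deriv]
    simp
  have hes : ∀ σ : ℂ, 1 - exp (2 * Real.pi * σ) = σ * e σ := by
    intro σ
    have := sub_smul_dslope (fun σ : ℂ => 1 - exp (2 * Real.pi * σ)) 0 σ
    simp at this
    rw [← this]
  set h : ℂ → ℂ := fun σ => periodConst r n * (I ^ (n + 1))⁻¹ * regKernel c (I * σ) *
    (exp ((n + 1) * (Real.log 4 * I + 2 * Real.pi) * σ) * e σ ^ m) with hh
  have hhd : DifferentiableOn ℂ h (Metric.closedBall 0 (1 / 3)) := by
    intro σ hσ
    have h1 := differentiableAt_regKernel_I_mul c hσ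
    have h2 := hed σ
    refine DifferentiableAt.differentiableWithinAt ?_
    refine DifferentiableAt.mul (h1.const_mul _) (DifferentiableAt.mul (by fun_prop) (h2.pow m))
  have hpi : (Real.pi : ℂ) ≠ 0 := by exact_mod_cast Real.pi_ne_zero
  have hh0 : h 0 ≠ 0 := by
    have hG : (Gamma (1 / 2))⁻¹ ≠ 0 := inv_ne_zero (Gamma_ne_zero_of_re_pos (by norm_num))
    have hsq : (Real.sqrt Real.pi : ℂ) ≠ 0 := by
      exact_mod_cast (Real.sqrt_pos.2 Real.pi_pos).ne'
    simp only [hh, he0, mul_zero, exp_zero, one_mul, regKernel, add_zero, zero_add, Gamma_one,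
      one_pow, periodConst]
    refine mul_ne_zero (mul_ne_zero (mul_ne_zero (mul_ne_zero ?_ ?_) ?_) ?_) ?_
    · exact pow_ne_zero _ (mul_ne_zero two_ne_zero hpi)
    · exact pow_ne_zero _ hsq
    · exact inv_ne_zero (pow_ne_zero _ I_ne_zero)
    · exact Finset.prod_ne_zero_iff.2 fun i _ => hG
    · exact pow_ne_zero _ (neg_ne_zero.2 (mul_ne_zero two_ne_zero hpi))
  obtain ⟨P, hP, hP'⟩ := exists_polynomial_circleIntegral (by norm_num) hhd hh0 (n - m)
  refine ⟨P, hP, fun t => ?_⟩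
  rw [← hP', circleTerm, Nat.cast_zero, mul_zero]
  refine circleIntegral.integral_congr (by norm_num) fun σ hσ => ?_
  have hσ0 := ne_zero_of_mem_sphere_third hσ
  have h1 := pow_mul_gammaKernel c (mul_ne_zero I_ne_zero hσ0)
  simp only [hh, ← h1, periodWeight, expFactor, hes, mul_pow]
  have h2 : σ ^ (n + 1) = σ ^ (n - m + 1) * σ ^ m := by
    rw [← pow_add]
    congr 1
    omega
  rw [h2]
  have := pow_ne_zero (n + 1) I_ne_zero
  field_simp

end LeadingTerm

/-! ### The functional equation of the kernel and the hypergeometric equation -/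

section Shift

variable {n r : ℕ}

theorem Complex.inv_Gamma_eq_prod_mul (s : ℂ) (m : ℕ) :
    (Gamma s)⁻¹ = (∏ k ∈ Finset.range m, (s + k)) * (Gamma (s + m))⁻¹ := by
  induction m with
  | zero => simp
  | succ m ih =>
    rw [ih, Finset.prod_range_succ, one_div_Gamma_eq_self_mul_one_div_Gamma_add_one (s + m)]
    push_cast
    ring_nf

/-- The polynomial `∏_i ∏_{k < m_i} (m_i X - 1/2 - k)`. -/
noncomputable def blockPoly (c : Fin (n + 1) → Fin r) : Polynomial ℂ :=
  ∏ i, ∏ k ∈ Finset.range (blockSize c i),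
    (Polynomial.C (-1 / 2 - k : ℂ) + Polynomial.C (blockSize c i : ℂ) * Polynomial.X)

/-- A unit step in z moves the argument 1/2 + m_i z by m_i, and 1/Γ acquires the product of m_i
consecutive linear factors; these are the factors of `blockPoly` at z + 1 in reverse order. The
steps of the Γ(z)^{m_i} contribute z^{n+1}. -/
theorem blockPoly_mul_gammaKernel (c : Fin (n + 1) → Fin r) {z : ℂ} (hz : z ≠ 0) :
    (blockPoly c).eval (z + 1) * gammaKernel c (z + 1) = z ^ (n + 1) * gammaKernel c z := by
  rw [pow_mul_gammaKernel c hz, blockPoly, Polynomial.eval_prod, gammaKernel, regKernel,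
    ← Finset.prod_mul_distrib]
  refine Finset.prod_congr rfl fun i _ => ?_
  rw [inv_Gamma_eq_prod_mul (1 / 2 + blockSize c i * z) (blockSize c i), Polynomial.eval_prod]
  have h1 : ∏ k ∈ Finset.range (blockSize c i), Polynomial.eval (z + 1)
      (Polynomial.C (-1 / 2 - k : ℂ) + Polynomial.C (blockSize c i : ℂ) * Polynomial.X) =
      ∏ k ∈ Finset.range (blockSize c i), (1 / 2 + blockSize c i * z + k) := by
    rw [← Finset.prod_range_reflect]
    refine Finset.prod_congr rfl fun k hk => ?_
    have hk := Finset.mem_range.1 hk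
    have h2 : ((blockSize c i - 1 - k : ℕ) : ℂ) = blockSize c i - 1 - k := by
      rw [Nat.cast_sub (by omega), Nat.cast_sub (by omega), Nat.cast_one]
    simp only [Polynomial.eval_add, Polynomial.eval_mul, Polynomial.eval_C, Polynomial.eval_X, h2]
    ring
  rw [h1, show 1 / 2 + (blockSize c i : ℂ) * (z + 1) = 1 / 2 + blockSize c i * z + blockSize c i by
    ring]
  ring

theorem expFactor_sub_I (n m : ℕ) (σ : ℂ) :
    expFactor n m (σ - I) = 4 ^ (n + 1) * expFactor n m σ := by
  have h1 : exp (2 * Real.pi * (σ - I)) = exp (2 * Real.pi * σ) := by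
    rw [mul_sub, exp_sub, exp_two_pi_mul_I, div_one]
  have h2 : exp ((n + 1) * (Real.log 4 * I + 2 * Real.pi) * (σ - I)) =
      4 ^ (n + 1) * exp ((n + 1) * (Real.log 4 * I + 2 * Real.pi) * σ) := by
    have e : ((n + 1) * (Real.log 4 * I + 2 * Real.pi) * (σ - I) : ℂ) =
        (n + 1 : ℕ) * (Real.log 4 : ℂ) + (n + 1) * (Real.log 4 * I + 2 * Real.pi) * σ -
          (n + 1 : ℕ) * (2 * Real.pi * I) := by
      push_cast
      linear_combination (-(n + 1) * Real.log 4 : ℂ) * I_mul_I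
    rw [e, exp_sub, exp_add, exp_nat_mul_two_pi_mul_I, div_one, exp_nat_mul, ← ofReal_exp,
      Real.exp_log (by norm_num)]
    norm_num
  rw [expFactor, expFactor, h1, h2, mul_assoc]

theorem circleIntegral_add_center (f : ℂ → ℂ) (a b : ℂ) (R : ℝ) :
    circleIntegral f a R = circleIntegral (fun σ => f (σ - b)) (a + b) R := by
  simp only [circleIntegral, deriv_circleMap]
  refine intervalIntegral.integral_congr fun θ _ => ?_
  simp only [circleMap]
  congr 3
  ring

/-- Substituting σ - i for σ replaces z by z + 1. The kernel changes by its functional equation,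
e^{2πσ} not at all, 4^{(n+1)z} by 4^{n+1} and e^{itσ} by e^t; the argument X - 1 of Q undoes the
step in z. -/
theorem circleTerm_shift (c : Fin (n + 1) → Fin r) (Q : Polynomial ℂ) (m l : ℕ) (t : ℂ) :
    circleTerm (fun σ => (Polynomial.X ^ (n + 1) * Q).eval (I * σ) * periodWeight c m σ)
        (l + 1) t =
      (4 ^ (n + 1))⁻¹ * exp (-t) *
        circleTerm (fun σ => (blockPoly c * Q.comp (Polynomial.X - 1)).eval (I * σ) *
          periodWeight c m σ) l t := by
  rw [circleTerm, circleTerm, circleIntegral_add_center _ (I * l) I,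
    ← circleIntegral.integral_const_mul, show I * (l : ℂ) + I = I * (l + 1 : ℕ) by push_cast; ring]
  refine circleIntegral.integral_congr (by norm_num) fun σ hσ => ?_
  have hz : I * σ ≠ 0 := mul_ne_zero I_ne_zero fun h => sphere_ne_pole hσ 0 (by simpa using h)
  have h1 := blockPoly_mul_gammaKernel c hz
  have h2 : I * (σ - I) = I * σ + 1 := by linear_combination -I_mul_I
  have h3 : exp (I * t * (σ - I)) = exp t * exp (I * t * σ) := by
    rw [← exp_add]
    congr 1
    linear_combination (-t) * I_mul_I
  have h4 : exp (-t) * exp t = 1 := by rw [← exp_add]; simp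
  simp only [periodWeight, h2, expFactor_sub_I, h3, Polynomial.eval_pow, Polynomial.eval_X,
    Polynomial.eval_mul, Polynomial.eval_comp, Polynomial.eval_sub, Polynomial.eval_one,
    add_sub_cancel_right]
  have h5 : (4 ^ (n + 1) : ℂ)⁻¹ * 4 ^ (n + 1) = 1 := inv_mul_cancel₀ (pow_ne_zero _ (by norm_num))
  calc _ = Q.eval (I * σ) * (periodConst r n * ((I * σ) ^ (n + 1) * gammaKernel c (I * σ)) *
        expFactor n m σ * exp (I * t * σ)) := by ring
    _ = Q.eval (I * σ) * (((4 ^ (n + 1) : ℂ)⁻¹ * 4 ^ (n + 1)) * (exp (-t) * exp t) *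
        (periodConst r n * ((blockPoly c).eval (I * σ + 1) * gammaKernel c (I * σ + 1)) *
        expFactor n m σ * exp (I * t * σ))) := by rw [h1, h4, h5]; ring
    _ = _ := by ring

/-- The factor z^{n+1} cancels the pole at 0, and Cauchy's theorem applies. So shifting the series
leaves no boundary term. -/
theorem circleTerm_zero_eq_zero (c : Fin (n + 1) → Fin r) (Q : Polynomial ℂ) (m : ℕ) (t : ℂ) :
    circleTerm (fun σ => (Polynomial.X ^ (n + 1) * Q).eval (I * σ) * periodWeight c m σ)
      0 t = 0 := by
  rw [circleTerm, Nat.cast_zero, mul_zero]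
  have h : ∀ σ ∈ Metric.sphere (0 : ℂ) (1 / 3),
      (Polynomial.X ^ (n + 1) * Q).eval (I * σ) * periodWeight c m σ * exp (I * t * σ) =
      periodConst r n * regKernel c (I * σ) *
        (Q.eval (I * σ) * expFactor n m σ * exp (I * t * σ)) := by
    intro σ hσ
    rw [← pow_mul_gammaKernel c (mul_ne_zero I_ne_zero (ne_zero_of_mem_sphere_third hσ)),
      periodWeight, Polynomial.eval_mul, Polynomial.eval_pow, Polynomial.eval_X]
    ring
  rw [circleIntegral.integral_congr (by norm_num) h]
  have hd : DifferentiableOn ℂ (fun σ => periodConst r n * regKernel c (I * σ) *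
      (Q.eval (I * σ) * expFactor n m σ * exp (I * t * σ))) (Metric.closedBall 0 (1 / 3)) := by
    intro σ hσ
    have h1 := differentiableAt_regKernel_I_mul c hσ
    have h2 := differentiable_expFactor n m σ
    have h3 : DifferentiableAt ℂ (fun σ => Q.eval (I * σ)) σ :=
      Q.differentiableAt.fun_comp' σ (by fun_prop)
    exact ((h1.const_mul _).mul ((h3.mul h2).mul (by fun_prop))).differentiableWithinAt
  exact circleIntegral_eq_zero_of_differentiable_on_off_countable (by norm_num)
    Set.countable_empty hd.continuousOn fun z hz => hd.differentiableAt
      (Metric.closedBall_mem_nhds_of_mem hz.1)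

/-- The differential equation of the A-periods, in terms of sums over residues. -/
theorem circleSum_shift (c : Fin (n + 1) → Fin r) (Q : Polynomial ℂ) {m : ℕ} {b : ℝ} (hb : 0 ≤ b)
    (h : CircleBound (periodWeight c m) b) {t : ℂ} (ht : b + 1 < t.re) :
    circleSum (fun σ => (Polynomial.X ^ (n + 1) * Q).eval (I * σ) * periodWeight c m σ) t
      = (4 ^ (n + 1))⁻¹ * exp (-t) *
        circleSum (fun σ => (blockPoly c * Q.comp (Polynomial.X - 1)).eval (I * σ) *
          periodWeight c m σ) t := by
  have hs := ((circleBound_eval (Polynomial.X ^ (n + 1) * Q)).mul h).hasSum (t := t) (by linarith)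
    (by linarith)
  rw [circleSum, hs.summable.tsum_eq_zero_add, circleTerm_zero_eq_zero, zero_add, circleSum,
    ← tsum_mul_left]
  exact tsum_congr fun l => circleTerm_shift c Q m l t

end Shift

/-! ## Constant coefficient operators in one variable -/

section ApplyD

/-- The value at `t` of `p(d/dt) g`. -/
noncomputable def applyD (g : ℂ → ℂ) (t : ℂ) : Polynomial ℂ →ₗ[ℂ] ℂ :=
  Polynomial.lsum fun k => LinearMap.toSpanSingleton ℂ ℂ (iteratedDeriv k g t)

theorem applyD_monomial (g : ℂ → ℂ) (t : ℂ) (k : ℕ) (a : ℂ) :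
    applyD g t (Polynomial.monomial k a) = a * iteratedDeriv k g t := by
  rw [applyD, Polynomial.lsum_apply, Polynomial.sum_monomial_index _ _ (by simp)]
  simp

theorem applyD_one (g : ℂ → ℂ) (t : ℂ) : applyD g t 1 = g t := by
  have := applyD_monomial g t 0 1
  simpa using this

theorem applyD_linear_mul (g : ℂ → ℂ) (t a b : ℂ) (p : Polynomial ℂ) :
    applyD g t ((Polynomial.C a + Polynomial.C b * Polynomial.X) * p) =
      a * applyD g t p + b * applyD g t (Polynomial.X * p) := by
  have : (Polynomial.C a + Polynomial.C b * Polynomial.X) * p =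
      a • p + b • (Polynomial.X * p) := by
    rw [Polynomial.smul_eq_C_mul, Polynomial.smul_eq_C_mul]
    ring
  rw [this, map_add, map_smul, map_smul, smul_eq_mul, smul_eq_mul]

theorem hasDerivAt_applyD {g : ℂ → ℂ} {t : ℂ} (hg : AnalyticAt ℂ g t) (p : Polynomial ℂ) :
    HasDerivAt (fun t => applyD g t p) (applyD g t (Polynomial.X * p)) t := by
  induction p using Polynomial.induction_on' with
  | add p q hp hq =>
    simp only [mul_add, map_add]
    exact hp.add hq
  | monomial k a =>
    rw [mul_comm, Polynomial.monomial_mul_X]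
    simp only [applyD_monomial, iteratedDeriv_succ]
    refine HasDerivAt.const_mul a (DifferentiableAt.hasDerivAt ?_)
    rw [iteratedDeriv_eq_iterate]
    exact (hg.iterated_deriv k).differentiableAt

theorem circleTerm_add {φ ψ : ℂ → ℂ} {l : ℕ}
    (hφ : ContinuousOn φ (Metric.sphere (I * l) (1 / 3)))
    (hψ : ContinuousOn ψ (Metric.sphere (I * l) (1 / 3))) (t : ℂ) :
    circleTerm (fun σ => φ σ + ψ σ) l t = circleTerm φ l t + circleTerm ψ l t := by
  have he : ContinuousOn (fun σ => exp (I * t * σ)) (Metric.sphere (I * l : ℂ) (1 / 3)) := by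
    fun_prop
  simp only [circleTerm, add_mul]
  exact circleIntegral.integral_add ((hφ.mul he).circleIntegrable (by norm_num))
    ((hψ.mul he).circleIntegrable (by norm_num))

theorem circleTerm_const_mul (a : ℂ) (φ : ℂ → ℂ) (l : ℕ) (t : ℂ) :
    circleTerm (fun σ => a * φ σ) l t = a * circleTerm φ l t := by
  simp only [circleTerm, mul_assoc]
  exact circleIntegral.integral_const_mul _ _ _ _

/-- Each d/dt becomes a factor iσ under the integrals, so differential equations in t become
identities between weights. -/
theorem applyD_circleSum {φ : ℂ → ℂ} {b : ℝ} (hb : 0 ≤ b) (h : CircleBound φ b)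
    (p : Polynomial ℂ) {t : ℂ} (ht : b + 1 < t.re) :
    applyD (circleSum φ) t p = circleSum (fun σ => p.eval (I * σ) * φ σ) t := by
  have hk : ∀ k : ℕ, ∀ t : ℂ, b + 1 < t.re → iteratedDeriv k (circleSum φ) t =
      circleSum (fun σ => (Polynomial.X ^ k : Polynomial ℂ).eval (I * σ) * φ σ) t := by
    intro k
    induction k with
    | zero => intro t _; simp
    | succ k ih =>
      intro t ht
      have hev : iteratedDeriv k (circleSum φ) =ᶠ[nhds t]
          circleSum (fun σ => (Polynomial.X ^ k : Polynomial ℂ).eval (I * σ) * φ σ) := by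
        filter_upwards [(isOpen_lt continuous_const continuous_re).mem_nhds ht] with s hs
          using ih s hs
      rw [iteratedDeriv_succ, hev.deriv_eq,
        (((circleBound_eval _).mul h).hasDerivAt (by linarith) (by linarith)).deriv]
      congr 1
      funext σ
      simp only [Polynomial.eval_pow, Polynomial.eval_X]
      ring
  induction p using Polynomial.induction_on' with
  | add p q hp hq =>
    rw [map_add, hp, hq]
    have h1 := (circleBound_eval p).mul h
    have h2 := (circleBound_eval q).mul h
    have h3 := (h1.hasSum (t := t) (by linarith) (by linarith)).add
      (h2.hasSum (by linarith) (by linarith))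
    rw [← h3.tsum_eq, circleSum]
    refine tsum_congr fun l => ?_
    rw [← circleTerm_add (h1.1 l) (h2.1 l)]
    simp only [Polynomial.eval_add, add_mul]
  | monomial k a =>
    rw [applyD_monomial, hk k t ht, circleSum, circleSum, ← tsum_mul_left]
    refine tsum_congr fun l => ?_
    rw [← circleTerm_const_mul]
    simp only [Polynomial.eval_monomial, Polynomial.eval_pow, Polynomial.eval_X, mul_assoc]

theorem analyticAt_circleSum {φ : ℂ → ℂ} {b : ℝ} (hb : 0 ≤ b) (h : CircleBound φ b) {t : ℂ}
    (ht : b < t.re) : AnalyticAt ℂ (circleSum φ) t := by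
  have hd : DifferentiableOn ℂ (circleSum φ) {t | b < t.re} := fun s hs =>
    (h.hasDerivAt (lt_of_le_of_lt hb hs) hs).differentiableAt.differentiableWithinAt
  exact hd.analyticAt ((isOpen_lt continuous_const continuous_re).mem_nhds ht)

end ApplyD

/-! ## Functions of the form `w⁻¹ g(t)` and the GKZ operators -/

section Chart

variable {n r : ℕ}

/-- The exponents `b` in `x_a ∂_a w⁻¹ = b_a w⁻¹`. -/
noncomputable def wExp : Idx r n → ℂ
  | Sum.inl _ => -1 / 2
  | Sum.inr _ => 0

/-- The exponents `ℓ` in `x_a ∂_a t = ℓ_a`. -/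
def tExp (c : Fin (n + 1) → Fin r) : Idx r n → ℂ
  | Sum.inl i => blockSize c i
  | Sum.inr _ => -1

/-- `t` and `w` are branches of `-ln q` and of the square root of `∏ x_{i,0}` on the open set `U`,
which does not meet the coordinate hyperplanes. -/
structure IsChart (c : Fin (n + 1) → Fin r) (U : Set (Idx r n → ℂ))
    (t w : (Idx r n → ℂ) → ℂ) : Prop where
  isOpen : IsOpen U
  ne_zero : ∀ x ∈ U, ∀ a, x a ≠ 0
  analytic_t : AnalyticOnNhd ℂ t U
  analytic_w : AnalyticOnNhd ℂ w U
  exp_t : ∀ x ∈ U, exp (-t x) = qOf c x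
  w_sq : ∀ x ∈ U, w x ^ 2 = ∏ i, x (Sum.inl i)

/-- The point with coordinates `x_a e^{u_a}`. -/
noncomputable def expScale (x u : Idx r n → ℂ) : Idx r n → ℂ := fun a => x a * exp (u a)

/-- Multiplicative coordinates make -ln q affine in u with slopes `tExp`, so no branch of the
logarithms of the x_a is needed. -/
theorem qOf_expScale (c : Fin (n + 1) → Fin r) (x u : Idx r n → ℂ) :
    qOf c (expScale x u) = qOf c x * exp (-∑ a, tExp c a * u a) := by
  have h1 : ∀ y e : ℂ, -4 * (y * e) = -4 * y * e := fun y e => (mul_assoc _ _ _).symm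
  simp only [qOf, expScale, Fintype.sum_sum_type, tExp, neg_add, exp_add, ← Finset.sum_neg_distrib,
    exp_sum, h1, Finset.prod_mul_distrib, mul_pow, mul_inv, exp_neg, exp_nat_mul]
  simp only [neg_mul, one_mul, exp_neg, inv_inv]
  ring

theorem prod_inl_expScale (x u : Idx r n → ℂ) :
    ∏ i, expScale x u (Sum.inl i) = (∏ i, x (Sum.inl i)) * exp (-2 * ∑ a, wExp a * u a) := by
  simp only [expScale, Finset.prod_mul_distrib, Fintype.sum_sum_type, wExp, zero_mul,
    Finset.sum_const_zero, add_zero, ← exp_sum, Finset.mul_sum]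
  congr 2
  refine Finset.sum_congr rfl fun i _ => ?_
  ring

theorem expScale_zero (x : Idx r n → ℂ) : expScale x 0 = x := by
  funext a
  simp [expScale]

theorem hasDerivAt_expScale (x v : Idx r n → ℂ) (s : ℂ) :
    HasDerivAt (fun s : ℂ => expScale x (s • v)) (fun a => expScale x (s • v) a * v a) s := by
  rw [hasDerivAt_pi]
  intro a
  simp only [expScale, Pi.smul_apply, smul_eq_mul]
  have := (((hasDerivAt_id s).mul_const (v a)).cexp).const_mul (x a)
  refine this.congr_deriv ?_
  simp
  ring

theorem fderiv_apply_eq_sum_partialD {f : (Idx r n → ℂ) → ℂ} (x v : Idx r n → ℂ) :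
    fderiv ℂ f x v = ∑ a, v a * partialD a f x := by
  conv_lhs => rw [← Finset.univ_sum_single v]
  rw [map_sum]
  refine Finset.sum_congr rfl fun a _ => ?_
  have : (Pi.single a (v a) : Idx r n → ℂ) = v a • Pi.single a 1 := by
    rw [← Pi.single_smul, smul_eq_mul, mul_one]
  rw [this, map_smul, smul_eq_mul, partialD]

theorem hasDerivAt_comp_expScale {f : (Idx r n → ℂ) → ℂ} {x v : Idx r n → ℂ} {s : ℂ}
    (hf : DifferentiableAt ℂ f (expScale x (s • v))) :
    HasDerivAt (fun s : ℂ => f (expScale x (s • v)))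
      (∑ a, v a * (expScale x (s • v) a * partialD a f (expScale x (s • v)))) s := by
  have := hf.hasFDerivAt.comp_hasDerivAt s (hasDerivAt_expScale x v s)
  rw [fderiv_apply_eq_sum_partialD] at this
  refine this.congr_deriv (Finset.sum_congr rfl fun a _ => ?_)
  ring

namespace IsChart

variable {c : Fin (n + 1) → Fin r} {U : Set (Idx r n → ℂ)} {t w : (Idx r n → ℂ) → ℂ}

theorem w_ne_zero (h : IsChart c U t w) {x : Idx r n → ℂ} (hx : x ∈ U) : w x ≠ 0 := by
  intro h0
  have h1 := h.w_sq x hx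
  rw [h0, zero_pow two_ne_zero] at h1
  exact Finset.prod_ne_zero_iff.2 (fun i _ => h.ne_zero x hx _) h1.symm

theorem eventually_expScale_mem (h : IsChart c U t w) {x : Idx r n → ℂ} (hx : x ∈ U)
    (v : Idx r n → ℂ) : ∀ᶠ s : ℂ in nhds 0, expScale x (s • v) ∈ U := by
  have hc : ContinuousAt (fun s : ℂ => expScale x (s • v)) 0 :=
    (hasDerivAt_expScale x v 0).continuousAt
  refine hc.eventually_mem ?_
  rw [zero_smul, expScale_zero]
  exact h.isOpen.mem_nhds hx

/-- t is differentiable by assumption; its derivative is read off from e^{-t} = q, whose scaling is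
explicit. -/
theorem hasDerivAt_t (h : IsChart c U t w) {x : Idx r n → ℂ} (hx : x ∈ U) (v : Idx r n → ℂ) :
    HasDerivAt (fun s : ℂ => t (expScale x (s • v))) (∑ a, tExp c a * v a) 0 := by
  have h0 : expScale x ((0 : ℂ) • v) = x := by rw [zero_smul, expScale_zero]
  have h1 := hasDerivAt_comp_expScale (f := t) (x := x) (v := v) (s := 0)
    (by rw [h0]; exact (h.analytic_t x hx).differentiableAt)
  rw [h0] at h1
  set T := ∑ a, v a * (x a * partialD a t x)
  have h2 : HasDerivAt (fun s : ℂ => exp (-t (expScale x (s • v)))) (exp (-t x) * -T) 0 := by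
    have := (h1.neg).cexp
    simp only [h0, Pi.neg_apply] at this
    exact this
  have h3 : HasDerivAt (fun s : ℂ => qOf c x * exp (-(s * ∑ a, tExp c a * v a)))
      (qOf c x * (exp (-(0 * ∑ a, tExp c a * v a)) * -(1 * ∑ a, tExp c a * v a))) 0 :=
    ((((hasDerivAt_id (0 : ℂ)).mul_const _).neg).cexp).const_mul _
  have h4 : (fun s : ℂ => exp (-t (expScale x (s • v)))) =ᶠ[nhds 0]
      fun s : ℂ => qOf c x * exp (-(s * ∑ a, tExp c a * v a)) := by
    filter_upwards [h.eventually_expScale_mem hx v] with s hs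
    rw [h.exp_t _ hs, qOf_expScale, Finset.mul_sum]
    congr 3
    refine Finset.sum_congr rfl fun a _ => ?_
    simp only [Pi.smul_apply, smul_eq_mul]
    ring
  have h5 := (h2.congr_of_eventuallyEq h4.symm).unique h3
  rw [← h.exp_t x hx, zero_mul, neg_zero, exp_zero, one_mul, one_mul] at h5
  have h6 := mul_left_cancel₀ (exp_ne_zero _) h5
  rw [← neg_injective h6]
  exact h1

theorem hasDerivAt_w_inv (h : IsChart c U t w) {x : Idx r n → ℂ} (hx : x ∈ U) (v : Idx r n → ℂ) :
    HasDerivAt (fun s : ℂ => (w (expScale x (s • v)))⁻¹) ((∑ a, wExp a * v a) * (w x)⁻¹) 0 := by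
  have h0 : expScale x ((0 : ℂ) • v) = x := by rw [zero_smul, expScale_zero]
  have hw := h.w_ne_zero hx
  have h1 := hasDerivAt_comp_expScale (f := w) (x := x) (v := v) (s := 0)
    (by rw [h0]; exact (h.analytic_w x hx).differentiableAt)
  rw [h0] at h1
  set T := ∑ a, v a * (x a * partialD a w x)
  have h2 : HasDerivAt (fun s : ℂ => w (expScale x (s • v)) ^ 2) (2 * w x * T) 0 := by
    have := h1.fun_pow 2
    simp only [h0] at this
    simpa using this
  have h3 : HasDerivAt (fun s : ℂ => w x ^ 2 * exp (s * (-2 * ∑ a, wExp a * v a)))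
      (w x ^ 2 * (exp (0 * (-2 * ∑ a, wExp a * v a)) * (1 * (-2 * ∑ a, wExp a * v a)))) 0 :=
    (((hasDerivAt_id (0 : ℂ)).mul_const _).cexp).const_mul _
  have h4 : (fun s : ℂ => w (expScale x (s • v)) ^ 2) =ᶠ[nhds 0]
      fun s : ℂ => w x ^ 2 * exp (s * (-2 * ∑ a, wExp a * v a)) := by
    filter_upwards [h.eventually_expScale_mem hx v] with s hs
    have e : ∑ a, wExp a * (s • v) a = s * ∑ a, wExp a * v a := by
      rw [Finset.mul_sum]
      refine Finset.sum_congr rfl fun a _ => ?_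
      rw [Pi.smul_apply, smul_eq_mul]
      ring
    rw [h.w_sq _ hs, prod_inl_expScale, h.w_sq x hx, e, mul_left_comm]
  have h5 := (h2.congr_of_eventuallyEq h4.symm).unique h3
  rw [zero_mul, exp_zero, one_mul, one_mul] at h5
  have h6 : T = -(∑ a, wExp a * v a) * w x := by
    have : w x * T = w x * (-(∑ a, wExp a * v a) * w x) := by linear_combination (1 / 2 : ℂ) * h5
    exact mul_left_cancel₀ hw this
  have h7 := h1.fun_inv (by rw [h0]; exact hw)
  rw [h0, h6] at h7
  refine h7.congr_deriv ?_
  field_simp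

/-- The function `w⁻¹ x^{-u} (p(d/dt) g)(t)`. -/
noncomputable def _root_.twisted (t w : (Idx r n → ℂ) → ℂ) (g : ℂ → ℂ) (u : Idx r n → ℕ)
    (p : Polynomial ℂ) (x : Idx r n → ℂ) : ℂ :=
  (w x)⁻¹ * (∏ a, (x a ^ u a)⁻¹) * applyD g (t x) p

theorem analyticAt_twisted (h : IsChart c U t w) {g : ℂ → ℂ} {x : Idx r n → ℂ} (hx : x ∈ U)
    (hg : AnalyticAt ℂ g (t x)) (u : Idx r n → ℕ) (p : Polynomial ℂ) :
    AnalyticAt ℂ (twisted t w g u p) x := by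
  have h1 : AnalyticAt ℂ (fun x => ∏ a, (x a ^ u a)⁻¹) x := by
    refine Finset.analyticAt_fun_prod _ fun a _ => ?_
    refine AnalyticAt.fun_inv ?_ (pow_ne_zero _ (h.ne_zero x hx a))
    exact ((ContinuousLinearMap.proj (R := ℂ) (φ := fun _ : Idx r n => ℂ) a).analyticAt x).fun_pow _
  have h2 : AnalyticAt ℂ (fun s => applyD g s p) (t x) := by
    rw [Complex.analyticAt_iff_eventually_differentiableAt]
    filter_upwards [hg.eventually_analyticAt] with s hs
      using (hasDerivAt_applyD hs p).differentiableAt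
  exact (((h.analytic_w x hx).fun_inv (h.w_ne_zero hx)).fun_mul h1).fun_mul
    (h2.fun_comp (h.analytic_t x hx))

/-- Product rule along the scaling of the single coordinate x_a: w⁻¹ contributes b_a, x^{-u}
contributes -u_a, and the function of t contributes ℓ_a d/dt. -/
theorem mul_partialD_twisted (h : IsChart c U t w) {g : ℂ → ℂ} {x : Idx r n → ℂ} (hx : x ∈ U)
    (hg : AnalyticAt ℂ g (t x)) (u : Idx r n → ℕ) (p : Polynomial ℂ) (a : Idx r n) :
    x a * partialD a (twisted t w g u p) x = twisted t w g u
      ((Polynomial.C (wExp a - u a) + Polynomial.C (tExp c a) * Polynomial.X) * p) x := by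
  set v : Idx r n → ℂ := Pi.single a 1 with hv
  have h0 : expScale x ((0 : ℂ) • v) = x := by rw [zero_smul, expScale_zero]
  have hsum : ∀ φ : Idx r n → ℂ, ∑ b, φ b * v b = φ a := by
    intro φ
    rw [Finset.sum_eq_single a]
    · simp [hv]
    · intro b _ hb; simp [hv, hb]
    · simp
  have h1 := hasDerivAt_comp_expScale (f := twisted t w g u p) (x := x) (v := v) (s := 0)
    (by rw [h0]; exact (h.analyticAt_twisted hx hg u p).differentiableAt)
  simp only [h0, mul_comm (v _), hsum] at h1
  have h2 := h.hasDerivAt_w_inv hx v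
  have h3 := h.hasDerivAt_t hx v
  rw [hsum] at h2 h3
  have h4 : HasDerivAt (fun s : ℂ => applyD g (t (expScale x (s • v))) p)
      (applyD g (t x) (Polynomial.X * p) * tExp c a) 0 :=
    (hasDerivAt_applyD hg p).comp_of_eq 0 h3 (by rw [h0])
  have h5 : ∀ s : ℂ, ∏ b, (expScale x (s • v) b ^ u b)⁻¹ =
      (∏ b, (x b ^ u b)⁻¹) * exp (s * (-(u a : ℂ))) := by
    intro s
    have : ∀ b, (expScale x (s • v) b ^ u b)⁻¹ = (x b ^ u b)⁻¹ * exp (s * (-(u b : ℂ)) * v b) := by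
      intro b
      rw [expScale, mul_pow, mul_inv, ← exp_nat_mul, ← exp_neg, Pi.smul_apply, smul_eq_mul]
      congr 2
      ring
    rw [Finset.prod_congr rfl fun b _ => this b, Finset.prod_mul_distrib, ← exp_sum, hsum]
  have h6 : HasDerivAt (fun s : ℂ => exp (s * (-(u a : ℂ))))
      (exp (0 * (-(u a : ℂ))) * (1 * (-(u a : ℂ)))) 0 :=
    ((hasDerivAt_id (0 : ℂ)).mul_const _).cexp
  have h7 := (h2.fun_mul (h6.const_mul (∏ b, (x b ^ u b)⁻¹))).fun_mul h4
  have e : (fun s : ℂ => twisted t w g u p (expScale x (s • v))) = fun s : ℂ =>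
      (w (expScale x (s • v)))⁻¹ * ((∏ b, (x b ^ u b)⁻¹) * exp (s * (-(u a : ℂ)))) *
        applyD g (t (expScale x (s • v))) p := by
    funext s
    rw [twisted, h5]
  rw [e] at h1
  have h8 := h1.unique h7
  rw [h8, twisted, applyD_linear_mul, h0]
  simp only [zero_mul, exp_zero]
  ring

theorem partialD_twisted (h : IsChart c U t w) {g : ℂ → ℂ} {x : Idx r n → ℂ} (hx : x ∈ U)
    (hg : AnalyticAt ℂ g (t x)) (u : Idx r n → ℕ) (p : Polynomial ℂ) (a : Idx r n) :
    partialD a (twisted t w g u p) x = twisted t w g (u + Pi.single a 1)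
      ((Polynomial.C (wExp a - u a) + Polynomial.C (tExp c a) * Polynomial.X) * p) x := by
  have hxa := h.ne_zero x hx a
  apply mul_left_cancel₀ hxa
  rw [h.mul_partialD_twisted hx hg, twisted, twisted]
  have : ∏ b, (x b ^ (u + Pi.single a 1 : Idx r n → ℕ) b)⁻¹ = (∏ b, (x b ^ u b)⁻¹) * (x a)⁻¹ := by
    have e : ∀ b, (x b ^ (u + Pi.single a 1 : Idx r n → ℕ) b)⁻¹ =
        (x b ^ u b)⁻¹ * (if b = a then (x a)⁻¹ else 1) := by
      intro b
      rw [Pi.add_apply, pow_add, mul_inv]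
      split_ifs with hb
      · subst hb; simp
      · simp [hb]
    rw [Finset.prod_congr rfl fun b _ => e b, Finset.prod_mul_distrib]
    simp
  rw [this]
  field_simp

/-- The polynomial `∏_a ∏_{k < u_a} (b_a - k + ℓ_a X)`. -/
noncomputable def _root_.opPoly (c : Fin (n + 1) → Fin r) (u : Idx r n → ℕ) : Polynomial ℂ :=
  ∏ a, ∏ k ∈ Finset.range (u a),
    (Polynomial.C (wExp a - k) + Polynomial.C (tExp c a) * Polynomial.X)

theorem _root_.partialD_congr {ι : Type} [DecidableEq ι] {U : Set (ι → ℂ)} (hU : IsOpen U)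
    {f g : (ι → ℂ) → ℂ} (h : Set.EqOn f g U) (a : ι) : Set.EqOn (partialD a f) (partialD a g) U := by
  intro x hx
  have : f =ᶠ[nhds x] g := by
    filter_upwards [hU.mem_nhds hx] with y hy using h hy
  rw [partialD, partialD, this.fderiv_eq]

/-- Each ∂_a adds one factor b_a - u_a + ℓ_a X and raises u_a by one, so repeated derivatives build
falling factorials. Different directions do not interact. -/
theorem multiPartial_eq (h : IsChart c U t w) {g : ℂ → ℂ} (hg : ∀ x ∈ U, AnalyticAt ℂ g (t x))
    {f : (Idx r n → ℂ) → ℂ} (hf : ∀ x ∈ U, f x = (w x)⁻¹ * g (t x)) (u : Idx r n → ℕ)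
    {x : Idx r n → ℂ} (hx : x ∈ U) :
    multiPartial u f x = (w x)⁻¹ * (∏ a, (x a ^ u a)⁻¹) * applyD g (t x) (opPoly c u) := by
  classical
  -- The condition μ a = 0 makes the falling factorial start at k = 0; it holds along the list
  -- because no index is repeated.
  have iter : ∀ (F : (Idx r n → ℂ) → ℂ) (μ : Idx r n → ℕ) (p : Polynomial ℂ) (a : Idx r n),
      μ a = 0 → Set.EqOn F (twisted t w g μ p) U → ∀ k : ℕ,
      Set.EqOn ((partialD a)^[k] F) (twisted t w g (μ + Pi.single a k)
        ((∏ j ∈ Finset.range k, (Polynomial.C (wExp a - j) +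
          Polynomial.C (tExp c a) * Polynomial.X)) * p)) U := by
    intro F μ p a hμ hF k
    induction k with
    | zero => simpa using hF
    | succ k ih =>
      intro y hy
      rw [Function.iterate_succ_apply', partialD_congr h.isOpen ih a hy,
        h.partialD_twisted hy (hg y hy), Finset.prod_range_succ]
      have e1 : (μ + Pi.single a k : Idx r n → ℕ) + Pi.single a 1 = μ + Pi.single a (k + 1) := by
        rw [add_assoc, ← Pi.single_add]
      have e2 : (μ + Pi.single a k : Idx r n → ℕ) a = k := by simp [hμ]
      rw [e1, e2]
      congr 1
      ring
  have main : ∀ l : List (Idx r n), l.Nodup →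
      Set.EqOn (l.foldr (fun a g => (partialD a)^[u a] g) f)
        (twisted t w g (fun a => if a ∈ l then u a else 0)
          (l.map fun a => ∏ k ∈ Finset.range (u a),
            (Polynomial.C (wExp a - k) + Polynomial.C (tExp c a) * Polynomial.X)).prod) U := by
    intro l
    induction l with
    | nil =>
      intro _ y hy
      simp [twisted, applyD_one, hf y hy]
    | cons a l ih =>
      intro hl
      rw [List.nodup_cons] at hl
      have := iter _ _ _ a (by simp [hl.1]) (ih hl.2) (u a)
      rw [List.foldr_cons, List.map_cons, List.prod_cons]
      convert this using 2
      funext b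
      by_cases hb : b = a
      · subst hb; simp [hl.1]
      · simp [hb]
  have := main _ Finset.univ.nodup_toList hx
  rw [multiPartial, this, twisted, Finset.prod_map_toList]
  simp [opPoly]

end IsChart

end Chart

/-! ## The A-periods solve the GKZ system -/

section Solution

variable {n r : ℕ}

/-- The exponent vector of `∏_j x_j`. -/
def rayExp (r n : ℕ) : Idx r n → ℕ := Sum.elim 0 1

/-- The exponent vector of `∏_i x_{i,0}^{m_i}`. -/
def blockExp (c : Fin (n + 1) → Fin r) : Idx r n → ℕ := Sum.elim (blockSize c) 0

/-- The common factor of `opPoly (ν + rayExp)` and, up to a shift, `opPoly (ν + blockExp)`. -/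
noncomputable def commonPoly (c : Fin (n + 1) → Fin r) (ν : Idx r n → ℕ) : Polynomial ℂ :=
  (∏ i, ∏ k ∈ Finset.range (ν (Sum.inl i)),
    (Polynomial.C (-1 / 2 - k : ℂ) + Polynomial.C (blockSize c i : ℂ) * Polynomial.X)) *
  ∏ j, ∏ k ∈ Finset.range (ν (Sum.inr j)), (-Polynomial.C (k + 1 : ℂ) - Polynomial.X)

/-- The extra derivative in each ray direction contributes the factor -X at k = 0; the old factors
move up by one index. -/
theorem opPoly_add_rayExp (c : Fin (n + 1) → Fin r) (ν : Idx r n → ℕ) :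
    opPoly c (ν + rayExp r n) =
      Polynomial.C ((-1) ^ (n + 1)) * (Polynomial.X ^ (n + 1) * commonPoly c ν) := by
  have h : ∀ j, ∏ k ∈ Finset.range ((ν + rayExp r n) (Sum.inr j)),
      (Polynomial.C ((0 : ℂ) - k) + Polynomial.C (-1) * Polynomial.X) =
      -Polynomial.X * ∏ k ∈ Finset.range (ν (Sum.inr j)),
        (-Polynomial.C (k + 1 : ℂ) - Polynomial.X) := by
    intro j
    have e : (ν + rayExp r n) (Sum.inr j) = ν (Sum.inr j) + 1 := by simp [rayExp]
    rw [e, Finset.prod_range_succ', mul_comm]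
    congr 1
    · simp
    · refine Finset.prod_congr rfl fun k _ => ?_
      simp only [zero_sub, Nat.cast_add, Nat.cast_one, Polynomial.C_neg, Polynomial.C_1]
      ring
  simp only [opPoly, Fintype.prod_sum_type, wExp, tExp, h, Finset.prod_mul_distrib, commonPoly]
  simp only [Finset.prod_const, Finset.card_univ, Fintype.card_fin, Pi.add_apply, rayExp,
    Sum.elim_inl, Pi.zero_apply, add_zero, neg_pow (Polynomial.X : Polynomial ℂ), Polynomial.C_pow,
    Polynomial.C_neg, Polynomial.C_1]
  ring

/-- The first m_i factors of block i form `blockPoly`. Those after them are the old ones at X - 1,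
since -(m_i + k) + m_i X = -k + m_i (X - 1); likewise -k - X = -(k + 1) - (X - 1) for the rays. -/
theorem opPoly_add_blockExp (c : Fin (n + 1) → Fin r) (ν : Idx r n → ℕ) :
    opPoly c (ν + blockExp c) = blockPoly c * (commonPoly c ν).comp (Polynomial.X - 1) := by
  have h : ∀ i, ∏ k ∈ Finset.range ((ν + blockExp c) (Sum.inl i)),
      (Polynomial.C (-1 / 2 - k : ℂ) + Polynomial.C (blockSize c i : ℂ) * Polynomial.X) =
      (∏ k ∈ Finset.range (blockSize c i),
        (Polynomial.C (-1 / 2 - k : ℂ) + Polynomial.C (blockSize c i : ℂ) * Polynomial.X)) *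
      ∏ k ∈ Finset.range (ν (Sum.inl i)), (Polynomial.C (-1 / 2 - k : ℂ) +
        Polynomial.C (blockSize c i : ℂ) * (Polynomial.X - 1)) := by
    intro i
    have e : (ν + blockExp c) (Sum.inl i) = blockSize c i + ν (Sum.inl i) := by
      simp [blockExp, add_comm]
    rw [e, Finset.prod_range_add]
    congr 1
    refine Finset.prod_congr rfl fun k _ => ?_
    simp only [Nat.cast_add, Polynomial.C_sub, Polynomial.C_add]
    ring
  simp only [opPoly, Fintype.prod_sum_type, wExp, tExp, h, Finset.prod_mul_distrib, commonPoly,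
    blockPoly, Polynomial.mul_comp, Polynomial.prod_comp]
  rw [mul_assoc]
  congr 2
  · refine Finset.prod_congr rfl fun i _ => Finset.prod_congr rfl fun k _ => ?_
    simp
  · refine Finset.prod_congr rfl fun j _ => ?_
    have e : (ν + blockExp c) (Sum.inr j) = ν (Sum.inr j) := by simp [blockExp]
    rw [e]
    refine Finset.prod_congr rfl fun k _ => ?_
    simp only [zero_sub, Polynomial.C_neg, Polynomial.sub_comp, Polynomial.neg_comp,
      Polynomial.add_comp, Polynomial.one_comp, Polynomial.C_comp, Polynomial.X_comp,
      Polynomial.C_add, Polynomial.C_1]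
    ring

theorem prod_inv_pow_add_rayExp (x : Idx r n → ℂ) (ν : Idx r n → ℕ) :
    ∏ a, (x a ^ (ν + rayExp r n) a)⁻¹ = (∏ a, (x a ^ ν a)⁻¹) * (∏ j, x (Sum.inr j))⁻¹ := by
  simp only [Pi.add_apply, pow_add, mul_inv, Finset.prod_mul_distrib]
  simp [rayExp, Fintype.prod_sum_type]

theorem prod_inv_pow_add_blockExp (c : Fin (n + 1) → Fin r) (x : Idx r n → ℂ) (ν : Idx r n → ℕ) :
    ∏ a, (x a ^ (ν + blockExp c) a)⁻¹ =
      (∏ a, (x a ^ ν a)⁻¹) * ∏ i, (x (Sum.inl i) ^ blockSize c i)⁻¹ := by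
  simp only [Pi.add_apply, pow_add, mul_inv, Finset.prod_mul_distrib]
  simp [blockExp, Fintype.prod_sum_type]

variable {c : Fin (n + 1) → Fin r} {U : Set (Idx r n → ℂ)} {t w : (Idx r n → ℂ) → ℂ}

theorem prod_inr_ne_zero (h : IsChart c U t w) {x : Idx r n → ℂ} (hx : x ∈ U) :
    ∏ j, x (Sum.inr j) ≠ 0 :=
  Finset.prod_ne_zero_iff.2 fun _ _ => h.ne_zero x hx _

theorem IsChart.exp_neg_t (h : IsChart c U t w) {x : Idx r n → ℂ} (hx : x ∈ U) :
    (4 ^ (n + 1) : ℂ)⁻¹ * exp (-t x) =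
      (-1) ^ (n + 1) * (∏ j, x (Sum.inr j)) * ∏ i, (x (Sum.inl i) ^ blockSize c i)⁻¹ := by
  rw [h.exp_t x hx, qOf, Finset.prod_mul_distrib, Finset.prod_const, Finset.card_univ,
    Fintype.card_fin, show (-4 : ℂ) = -1 * 4 by norm_num, mul_pow]
  field_simp

/-- After removal of w⁻¹ x^{-ν}, this is the shift equation with Q = `commonPoly c ν`. The signs and
the powers of 4 match because of the factors -4 in q. -/
theorem multiPartial_add_rayExp {b : ℝ} (hb : 0 ≤ b) {m : ℕ}
    (hφ : CircleBound (periodWeight c m) b) (h : IsChart c U t w)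
    (ht : ∀ x ∈ U, b + 1 < (t x).re) (ν : Idx r n → ℕ) {x : Idx r n → ℂ} (hx : x ∈ U) :
    multiPartial (ν + rayExp r n) (fun x => (w x)⁻¹ * circleSum (periodWeight c m) (t x)) x =
      multiPartial (ν + blockExp c)
        (fun x => (w x)⁻¹ * circleSum (periodWeight c m) (t x)) x := by
  have hg : ∀ x ∈ U, AnalyticAt ℂ (circleSum (periodWeight c m)) (t x) := fun x hx =>
    analyticAt_circleSum hb hφ (by linarith [ht x hx])
  rw [h.multiPartial_eq hg (fun _ _ => rfl) _ hx, h.multiPartial_eq hg (fun _ _ => rfl) _ hx,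
    prod_inv_pow_add_rayExp, prod_inv_pow_add_blockExp, opPoly_add_rayExp, opPoly_add_blockExp,
    ← Polynomial.smul_eq_C_mul, map_smul, smul_eq_mul,
    applyD_circleSum hb hφ _ (ht x hx), applyD_circleSum hb hφ _ (ht x hx),
    circleSum_shift c _ hb hφ (ht x hx), h.exp_neg_t hx]
  have h1 := prod_inr_ne_zero h hx
  have h2 : ((-1 : ℂ) ^ (n + 1)) * (-1) ^ (n + 1) = 1 := by rw [← mul_pow]; norm_num
  field_simp
  rw [pow_two, h2, mul_one]

theorem multiPartial_add_nsmul_rayExp {b : ℝ} (hb : 0 ≤ b) {m : ℕ}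
    (hφ : CircleBound (periodWeight c m) b) (h : IsChart c U t w)
    (ht : ∀ x ∈ U, b + 1 < (t x).re) (D : ℕ) (ν : Idx r n → ℕ) {x : Idx r n → ℂ} (hx : x ∈ U) :
    multiPartial (ν + D • rayExp r n) (fun x => (w x)⁻¹ * circleSum (periodWeight c m) (t x)) x =
      multiPartial (ν + D • blockExp c)
        (fun x => (w x)⁻¹ * circleSum (periodWeight c m) (t x)) x := by
  induction D generalizing ν with
  | zero => simp
  | succ D ih =>
    rw [succ_nsmul', ← add_assoc, ih, add_right_comm, multiPartial_add_rayExp hb hφ h ht _ hx,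
      succ_nsmul, add_assoc]

theorem sum_ray_mul (k : Fin n) (f : Fin (n + 1) → ℤ) :
    ∑ j, ray j k * f j = f k.castSucc - f (Fin.last n) := by
  rw [Fin.sum_univ_castSucc, Finset.sum_eq_single k]
  · simp [ray, (Fin.castSucc_lt_last k).ne, sub_eq_add_neg]
  · intro j _ hj
    simp [ray, (Fin.castSucc_lt_last j).ne, hj]
  · simp

theorem sum_gkzMatrix_inl_mul (c : Fin (n + 1) → Fin r) (i : Fin r) (u : Idx r n → ℤ) :
    ∑ a, gkzMatrix c (Sum.inl i) a * u a =
      u (Sum.inl i) + ∑ j, if i = c j then u (Sum.inr j) else 0 := by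
  simp [Fintype.sum_sum_type, gkzMatrix]

theorem sum_gkzMatrix_inr_mul (c : Fin (n + 1) → Fin r) (k : Fin n) (u : Idx r n → ℤ) :
    ∑ a, gkzMatrix c (Sum.inr k) a * u a =
      u (Sum.inr k.castSucc) - u (Sum.inr (Fin.last n)) := by
  simp [Fintype.sum_sum_type, gkzMatrix, sum_ray_mul k fun j => u (Sum.inr j)]

/-- The ray rows of A force all ray entries of u - v to equal one number D, and the block rows then
fix the rest, so u - v is D times the basic relation. The common part ν has the block entries of u
and the ray entries of v. -/
theorem exists_eq_add_nsmul {u v : Idx r n → ℕ}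
    (huv : ∀ i, ∑ a, gkzMatrix c i a * (u a : ℤ) = ∑ a, gkzMatrix c i a * (v a : ℤ))
    (hle : v (Sum.inr (Fin.last n)) ≤ u (Sum.inr (Fin.last n))) :
    ∃ (D : ℕ) (ν : Idx r n → ℕ), u = ν + D • rayExp r n ∧ v = ν + D • blockExp c := by
  obtain ⟨D, hD⟩ := Nat.exists_eq_add_of_le hle
  have hinr : ∀ j, (u (Sum.inr j) : ℤ) = v (Sum.inr j) + D := by
    intro j
    refine Fin.lastCases ?_ (fun k => ?_) j
    · exact_mod_cast hD
    · have := huv (Sum.inr k)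
      rw [sum_gkzMatrix_inr_mul, sum_gkzMatrix_inr_mul] at this
      omega
  have hinl : ∀ i, (v (Sum.inl i) : ℤ) = u (Sum.inl i) + D * blockSize c i := by
    intro i
    have := huv (Sum.inl i)
    rw [sum_gkzMatrix_inl_mul, sum_gkzMatrix_inl_mul] at this
    have e : ∀ j, (if i = c j then (u (Sum.inr j) : ℤ) else 0) =
        (if i = c j then (v (Sum.inr j) : ℤ) else 0) + (if c j = i then (1 : ℤ) else 0) * D := by
      intro j
      by_cases hj : c j = i
      · simp [hj, hinr]
      · simp [hj, Ne.symm hj]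
    rw [Finset.sum_congr rfl fun j _ => e j, Finset.sum_add_distrib, ← Finset.sum_mul,
      Finset.sum_boole] at this
    rw [blockSize]
    linarith
  refine ⟨D, Sum.elim (fun i => u (Sum.inl i)) fun j => v (Sum.inr j), ?_, ?_⟩
  · funext a
    cases a with
    | inl i => simp [rayExp]
    | inr j => simpa [rayExp] using (by exact_mod_cast hinr j)
  · funext a
    cases a with
    | inl i => simpa [blockExp] using (by exact_mod_cast hinl i)
    | inr j => simp [blockExp]

theorem sum_gkzMatrix_mul_wExp (c : Fin (n + 1) → Fin r) (i : Fin r ⊕ Fin n) :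
    ∑ a, (gkzMatrix c i a : ℂ) * wExp a = gkzBeta r n i := by
  cases i <;> simp [Fintype.sum_sum_type, gkzMatrix, wExp, gkzBeta]

theorem sum_gkzMatrix_mul_tExp (c : Fin (n + 1) → Fin r) (i : Fin r ⊕ Fin n) :
    ∑ a, (gkzMatrix c i a : ℂ) * tExp c a = 0 := by
  have h : ∑ a, gkzMatrix c i a * (Sum.elim (fun i => (blockSize c i : ℤ)) (fun _ => -1) :
      Idx r n → ℤ) a = 0 := by
    cases i with
    | inl i =>
      rw [sum_gkzMatrix_inl_mul, ← Finset.sum_filter]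
      simp [blockSize, eq_comm]
    | inr k =>
      rw [sum_gkzMatrix_inr_mul]
      simp
  have h' := congrArg (Int.cast : ℤ → ℂ) h
  rw [Int.cast_sum, Int.cast_zero] at h'
  rw [← h']
  refine Finset.sum_congr rfl fun a _ => ?_
  cases a <;> simp [tExp]

/-- The Euler operators act on w⁻¹ g(t) through Ab = β and Aℓ = 0, so they do not see g. -/
theorem IsChart.euler (h : IsChart c U t w) {g : ℂ → ℂ} {x : Idx r n → ℂ} (hx : x ∈ U)
    (hg : AnalyticAt ℂ g (t x)) (i : Fin r ⊕ Fin n) :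
    ∑ a, (gkzMatrix c i a : ℂ) * x a * partialD a (fun x => (w x)⁻¹ * g (t x)) x =
      gkzBeta r n i * ((w x)⁻¹ * g (t x)) := by
  have hf : (fun x => (w x)⁻¹ * g (t x)) = twisted t w g 0 1 := by
    funext y
    simp [twisted, applyD_one]
  have h1 : ∀ a, (gkzMatrix c i a : ℂ) * x a * partialD a (fun x => (w x)⁻¹ * g (t x)) x =
      (w x)⁻¹ * ((gkzMatrix c i a : ℂ) * wExp a * g (t x) +
        (gkzMatrix c i a : ℂ) * tExp c a * applyD g (t x) Polynomial.X) := by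
    intro a
    rw [hf, mul_assoc, h.mul_partialD_twisted hx hg, twisted, applyD_linear_mul, applyD_one]
    simp
    ring
  rw [Finset.sum_congr rfl fun a _ => h1 a, ← Finset.mul_sum, Finset.sum_add_distrib,
    ← Finset.sum_mul, ← Finset.sum_mul, sum_gkzMatrix_mul_wExp, sum_gkzMatrix_mul_tExp]
  ring

theorem isGKZSolution_circleSum {b : ℝ} (hb : 0 ≤ b) {m : ℕ}
    (hφ : CircleBound (periodWeight c m) b) (h : IsChart c U t w)
    (ht : ∀ x ∈ U, b + 1 < (t x).re) :
    IsGKZSolution (gkzMatrix c) (gkzBeta r n) U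
      fun x => (w x)⁻¹ * circleSum (periodWeight c m) (t x) := by
  have hg : ∀ x ∈ U, AnalyticAt ℂ (circleSum (periodWeight c m)) (t x) := fun x hx =>
    analyticAt_circleSum hb hφ (by linarith [ht x hx])
  refine ⟨fun x hx => ?_, fun u v huv x hx => ?_, fun i x hx => h.euler hx (hg x hx) i⟩
  · exact ((h.analytic_w x hx).fun_inv (h.w_ne_zero hx)).fun_mul
      ((hg x hx).fun_comp (h.analytic_t x hx))
  · rcases le_total (v (Sum.inr (Fin.last n))) (u (Sum.inr (Fin.last n))) with hle | hle
    · obtain ⟨D, ν, rfl, rfl⟩ := exists_eq_add_nsmul huv hle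
      exact multiPartial_add_nsmul_rayExp hb hφ h ht D ν hx
    · obtain ⟨D, ν, rfl, rfl⟩ := exists_eq_add_nsmul (fun i => (huv i).symm) hle
      exact (multiPartial_add_nsmul_rayExp hb hφ h ht D ν hx).symm

end Solution

/-! ## Linear independence of the A-periods -/

section Independence

variable {n r : ℕ}

theorem Polynomial.eq_zero_of_sum_C_mul_eq_zero {P : Fin (n + 1) → Polynomial ℂ}
    (hP : ∀ m, (P m).degree = ((n - m : ℕ) : WithBot ℕ)) {a : Fin (n + 1) → ℂ}
    (h : ∑ m, Polynomial.C (a m) * P m = 0) : a = 0 := by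
  have key : ∀ N (m : Fin (n + 1)), (m : ℕ) = N → a m = 0 := by
    intro N
    induction N using Nat.strong_induction_on with
    | _ N ih =>
      intro m hm
      -- In degree n - m, the terms before m vanish by induction and those after m have smaller
      -- degree.
      have h1 := congrArg (fun p => Polynomial.coeff p (n - m)) h
      simp only [Polynomial.finsetSum_coeff, Polynomial.coeff_C_mul, Polynomial.coeff_zero] at h1
      rw [Finset.sum_eq_single m] at h1
      · refine (mul_eq_zero.1 h1).resolve_right ?_
        exact Polynomial.coeff_ne_zero_of_eq_degree (hP m)
      · intro k _ hk
        rcases lt_or_gt_of_ne hk with hlt | hgt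
        · rw [ih k (by omega) k rfl, zero_mul]
        · rw [Polynomial.coeff_eq_zero_of_degree_lt, mul_zero]
          rw [hP, Nat.cast_lt]
          have := k.isLt
          have : (m : ℕ) < k := hgt
          omega
      · simp
  funext m
  exact key m m rfl

theorem Polynomial.eq_zero_of_tendsto_eval {P : Polynomial ℂ}
    (h : Filter.Tendsto (fun x : ℝ => P.eval (x : ℂ)) Filter.atTop (nhds 0)) : P = 0 := by
  have hz : Filter.Tendsto (fun x : ℝ => ‖(x : ℂ)‖) Filter.atTop Filter.atTop := by
    simp only [Complex.norm_real, Real.norm_eq_abs]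
    exact Filter.tendsto_abs_atTop_atTop
  have hd : P.degree ≤ 0 := by
    by_contra! hd
    exact not_tendsto_nhds_of_tendsto_atTop (P.tendsto_norm_atTop hd hz) _ h.norm
  rw [Polynomial.eq_C_of_degree_le_zero hd] at h ⊢
  simp only [Polynomial.eval_C] at h
  rw [tendsto_nhds_unique tendsto_const_nhds h, Polynomial.C_0]

/-- For real t = x the terms with l ≥ 1 are dominated by a geometric series with sum of order
e^{x/3} e^{b - x}. -/
theorem CircleBound.tendsto_circleSum_sub {φ : ℂ → ℂ} {b : ℝ} (h : CircleBound φ b) :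
    Filter.Tendsto (fun x : ℝ => circleSum φ x - circleTerm φ 0 x) Filter.atTop (nhds 0) := by
  obtain ⟨K, hK, hle⟩ := h.norm_circleTerm_le
  have hlim : Filter.Tendsto (fun x : ℝ => 2 * K * Real.exp b * Real.exp (-(2 / 3 * x)))
      Filter.atTop (nhds 0) := by
    rw [← mul_zero (2 * K * Real.exp b)]
    refine (Real.tendsto_exp_neg_atTop_nhds_zero.comp ?_).const_mul _
    exact Filter.tendsto_id.const_mul_atTop (by norm_num)
  refine squeeze_zero_norm' ?_ hlim
  filter_upwards [Filter.eventually_ge_atTop (|b| + 1)] with x hx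
  have hx0 : 0 ≤ x := by linarith [abs_nonneg b]
  have hbx : b + 1 ≤ x := by linarith [le_abs_self b]
  have hs := h.hasSum (t := (x : ℂ)) (by simpa using hx0) (by simp; linarith)
  have hs1 := (hasSum_nat_add_iff' 1).2 hs
  rw [Finset.sum_range_one] at hs1
  set ρ := Real.exp (b - x) with hρ
  have hρ0 : 0 < ρ := Real.exp_pos _
  have hρ1 : ρ ≤ 1 / 2 := by
    have h1 : Real.exp (-1) ≤ 1 / 2 := by
      rw [Real.exp_neg, inv_le_comm₀ (Real.exp_pos _) (by norm_num)]
      linarith [Real.add_one_le_exp (1 : ℝ)]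
    exact (Real.exp_le_exp.2 (by linarith)).trans h1
  have hg := (hasSum_geometric_of_lt_one hρ0.le (by linarith)).mul_left
    (K * Real.exp (x / 3) * ρ)
  have hb : ∀ l : ℕ, ‖circleTerm φ (l + 1) x‖ ≤ K * Real.exp (x / 3) * ρ * ρ ^ l := by
    intro l
    have := hle (l + 1) (x : ℂ) (by simpa using hx0)
    simp only [ofReal_re, ofReal_im, abs_zero, add_zero] at this
    rwa [pow_succ', ← mul_assoc] at this
  have h2 := tsum_of_norm_bounded hg hb
  rw [hs1.tsum_eq] at h2
  refine h2.trans ?_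
  have h3 : (1 - ρ)⁻¹ ≤ 2 := by
    rw [inv_le_comm₀ (by linarith) (by norm_num)]
    linarith
  have h4 : Real.exp (x / 3) * ρ = Real.exp b * Real.exp (-(2 / 3 * x)) := by
    rw [hρ, ← Real.exp_add, ← Real.exp_add]
    congr 1
    ring
  calc K * Real.exp (x / 3) * ρ * (1 - ρ)⁻¹ ≤ K * Real.exp (x / 3) * ρ * 2 := by gcongr
    _ = 2 * K * (Real.exp (x / 3) * ρ) := by ring
    _ = _ := by rw [h4]; ring

/-- For t → +∞ the combination of the leading polynomials tends to 0, so it is the zero polynomial;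
its members have pairwise distinct degrees. -/
theorem eq_zero_of_sum_circleSum_eq_zero (c : Fin (n + 1) → Fin r) {b : ℝ}
    (hφ : ∀ m ≤ n, CircleBound (periodWeight c m) b) {a : Fin (n + 1) → ℂ}
    (h : ∀ t : ℂ, b < t.re → ∑ m : Fin (n + 1), a m * circleSum (periodWeight c m) t = 0) :
    a = 0 := by
  choose P hP hPt using fun m : Fin (n + 1) =>
    exists_polynomial_leading_term c (Nat.lt_succ_iff.1 m.isLt)
  refine Polynomial.eq_zero_of_sum_C_mul_eq_zero hP (Polynomial.eq_zero_of_tendsto_eval ?_)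
  have h1 : Filter.Tendsto (fun x : ℝ => ∑ m : Fin (n + 1), a m *
      (circleSum (periodWeight c m) x - circleTerm (periodWeight c m) 0 x)) Filter.atTop
      (nhds (∑ m : Fin (n + 1), a m * 0)) :=
    tendsto_finsetSum _ fun m _ =>
      ((hφ m (Nat.lt_succ_iff.1 m.isLt)).tendsto_circleSum_sub).const_mul _
  simp only [mul_zero, Finset.sum_const_zero] at h1
  rw [← neg_zero]
  refine h1.neg.congr' ?_
  filter_upwards [Filter.eventually_gt_atTop b] with x hx
  have h2 := h x (by simpa using hx)
  simp only [mul_sub, Finset.sum_sub_distrib, h2, hPt, zero_sub, neg_neg, Polynomial.eval_finsetSum,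
    Polynomial.eval_mul, Polynomial.eval_C]

/-- The direction in which `ln x_{n+1}` decreases. -/
def lastDir (r n : ℕ) : Idx r n → ℂ := Pi.single (Sum.inr (Fin.last n)) (-1)

theorem sum_tExp_mul_lastDir (c : Fin (n + 1) → Fin r) :
    ∑ a, tExp c a * lastDir r n a = 1 := by
  rw [Finset.sum_eq_single (Sum.inr (Fin.last n))]
  · simp [tExp, lastDir]
  · intro a _ ha
    simp [lastDir, ha]
  · simp

variable {c : Fin (n + 1) → Fin r} {U : Set (Idx r n → ℂ)} {t w : (Idx r n → ℂ) → ℂ}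

/-- The values t(U) may be confined to a small set, but t has speed 1 along `lastDir`, so they
accumulate at t(x). The identity theorem extends the relation to the half-plane, where t → +∞ is
available. -/
theorem IsChart.eq_zero_of_sum_eq_zero (h : IsChart c U t w) (hU : U.Nonempty) {b : ℝ}
    (hb : 0 ≤ b) (hφ : ∀ m ≤ n, CircleBound (periodWeight c m) b) (ht : ∀ x ∈ U, b < (t x).re)
    {a : Fin (n + 1) → ℂ}
    (h0 : ∀ x ∈ U, ∑ m : Fin (n + 1), a m * ((w x)⁻¹ * circleSum (periodWeight c m) (t x)) = 0) :
    a = 0 := by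
  obtain ⟨x, hx⟩ := hU
  set G : ℂ → ℂ := fun s => ∑ m : Fin (n + 1), a m * circleSum (periodWeight c m) s with hG
  have hGU : ∀ y ∈ U, G (t y) = 0 := by
    intro y hy
    have := h0 y hy
    simp only [mul_left_comm (a _), ← Finset.mul_sum] at this
    exact (mul_eq_zero.1 this).resolve_left (inv_ne_zero (h.w_ne_zero hy))
  have hGa : AnalyticOnNhd ℂ G {s | b < s.re} := fun s hs =>
    Finset.analyticAt_fun_sum _ fun m _ => analyticAt_const.fun_mul
      (analyticAt_circleSum hb (hφ m (Nat.lt_succ_iff.1 m.isLt)) hs)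
  have hd := h.hasDerivAt_t hx (lastDir r n)
  rw [sum_tExp_mul_lastDir] at hd
  have htend := hd.tendsto_nhdsNE one_ne_zero
  rw [zero_smul, expScale_zero] at htend
  have hfreq : ∃ᶠ s in nhdsWithin (t x) {t x}ᶜ, G s = 0 := by
    refine htend.frequently (Filter.Eventually.frequently ?_)
    filter_upwards [nhdsWithin_le_nhds (h.eventually_expScale_mem hx (lastDir r n))] with s hs
      using hGU _ hs
  have hconv : Convex ℝ {s : ℂ | b < s.re} := convex_halfSpace_re_gt b
  have hz := hGa.eqOn_zero_of_preconnected_of_frequently_eq_zero hconv.isPreconnected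
    (ht x hx) hfreq
  exact eq_zero_of_sum_circleSum_eq_zero c hφ fun s hs => hz hs

end Independence

/-! ## Linear structure on the solutions of a GKZ system -/

section Linear

variable {ι d : Type} [DecidableEq ι] {U : Set (ι → ℂ)} {f g : (ι → ℂ) → ℂ}

theorem iterate_partialD_congr (hU : IsOpen U) (h : Set.EqOn f g U) (a : ι) (k : ℕ) :
    Set.EqOn ((partialD a)^[k] f) ((partialD a)^[k] g) U := by
  induction k with
  | zero => exact h
  | succ k ih =>
    rw [Function.iterate_succ_apply', Function.iterate_succ_apply']
    exact partialD_congr hU ih a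

variable [Fintype ι]

theorem AnalyticOnNhd.partialD (hf : AnalyticOnNhd ℂ f U) (a : ι) :
    AnalyticOnNhd ℂ (partialD a f) U := fun x hx =>
  ((ContinuousLinearMap.apply ℂ ℂ (Pi.single a 1 : ι → ℂ)).analyticAt _).comp (hf x hx).fderiv

theorem AnalyticOnNhd.iterate_partialD (hf : AnalyticOnNhd ℂ f U) (a : ι) (k : ℕ) :
    AnalyticOnNhd ℂ ((_root_.partialD a)^[k] f) U := by
  induction k with
  | zero => exact hf
  | succ k ih =>
    rw [Function.iterate_succ_apply']
    exact ih.partialD a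

theorem partialD_lincomb (hf : AnalyticOnNhd ℂ f U) (hg : AnalyticOnNhd ℂ g U) (z : ℂ) (a : ι) :
    Set.EqOn (partialD a (fun x => z * f x + g x))
      (fun x => z * partialD a f x + partialD a g x) U := by
  intro x hx
  have h1 := ((hf x hx).differentiableAt.hasFDerivAt.const_mul z).fun_add
    (hg x hx).differentiableAt.hasFDerivAt
  simp only [partialD]
  rw [h1.fderiv]
  simp

theorem iterate_partialD_lincomb (hU : IsOpen U) (hf : AnalyticOnNhd ℂ f U)
    (hg : AnalyticOnNhd ℂ g U) (z : ℂ) (a : ι) (k : ℕ) :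
    Set.EqOn ((partialD a)^[k] (fun x => z * f x + g x))
      (fun x => z * (partialD a)^[k] f x + (partialD a)^[k] g x) U := by
  induction k with
  | zero => exact fun x _ => rfl
  | succ k ih =>
    intro x hx
    rw [Function.iterate_succ_apply', partialD_congr hU ih a hx,
      partialD_lincomb (hf.iterate_partialD a k) (hg.iterate_partialD a k) z a hx,
      Function.iterate_succ_apply', Function.iterate_succ_apply']

/-- Analyticity is carried through the induction, because `fderiv` is additive only on
differentiable functions. -/
theorem foldr_partialD_lincomb (hU : IsOpen U) (u : ι → ℕ) (hf : AnalyticOnNhd ℂ f U)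
    (hg : AnalyticOnNhd ℂ g U) (z : ℂ) (l : List ι) :
    AnalyticOnNhd ℂ (l.foldr (fun a g => (partialD a)^[u a] g) f) U ∧
    AnalyticOnNhd ℂ (l.foldr (fun a g => (partialD a)^[u a] g) g) U ∧
    Set.EqOn (l.foldr (fun a g => (partialD a)^[u a] g) fun x => z * f x + g x)
      (fun x => z * l.foldr (fun a g => (partialD a)^[u a] g) f x +
        l.foldr (fun a g => (partialD a)^[u a] g) g x) U := by
  induction l with
  | nil => exact ⟨hf, hg, fun x _ => rfl⟩
  | cons a l ih =>
    obtain ⟨h1, h2, h3⟩ := ih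
    refine ⟨h1.iterate_partialD a _, h2.iterate_partialD a _, fun x hx => ?_⟩
    simp only [List.foldr_cons]
    rw [iterate_partialD_congr hU h3 a _ hx, iterate_partialD_lincomb hU h1 h2 z a _ hx]

theorem multiPartial_lincomb (hU : IsOpen U) (u : ι → ℕ) (hf : AnalyticOnNhd ℂ f U)
    (hg : AnalyticOnNhd ℂ g U) (z : ℂ) :
    Set.EqOn (multiPartial u fun x => z * f x + g x)
      (fun x => z * multiPartial u f x + multiPartial u g x) U :=
  (foldr_partialD_lincomb hU u hf hg z _).2.2

variable {A : Matrix d ι ℤ} {β : d → ℂ}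

theorem IsGKZSolution.lincomb (hU : IsOpen U) (hf : IsGKZSolution A β U f)
    (hg : IsGKZSolution A β U g) (z : ℂ) : IsGKZSolution A β U fun x => z * f x + g x := by
  refine ⟨fun x hx => (analyticAt_const.fun_mul (hf.analytic x hx)).fun_add (hg.analytic x hx),
    fun u v huv x hx => ?_, fun i x hx => ?_⟩
  · rw [multiPartial_lincomb hU u hf.analytic hg.analytic z hx,
      multiPartial_lincomb hU v hf.analytic hg.analytic z hx]
    simp only [hf.box u v huv x hx, hg.box u v huv x hx]
  · simp only [partialD_lincomb hf.analytic hg.analytic z _ hx, mul_add, mul_left_comm _ z,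
      Finset.sum_add_distrib, ← Finset.mul_sum, hf.euler i x hx, hg.euler i x hx]

theorem multiPartial_zero_fun (u : ι → ℕ) :
    multiPartial u (fun _ : ι → ℂ => (0 : ℂ)) = fun _ => 0 := by
  have h1 : ∀ a : ι, partialD a (fun _ : ι → ℂ => (0 : ℂ)) = fun _ => 0 := by
    intro a
    funext x
    simp [partialD]
  rw [multiPartial]
  induction (Finset.univ : Finset ι).toList with
  | nil => rfl
  | cons a l ih =>
    rw [List.foldr_cons, ih]
    exact Function.iterate_fixed (h1 a) _

theorem IsGKZSolution.zero : IsGKZSolution A β U fun _ => 0 := by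
  refine ⟨fun _ _ => analyticAt_const, fun u v _ x _ => ?_, fun i x _ => ?_⟩
  · rw [multiPartial_zero_fun, multiPartial_zero_fun]
  · simp [partialD]

/-- The solutions of a GKZ system on an open set, as a subspace of the functions. -/
def gkzSubmodule (A : Matrix d ι ℤ) (β : d → ℂ) (hU : IsOpen U) : Submodule ℂ (U → ℂ) where
  carrier := gkzSolutions A β U
  zero_mem' := ⟨_, .zero, fun _ => rfl⟩
  add_mem' := by
    rintro _ _ ⟨f, hf, h1⟩ ⟨g, hg, h2⟩
    exact ⟨_, hf.lincomb hU hg 1, fun x => by simp [h1, h2]⟩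
  smul_mem' := by
    rintro z _ ⟨f, hf, h1⟩
    exact ⟨_, hf.lincomb hU .zero z, fun x => by simp [h1]⟩

end Linear

/-! ## Uniqueness for linear differential equations -/

section Uniqueness

theorem hasDerivAt_iteratedDeriv {g : ℂ → ℂ} {τ : ℂ} (hg : AnalyticAt ℂ g τ) (k : ℕ) :
    HasDerivAt (iteratedDeriv k g) (iteratedDeriv (k + 1) g τ) τ := by
  rw [iteratedDeriv_succ]
  refine DifferentiableAt.hasDerivAt ?_
  rw [iteratedDeriv_eq_iterate]
  exact (hg.iterated_deriv k).differentiableAt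

theorem applyD_eq_sum_range (g : ℂ → ℂ) (τ : ℂ) {p : Polynomial ℂ} {N : ℕ}
    (hp : p.natDegree < N) :
    applyD g τ p = ∑ k ∈ Finset.range N, p.coeff k * iteratedDeriv k g τ := by
  conv_lhs => rw [p.as_sum_range' N hp]
  rw [map_sum]
  simp only [applyD_monomial]

/-- The top derivative occurs on both sides of the equation, and solving for it requires 1 - κ
p_{N+1} ≠ 0. The vector of the derivatives up to order N then satisfies |G'| ≤ K|G|, and Gronwall's
inequality on segments from τ₀ finishes. -/
theorem eventually_eq_zero_of_linear_ode {g κ : ℂ → ℂ} {τ₀ : ℂ} (hg : AnalyticAt ℂ g τ₀) {N : ℕ}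
    {p : Polynomial ℂ} (hp : p.natDegree ≤ N + 1) (hκ : ContinuousAt κ τ₀)
    (hne : κ τ₀ * p.coeff (N + 1) ≠ 1)
    (hode : ∀ᶠ τ in nhds τ₀, iteratedDeriv (N + 1) g τ = κ τ * applyD g τ p)
    (h0 : ∀ k ≤ N, iteratedDeriv k g τ₀ = 0) : ∀ᶠ τ in nhds τ₀, g τ = 0 := by
  set G : ℂ → Fin (N + 1) → ℂ := fun τ k => iteratedDeriv k g τ with hG
  set G' : ℂ → Fin (N + 1) → ℂ := fun τ k => iteratedDeriv (k + 1) g τ with hG'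
  set δ := ‖1 - κ τ₀ * p.coeff (N + 1)‖ / 2 with hδ
  have hδ0 : 0 < δ := half_pos (norm_pos_iff.2 (sub_ne_zero.2 hne.symm))
  have hE1 : ∀ᶠ τ in nhds τ₀, δ < ‖1 - κ τ * p.coeff (N + 1)‖ := by
    have : ContinuousAt (fun τ => ‖1 - κ τ * p.coeff (N + 1)‖) τ₀ :=
      (continuousAt_const.sub (hκ.mul continuousAt_const)).norm
    exact this.eventually (lt_mem_nhds (half_lt_self (by linarith)))
  have hE2 : ∀ᶠ τ in nhds τ₀, ‖κ τ‖ < ‖κ τ₀‖ + 1 :=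
    hκ.norm.eventually (gt_mem_nhds (by linarith))
  set S := ∑ k ∈ Finset.range (N + 1), ‖p.coeff k‖ with hS
  have hS0 : 0 ≤ S := Finset.sum_nonneg fun _ _ => norm_nonneg _
  set K := 1 + δ⁻¹ * ((‖κ τ₀‖ + 1) * S) with hK
  have hK1 : 1 ≤ K := by
    have : 0 ≤ δ⁻¹ * ((‖κ τ₀‖ + 1) * S) := by positivity
    linarith
  have hE3 : ∀ᶠ τ in nhds τ₀, AnalyticAt ℂ g τ ∧ ‖G' τ‖ ≤ K * ‖G τ‖ := by
    filter_upwards [hE1, hE2, hode, hg.eventually_analyticAt] with τ h1 h2 h3 h4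
    refine ⟨h4, (pi_norm_le_iff_of_nonneg (by positivity)).2 fun k => ?_⟩
    rcases Nat.lt_or_ge (k + 1) (N + 1) with hk | hk
    · have := norm_le_pi_norm (G τ) ⟨k + 1, hk⟩
      calc ‖G' τ k‖ ≤ ‖G τ‖ := this
        _ ≤ K * ‖G τ‖ := le_mul_of_one_le_left (norm_nonneg _) hK1
    · have hkN : (k : ℕ) = N := by omega
      rw [applyD_eq_sum_range g τ (Nat.lt_succ_of_le hp), Finset.sum_range_succ] at h3
      have h5 : (1 - κ τ * p.coeff (N + 1)) * iteratedDeriv (N + 1) g τ =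
          κ τ * ∑ k ∈ Finset.range (N + 1), p.coeff k * iteratedDeriv k g τ := by
        linear_combination h3
      have h6 : ‖∑ k ∈ Finset.range (N + 1), p.coeff k * iteratedDeriv k g τ‖ ≤ S * ‖G τ‖ := by
        rw [hS, Finset.sum_mul]
        refine norm_sum_le_of_le _ fun j hj => ?_
        rw [norm_mul]
        exact mul_le_mul_of_nonneg_left
          (norm_le_pi_norm (G τ) ⟨j, Finset.mem_range.1 hj⟩) (norm_nonneg _)
      have h7 := congrArg norm h5
      rw [norm_mul, norm_mul] at h7
      have h8 : δ * ‖iteratedDeriv (N + 1) g τ‖ ≤ (‖κ τ₀‖ + 1) * (S * ‖G τ‖) := by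
        refine (mul_le_mul_of_nonneg_right h1.le (norm_nonneg _)).trans (h7.le.trans ?_)
        exact mul_le_mul h2.le h6 (norm_nonneg _) (by positivity)
      have h9 : ‖G' τ k‖ = ‖iteratedDeriv (N + 1) g τ‖ := by rw [hG']; simp only [hkN]
      rw [h9]
      calc ‖iteratedDeriv (N + 1) g τ‖ ≤ δ⁻¹ * ((‖κ τ₀‖ + 1) * (S * ‖G τ‖)) := by
            rwa [← div_eq_inv_mul, le_div_iff₀' hδ0]
        _ = (K - 1) * ‖G τ‖ := by rw [hK]; ring
        _ ≤ K * ‖G τ‖ := by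
            have := norm_nonneg (G τ)
            nlinarith
  obtain ⟨ε, hε, hball⟩ := Metric.eventually_nhds_iff_ball.1 hE3
  filter_upwards [Metric.ball_mem_nhds τ₀ hε] with z hz
  have hmem : ∀ s ∈ Set.Icc (0 : ℝ) 1, τ₀ + s * (z - τ₀) ∈ Metric.ball τ₀ ε := by
    intro s hs
    rw [mem_ball_iff_norm] at hz ⊢
    rw [add_sub_cancel_left, norm_mul, norm_real, Real.norm_eq_abs, abs_of_nonneg hs.1]
    exact (mul_le_of_le_one_left (norm_nonneg _) hs.2).trans_lt hz
  have hder : ∀ s ∈ Set.Icc (0 : ℝ) 1, HasDerivAt (fun s : ℝ => G (τ₀ + s * (z - τ₀)))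
      ((z - τ₀) • G' (τ₀ + s * (z - τ₀))) s := by
    intro s hs
    rw [hasDerivAt_pi]
    intro k
    have h1 := hasDerivAt_iteratedDeriv (hball _ (hmem s hs)).1 k
    have h2 : HasDerivAt (fun s : ℝ => τ₀ + s * (z - τ₀)) (z - τ₀) s := by
      have := ((hasDerivAt_id s).ofReal_comp.mul_const (z - τ₀)).const_add τ₀
      simpa using this
    have h3 := h1.comp s h2
    refine h3.congr_deriv ?_
    rw [Pi.smul_apply, smul_eq_mul, mul_comm]
  have hfin := eq_zero_of_abs_deriv_le_mul_abs_self_of_eq_zero_right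
    (f := fun s : ℝ => G (τ₀ + s * (z - τ₀)))
    (f' := fun s : ℝ => (z - τ₀) • G' (τ₀ + s * (z - τ₀))) (K := ‖z - τ₀‖ * K) (a := 0) (b := 1)
    (fun s hs => (hder s hs).continuousAt.continuousWithinAt)
    (fun s hs => (hder s (Set.Ico_subset_Icc_self hs)).hasDerivWithinAt)
    (by
      funext k
      simpa [hG] using h0 k (Nat.lt_succ_iff.1 k.isLt))
    (fun s hs => by
      rw [norm_smul, mul_assoc]
      exact mul_le_mul_of_nonneg_left (hball _ (hmem s (Set.Ico_subset_Icc_self hs))).2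
        (norm_nonneg _))
    1 ⟨zero_le_one, le_rfl⟩
  have := congrFun hfin 0
  simpa [hG] using this

end Uniqueness

/-! ## Solutions of the GKZ system are determined by a jet of order `n` -/

section Local

variable {n r : ℕ} {c : Fin (n + 1) → Fin r} {U : Set (Idx r n → ℂ)} {t w f : (Idx r n → ℂ) → ℂ}

theorem expScale_add (x u v : Idx r n → ℂ) : expScale x (u + v) = expScale (expScale x u) v := by
  funext a
  simp [expScale, exp_add, mul_assoc]

theorem continuous_expScale (x : Idx r n → ℂ) : Continuous (expScale x) := by
  refine continuous_pi fun a => ?_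
  simp only [expScale]
  fun_prop

theorem differentiable_expScale_line (x v : Idx r n → ℂ) :
    Differentiable ℂ fun s : ℂ => expScale x (s • v) := fun s =>
  (hasDerivAt_expScale x v s).differentiableAt

/-- The ray rows make all ray entries equal, and the block rows determine the others: the kernel of
A is the line spanned by ℓ. -/
theorem exists_eq_mul_tExp {d : Idx r n → ℂ}
    (h : ∀ i, ∑ a, (gkzMatrix c i a : ℂ) * d a = 0) :
    ∃ l : ℂ, ∀ a, d a = tExp c a * l := by
  have hinr : ∀ j, d (Sum.inr j) = d (Sum.inr (Fin.last n)) := by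
    intro j
    refine Fin.lastCases rfl (fun k => ?_) j
    have h1 := h (Sum.inr k)
    simp only [Fintype.sum_sum_type, gkzMatrix, Int.cast_zero, zero_mul, Finset.sum_const_zero,
      zero_add] at h1
    rw [Fin.sum_univ_castSucc, Finset.sum_eq_single k] at h1
    · simp only [ray, (Fin.castSucc_lt_last k).ne, if_true, if_false] at h1
      push_cast at h1
      linear_combination h1
    · intro j _ hj
      simp [ray, (Fin.castSucc_lt_last j).ne, hj]
    · simp
  refine ⟨-d (Sum.inr (Fin.last n)), fun a => ?_⟩
  cases a with
  | inr j => rw [hinr, tExp]; ring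
  | inl i =>
    have h1 := h (Sum.inl i)
    simp only [Fintype.sum_sum_type, gkzMatrix, hinr, Int.cast_ite, Int.cast_one, Int.cast_zero,
      ite_mul, one_mul, zero_mul, Finset.sum_ite_eq, Finset.mem_univ, if_true] at h1
    simp only [← Finset.sum_filter, Finset.sum_const, nsmul_eq_mul, eq_comm (a := i)] at h1
    simp only [tExp, blockSize]
    linear_combination h1

/-- In logarithmic coordinates, `f w` is constant along the level sets of `t`. -/
theorem IsGKZSolution.hasDerivAt_mul_w (hf : IsGKZSolution (gkzMatrix c) (gkzBeta r n) U f)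
    (h : IsChart c U t w) {x : Idx r n → ℂ} (hx : x ∈ U) {v : Idx r n → ℂ}
    (hv : ∑ a, tExp c a * v a = 0) :
    HasDerivAt (fun s : ℂ => f (expScale x (s • v)) * w (expScale x (s • v))) 0 0 := by
  have h0 : expScale x ((0 : ℂ) • v) = x := by rw [zero_smul, expScale_zero]
  have hw := h.w_ne_zero hx
  have h1 := hasDerivAt_comp_expScale (f := f) (x := x) (v := v) (s := 0)
    (by rw [h0]; exact (hf.analytic x hx).differentiableAt)
  have h2 := (h.hasDerivAt_w_inv hx v).fun_inv (by rw [h0]; exact inv_ne_zero hw)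
  simp only [inv_inv] at h2
  have h3 := h1.fun_mul h2
  rw [h0] at h3
  refine h3.congr_deriv ?_
  -- By the Euler equations this vector lies in the kernel of A, hence on the line of ℓ, to which v
  -- is orthogonal.
  obtain ⟨l, hl⟩ : ∃ l : ℂ, ∀ a, x a * partialD a f x - wExp a * f x = tExp c a * l := by
    refine exists_eq_mul_tExp fun i => ?_
    simp only [mul_sub, ← mul_assoc, Finset.sum_sub_distrib]
    rw [hf.euler i x hx, ← Finset.sum_mul, sum_gkzMatrix_mul_wExp, sub_self]
  have h4 : ∑ a, v a * (x a * partialD a f x) = f x * ∑ a, wExp a * v a := by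
    have : ∀ a, v a * (x a * partialD a f x) = f x * (wExp a * v a) + l * (tExp c a * v a) := by
      intro a
      linear_combination v a * hl a
    rw [Finset.sum_congr rfl fun a _ => this a, Finset.sum_add_distrib, ← Finset.mul_sum,
      ← Finset.mul_sum, hv, mul_zero, add_zero]
  rw [h4]
  field_simp
  ring

theorem IsGKZSolution.mul_w_eq_of_ball (hf : IsGKZSolution (gkzMatrix c) (gkzBeta r n) U f)
    (h : IsChart c U t w) {x : Idx r n → ℂ} {δ : ℝ}
    (hδ : ∀ u ∈ Metric.ball (0 : Idx r n → ℂ) δ, expScale x u ∈ U) {u u' : Idx r n → ℂ}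
    (hu : u ∈ Metric.ball 0 δ) (hu' : u' ∈ Metric.ball 0 δ)
    (huu' : ∑ a, tExp c a * u a = ∑ a, tExp c a * u' a) :
    f (expScale x u) * w (expScale x u) = f (expScale x u') * w (expScale x u') := by
  set v := u' - u with hv
  have hsum : ∑ a, tExp c a * v a = 0 := by
    simp only [hv, Pi.sub_apply, mul_sub, Finset.sum_sub_distrib, huu', sub_self]
  set S : Set ℂ := (fun s : ℂ => u + s • v) ⁻¹' Metric.ball 0 δ with hS
  have hSo : IsOpen S := Metric.isOpen_ball.preimage (by fun_prop)
  have hSc : Convex ℝ S := by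
    intro s hs s' hs' a b ha hb hab
    have e : u + (a • s + b • s') • v = a • (u + s • v) + b • (u + s' • v) := by
      have : u = a • u + b • u := by rw [← add_smul, hab, one_smul]
      conv_lhs => rw [this]
      simp only [smul_add, add_smul, smul_assoc]
      abel
    rw [hS, Set.mem_preimage, e]
    exact convex_ball _ _ hs hs' ha hb hab
  set F : ℂ → ℂ := fun s => f (expScale x (u + s • v)) * w (expScale x (u + s • v)) with hF
  have hder : ∀ s ∈ S, HasDerivAt F 0 s := by
    intro s hs
    have h1 := hf.hasDerivAt_mul_w h (hδ _ hs) hsum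
    have h2 : HasDerivAt (fun s' : ℂ => s' - s) 1 s := (hasDerivAt_id s).sub_const s
    have h3 := h1.comp_of_eq s h2 (sub_self s).symm
    rw [zero_mul] at h3
    refine h3.congr_of_eventuallyEq (Filter.Eventually.of_forall fun s' => ?_)
    simp only [hF, Function.comp_apply, ← expScale_add]
    have : u + s • v + (s' - s) • v = u + s' • v := by rw [sub_smul]; abel
    rw [this]
  have h0 : (0 : ℂ) ∈ S := by simpa [hS] using hu
  have h1 : (1 : ℂ) ∈ S := by simpa [hS, hv] using hu'
  have := hSo.is_const_of_deriv_eq_zero hSc.isPreconnected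
    (fun s hs => (hder s hs).differentiableAt.differentiableWithinAt)
    (fun s hs => (hder s hs).deriv) h0 h1
  simpa [hF, hv] using this

/-- The difference ζ of the two sides satisfies e^ζ = 1 and is continuous with ζ = 0 at u = 0; being
small, it vanishes. -/
theorem IsChart.eventually_t_expScale (h : IsChart c U t w) {x : Idx r n → ℂ} (hx : x ∈ U) :
    ∀ᶠ u in nhds (0 : Idx r n → ℂ), expScale x u ∈ U ∧
      t (expScale x u) = t x + ∑ a, tExp c a * u a := by
  have hc := (continuous_expScale x).continuousAt (x := 0)
  have hU : ∀ᶠ u in nhds (0 : Idx r n → ℂ), expScale x u ∈ U :=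
    hc.eventually_mem (by rw [expScale_zero]; exact h.isOpen.mem_nhds hx)
  set ζ : (Idx r n → ℂ) → ℂ := fun u => t (expScale x u) - (t x + ∑ a, tExp c a * u a) with hζ
  have hζc : ContinuousAt ζ 0 := by
    have h1 : ContinuousAt (fun u => t (expScale x u)) 0 :=
      ContinuousAt.comp (g := t) (by rw [expScale_zero]; exact (h.analytic_t x hx).continuousAt) hc
    have h2 : Continuous fun u : Idx r n → ℂ => t x + ∑ a, tExp c a * u a := by fun_prop
    exact h1.sub h2.continuousAt
  have hζ0 : ζ 0 = 0 := by simp [hζ, expScale_zero]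
  have hlt : ∀ᶠ u in nhds (0 : Idx r n → ℂ), ‖ζ u‖ < 1 := by
    have := hζc.norm
    rw [ContinuousAt, hζ0, norm_zero] at this
    exact this.eventually (gt_mem_nhds one_pos)
  filter_upwards [hU, hlt] with u h1 h2
  refine ⟨h1, ?_⟩
  have h3 : exp (ζ u) = 1 := by
    have e : ζ u = -(-t (expScale x u)) + (-t x + -∑ a, tExp c a * u a) := by rw [hζ]; ring
    rw [e, exp_add, exp_neg, h.exp_t _ h1, qOf_expScale, exp_add, ← h.exp_t x hx]
    exact inv_mul_cancel₀ (mul_ne_zero (exp_ne_zero _) (exp_ne_zero _))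
  have h4 : |(ζ u).im| < 1 := (abs_im_le_norm _).trans_lt h2
  have h5 := abs_lt.1 h4
  have h6 := Real.pi_gt_three
  have h7 := log_exp (x := ζ u) (by linarith) (by linarith)
  rw [h3, log_one] at h7
  exact sub_eq_zero.1 h7.symm

/-- The function `g` of `t` for which `f = w⁻¹ g(t)` near `x`. -/
noncomputable def profile (t w f : (Idx r n → ℂ) → ℂ) (x : Idx r n → ℂ) (τ : ℂ) : ℂ :=
  f (expScale x ((τ - t x) • lastDir r n)) * w (expScale x ((τ - t x) • lastDir r n))

theorem IsChart.analyticAt_profile (h : IsChart c U t w) (hf : AnalyticOnNhd ℂ f U)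
    {x : Idx r n → ℂ} (hx : x ∈ U) : AnalyticAt ℂ (profile t w f x) (t x) := by
  have h1 : AnalyticAt ℂ (fun τ : ℂ => expScale x ((τ - t x) • lastDir r n)) (t x) :=
    ((differentiable_expScale_line x (lastDir r n)).comp
      (differentiable_id.sub_const (t x))).analyticAt _
  have h0 : expScale x ((t x - t x) • lastDir r n) = x := by
    rw [sub_self, zero_smul, expScale_zero]
  exact ((hf x hx).comp_of_eq h1 h0).fun_mul ((h.analytic_w x hx).comp_of_eq h1 h0)

/-- In the logarithmic coordinates u around x, a point y is compared with the point u' of the line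
in direction `lastDir` on the same level set of t, where f w takes the same value. -/
theorem IsGKZSolution.eventually_eq_profile
    (hf : IsGKZSolution (gkzMatrix c) (gkzBeta r n) U f) (h : IsChart c U t w)
    {x : Idx r n → ℂ} (hx : x ∈ U) :
    ∀ᶠ y in nhds x, f y = (w y)⁻¹ * profile t w f x (t y) := by
  obtain ⟨δ, hδ, hball⟩ := Metric.eventually_nhds_iff_ball.1 (h.eventually_t_expScale hx)
  set u : (Idx r n → ℂ) → Idx r n → ℂ := fun y a => log (y a / x a) with hu
  set u' : (Idx r n → ℂ) → Idx r n → ℂ :=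
    fun y => (∑ a, tExp c a * u y a) • lastDir r n with hu'
  have hux : u x = 0 := by
    funext a
    simp [hu]
  have huc : ContinuousAt u x := by
    refine continuousAt_pi.2 fun a => ?_
    refine ContinuousAt.clog ((continuousAt_apply a x).div_const _) ?_
    rw [div_self (h.ne_zero x hx a)]
    exact one_mem_slitPlane
  have hu'c : ContinuousAt u' x := by
    have : Continuous fun v : Idx r n → ℂ => (∑ a, tExp c a * v a) • lastDir r n := by fun_prop
    exact this.continuousAt.comp huc
  have hu'x : u' x = 0 := by simp [hu', hux]
  have h1 : ∀ᶠ y in nhds x, u y ∈ Metric.ball 0 δ :=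
    huc.eventually_mem (by rw [hux]; exact Metric.ball_mem_nhds _ hδ)
  have h2 : ∀ᶠ y in nhds x, u' y ∈ Metric.ball 0 δ :=
    hu'c.eventually_mem (by rw [hu'x]; exact Metric.ball_mem_nhds _ hδ)
  filter_upwards [h1, h2, h.isOpen.mem_nhds hx] with y hy1 hy2 hyU
  have hy : expScale x (u y) = y := by
    funext a
    simp only [expScale, hu]
    rw [exp_log (div_ne_zero (h.ne_zero y hyU a) (h.ne_zero x hx a)),
      mul_div_cancel₀ _ (h.ne_zero x hx a)]
  have ht : t y - t x = ∑ a, tExp c a * u y a := by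
    have := (hball _ hy1).2
    rw [hy] at this
    rw [this, add_sub_cancel_left]
  have hsum : ∑ a, tExp c a * u y a = ∑ a, tExp c a * u' y a := by
    simp only [hu', Pi.smul_apply, smul_eq_mul, mul_left_comm (tExp c _)]
    rw [← Finset.mul_sum, sum_tExp_mul_lastDir, mul_one]
  have hmain := hf.mul_w_eq_of_ball h (fun v hv => (hball v hv).1) hy1 hy2 hsum
  rw [hy] at hmain
  rw [profile, ht, ← hmain, mul_comm (f y), inv_mul_cancel_left₀ (h.w_ne_zero hyU)]

theorem IsChart.mono (h : IsChart c U t w) {V : Set (Idx r n → ℂ)} (hV : IsOpen V) (hVU : V ⊆ U) :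
    IsChart c V t w where
  isOpen := hV
  ne_zero x hx := h.ne_zero x (hVU hx)
  analytic_t := h.analytic_t.mono hVU
  analytic_w := h.analytic_w.mono hVU
  exp_t x hx := h.exp_t x (hVU hx)
  w_sq x hx := h.w_sq x (hVU hx)

theorem sum_gkzMatrix_mul_rayExp (c : Fin (n + 1) → Fin r) (i : Fin r ⊕ Fin n) :
    ∑ a, gkzMatrix c i a * (rayExp r n a : ℤ) = ∑ a, gkzMatrix c i a * (blockExp c a : ℤ) := by
  cases i with
  | inl i =>
    rw [sum_gkzMatrix_inl_mul c i fun a => (rayExp r n a : ℤ),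
      sum_gkzMatrix_inl_mul c i fun a => (blockExp c a : ℤ)]
    simp [rayExp, blockExp, blockSize, eq_comm]
  | inr k =>
    rw [sum_gkzMatrix_inr_mul c k fun a => (rayExp r n a : ℤ),
      sum_gkzMatrix_inr_mul c k fun a => (blockExp c a : ℤ)]
    simp [rayExp, blockExp]

/-- The box equation of the basic relation, ν = 0, becomes the hypergeometric equation for the
profile. -/
theorem IsGKZSolution.applyD_profile (hf : IsGKZSolution (gkzMatrix c) (gkzBeta r n) U f)
    (h : IsChart c U t w) {g : ℂ → ℂ} {V : Set (Idx r n → ℂ)} (hV : IsOpen V) (hVU : V ⊆ U)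
    (hg : ∀ y ∈ V, AnalyticAt ℂ g (t y)) (hfg : ∀ y ∈ V, f y = (w y)⁻¹ * g (t y))
    {y : Idx r n → ℂ} (hy : y ∈ V) :
    iteratedDeriv (n + 1) g (t y) =
      (4 ^ (n + 1) : ℂ)⁻¹ * exp (-t y) * applyD g (t y) (blockPoly c) := by
  have hc := h.mono hV hVU
  have h1 := hf.box (0 + rayExp r n) (0 + blockExp c)
    (by simpa only [zero_add] using sum_gkzMatrix_mul_rayExp c) y (hVU hy)
  have hcp : commonPoly c (0 : Idx r n → ℕ) = 1 := by simp [commonPoly]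
  rw [hc.multiPartial_eq hg hfg _ hy, hc.multiPartial_eq hg hfg _ hy, prod_inv_pow_add_rayExp,
    prod_inv_pow_add_blockExp, opPoly_add_rayExp, opPoly_add_blockExp, hcp, mul_one,
    Polynomial.one_comp, mul_one, ← Polynomial.smul_eq_C_mul, map_smul, smul_eq_mul,
    ← Polynomial.monomial_one_right_eq_X_pow, applyD_monomial, one_mul] at h1
  rw [h.exp_neg_t (hVU hy)]
  have h2 := prod_inr_ne_zero h (hVU hy)
  have h3 := h.w_ne_zero (hVU hy)
  have h4 : ((-1 : ℂ) ^ (n + 1)) * (-1) ^ (n + 1) = 1 := by rw [← mul_pow]; norm_num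
  simp only [Pi.zero_apply, pow_zero, inv_one, Finset.prod_const_one, one_mul, mul_assoc] at h1
  have h5 := mul_left_cancel₀ (inv_ne_zero h3) h1
  have h6 := congrArg ((-1 : ℂ) ^ (n + 1) * (∏ j, y (Sum.inr j)) * ·) h5
  beta_reduce at h6
  have h7 : (-1 : ℂ) ^ (n + 1) * (∏ j, y (Sum.inr j)) * ((∏ j, y (Sum.inr j))⁻¹ *
      ((-1) ^ (n + 1) * iteratedDeriv (n + 1) g (t y))) = iteratedDeriv (n + 1) g (t y) := by
    rw [mul_assoc, mul_inv_cancel_left₀ h2, ← mul_assoc, h4, one_mul]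
  rw [h7] at h6
  rw [h6]
  ring

theorem natDegree_blockPoly_le (c : Fin (n + 1) → Fin r) : (blockPoly c).natDegree ≤ n + 1 := by
  rw [blockPoly, ← sum_blockSize c]
  refine (Polynomial.natDegree_prod_le _ _).trans (Finset.sum_le_sum fun i _ => ?_)
  refine (Polynomial.natDegree_prod_le _ _).trans ?_
  refine (Finset.sum_le_card_nsmul _ _ 1 fun k _ => ?_).trans (by simp)
  compute_degree

theorem IsGKZSolution.eqOn_zero (hf : IsGKZSolution (gkzMatrix c) (gkzBeta r n) U f)
    (h : IsChart c U t w) (hU : IsPreconnected U) {x : Idx r n → ℂ} (hx : x ∈ U)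
    (ht : ‖(blockPoly c).coeff (n + 1)‖ < (t x).re)
    (h0 : ∀ k ≤ n, iteratedDeriv k (profile t w f x) (t x) = 0) : Set.EqOn f 0 U := by
  set g := profile t w f x with hg
  have hga : AnalyticAt ℂ g (t x) := h.analyticAt_profile hf.analytic hx
  have htc := (h.analytic_t x hx).continuousAt
  have hev : ∀ᶠ y in nhds x, y ∈ U ∧ f y = (w y)⁻¹ * g (t y) ∧ AnalyticAt ℂ g (t y) :=
    (h.isOpen.eventually_mem hx).and
      ((hf.eventually_eq_profile h hx).and (htc.eventually hga.eventually_analyticAt))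
  obtain ⟨V, hV, hVo, hxV⟩ := eventually_nhds_iff.1 hev
  have hode : ∀ᶠ τ in nhds (t x), iteratedDeriv (n + 1) g τ =
      (4 ^ (n + 1) : ℂ)⁻¹ * exp (-τ) * applyD g τ (blockPoly c) := by
    have hc : ContinuousAt (fun τ : ℂ => (τ - t x) • lastDir r n) (t x) := by fun_prop
    have hc0 : (t x - t x) • lastDir r n = 0 := by rw [sub_self, zero_smul]
    have hc' : ContinuousAt (fun τ : ℂ => expScale x ((τ - t x) • lastDir r n)) (t x) :=
      (continuous_expScale x).continuousAt.comp hc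
    have e1 := hc.eventually (hc0.symm ▸ h.eventually_t_expScale hx)
    have e2 := hc'.eventually_mem (s := V)
      (by rw [hc0, expScale_zero]; exact hVo.mem_nhds hxV)
    filter_upwards [e1, e2] with τ h1 h2
    have h3 := h1.2
    have h4 : ∑ a, tExp c a * ((τ - t x) • lastDir r n) a = τ - t x := by
      simp only [Pi.smul_apply, smul_eq_mul, mul_left_comm (tExp c _)]
      rw [← Finset.mul_sum, sum_tExp_mul_lastDir, mul_one]
    rw [h4, add_sub_cancel] at h3
    have := hf.applyD_profile h hVo (fun y hy => (hV y hy).1) (fun y hy => (hV y hy).2.2)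
      (fun y hy => (hV y hy).2.1) h2
    rwa [h3] at this
  -- The bound on Re t makes this product smaller than 1 in modulus, away from the singular point of
  -- the equation.
  have hne : (4 ^ (n + 1) : ℂ)⁻¹ * exp (-t x) * (blockPoly c).coeff (n + 1) ≠ 1 := by
    intro h1
    have h2 := congrArg norm h1
    set B := ‖(blockPoly c).coeff (n + 1)‖
    rw [norm_mul, norm_mul, norm_exp, norm_one, norm_inv, norm_pow, neg_re] at h2
    have h3 : (‖(4 : ℂ)‖ ^ (n + 1))⁻¹ ≤ 1 :=
      inv_le_one_of_one_le₀ (one_le_pow₀ (by norm_num))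
    have h4 : B < Real.exp (t x).re := by linarith [Real.add_one_le_exp (t x).re]
    have h5 : Real.exp (-(t x).re) * B < 1 := by
      rw [Real.exp_neg, inv_mul_lt_iff₀ (Real.exp_pos _), mul_one]
      exact h4
    have h6 : 0 ≤ Real.exp (-(t x).re) * B := by positivity
    rw [mul_assoc] at h2
    have h7 := mul_le_of_le_one_left h6 h3
    linarith
  have hz := eventually_eq_zero_of_linear_ode hga (natDegree_blockPoly_le c)
    (κ := fun τ => (4 ^ (n + 1) : ℂ)⁻¹ * exp (-τ)) (by fun_prop) hne hode h0
  refine hf.analytic.eqOn_zero_of_preconnected_of_eventuallyEq_zero hU hx ?_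
  filter_upwards [hev, htc.eventually hz] with y h1 h2
  rw [h1.2.1, h2, mul_zero, Pi.zero_apply]

end Local

/-! ## Bases of the solution space -/

section Basis

theorem multiPartial_congr {ι : Type} [Fintype ι] [DecidableEq ι] {U : Set (ι → ℂ)}
    (hU : IsOpen U) {f g : (ι → ℂ) → ℂ} (h : Set.EqOn f g U) (u : ι → ℕ) :
    Set.EqOn (multiPartial u f) (multiPartial u g) U := by
  simp only [multiPartial]
  induction (Finset.univ : Finset ι).toList with
  | nil => exact h
  | cons a l ih =>
    rw [List.foldr_cons, List.foldr_cons]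
    exact iterate_partialD_congr hU ih a _

theorem IsGKZSolution.congr {ι d : Type} [Fintype ι] [DecidableEq ι] {A : Matrix d ι ℤ}
    {β : d → ℂ} {U : Set (ι → ℂ)} {f g : (ι → ℂ) → ℂ} (hf : IsGKZSolution A β U f)
    (hU : IsOpen U) (h : Set.EqOn f g U) : IsGKZSolution A β U g := by
  refine ⟨hf.analytic.congr hU h, fun u v huv x hx => ?_, fun i x hx => ?_⟩
  · rw [← multiPartial_congr hU h u hx, ← multiPartial_congr hU h v hx, hf.box u v huv x hx]
  · simp only [← partialD_congr hU h _ hx, ← h hx, hf.euler i x hx]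

variable {n r : ℕ} {c : Fin (n + 1) → Fin r} {U : Set (Idx r n → ℂ)} {t w : (Idx r n → ℂ) → ℂ}

/-- Extension by zero is a linear choice of representative on the ambient space, which makes the jet
a linear map. -/
theorem isGKZSolution_extend {A : Matrix (Fin r ⊕ Fin n) (Idx r n) ℤ} {β : Fin r ⊕ Fin n → ℂ}
    (hU : IsOpen U) {g : U → ℂ} (hg : g ∈ gkzSolutions A β U) :
    IsGKZSolution A β U (Function.extend Subtype.val g 0) := by
  obtain ⟨f, hf, h⟩ := hg
  refine hf.congr hU fun x hx => ?_
  have := Subtype.val_injective.extend_apply g 0 (⟨x, hx⟩ : U)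
  exact (this.trans (h ⟨x, hx⟩)).symm

/-- The jet of order `n` of a solution, in the direction of decreasing `ln x_{n+1}`. -/
noncomputable def IsChart.jet (h : IsChart c U t w) {x : Idx r n → ℂ} (hx : x ∈ U) :
    gkzSubmodule (gkzMatrix c) (gkzBeta r n) h.isOpen →ₗ[ℂ] Fin (n + 1) → ℂ where
  toFun g k := iteratedDeriv k (profile t w (Function.extend Subtype.val g.1 0) x) (t x)
  map_add' f g := by
    funext k
    have hf := h.analyticAt_profile (isGKZSolution_extend h.isOpen f.2).analytic hx
    have hg := h.analyticAt_profile (isGKZSolution_extend h.isOpen g.2).analytic hx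
    have e : profile t w (Function.extend Subtype.val (f + g).1 0) x =
        profile t w (Function.extend Subtype.val f.1 0) x +
          profile t w (Function.extend Subtype.val g.1 0) x := by
      funext τ
      have : Function.extend (Subtype.val : U → Idx r n → ℂ) (f.1 + g.1) 0 =
          Function.extend Subtype.val f.1 0 + Function.extend Subtype.val g.1 0 :=
        map_add (Function.ExtendByZero.linearMap ℂ Subtype.val) f.1 g.1
      simp only [profile, Submodule.coe_add, this, Pi.add_apply, add_mul]
    rw [e, iteratedDeriv_add hf.contDiffAt hg.contDiffAt, Pi.add_apply]
  map_smul' z f := by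
    funext k
    have e : profile t w (Function.extend Subtype.val (z • f).1 0) x =
        z • profile t w (Function.extend Subtype.val f.1 0) x := by
      funext τ
      have : Function.extend (Subtype.val : U → Idx r n → ℂ) (z • f.1) 0 =
          z • Function.extend Subtype.val f.1 0 :=
        map_smul (Function.ExtendByZero.linearMap ℂ Subtype.val) z f.1
      simp only [profile, Submodule.coe_smul, this, Pi.smul_apply, smul_eq_mul, mul_assoc]
    rw [e, iteratedDeriv_const_smul_field, RingHom.id_apply, Pi.smul_apply]

theorem IsChart.jet_injective (h : IsChart c U t w) (hU : IsPreconnected U) {x : Idx r n → ℂ}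
    (hx : x ∈ U) (ht : ‖(blockPoly c).coeff (n + 1)‖ < (t x).re) :
    Function.Injective (h.jet hx) := by
  refine (injective_iff_map_eq_zero _).2 fun g hg => ?_
  have h1 := (isGKZSolution_extend h.isOpen g.2).eqOn_zero h hU hx ht
    fun k hk => congrFun hg ⟨k, Nat.lt_succ_of_le hk⟩
  refine Subtype.ext (funext fun y => ?_)
  have h2 := h1 y.2
  rwa [Subtype.val_injective.extend_apply] at h2

/-- The jet embeds the solution space into ℂ^{n+1}, so n + 1 independent solutions exhaust it. -/
theorem IsChart.span_eq_of_linearIndependent (h : IsChart c U t w) (hU : IsConnected U)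
    (ht : ∀ x ∈ U, ‖(blockPoly c).coeff (n + 1)‖ < (t x).re) {F : Fin (n + 1) → U → ℂ}
    (hF : ∀ m, F m ∈ gkzSubmodule (gkzMatrix c) (gkzBeta r n) h.isOpen)
    (hli : LinearIndependent ℂ F) :
    Submodule.span ℂ (Set.range F) = gkzSubmodule (gkzMatrix c) (gkzBeta r n) h.isOpen := by
  obtain ⟨x, hx⟩ := hU.nonempty
  have hinj := h.jet_injective hU.isPreconnected hx (ht x hx)
  have hfin := FiniteDimensional.of_injective _ hinj
  refine Submodule.eq_of_le_of_finrank_le (Submodule.span_le.2 (Set.range_subset_iff.2 hF)) ?_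
  rw [finrank_span_eq_card hli]
  simpa using LinearMap.finrank_le_finrank_of_injective hinj

end Basis

theorem mainTheorem4 (n r : ℕ) (c : Fin (n + 1) → Fin r) :
    ∃ C : ℝ, ∀ (s : Fin r → MvPolynomial (Fin (n + 1)) ℂ)
      (hs : ∀ i, (s i).IsHomogeneous (blockSize c i))
      (L : Contour (doubleCoverGLSM c s hs)),
      -- for `Re t ≫ 1` the A-periods converge and are sums of residues
      (∀ t : ℂ, L.InRegion C t → ∀ J : Finset (Fin (n + 1)),
        Integrable ((braneOf c s hs J).pullback L t) ∧
        HasSum (fun l : ℕ => circleIntegral ((braneOf c s hs J).integrand t) (I * l) (1 / 3))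
          ((braneOf c s hs J).period L t)) ∧
      -- the A-periods are labelled by the cardinality of `J`
      (∀ J J' : Finset (Fin (n + 1)), J.card = J'.card → ∀ t : ℂ,
        (braneOf c s hs J).period L t = (braneOf c s hs J').period L t) ∧
      -- the leading term is a polynomial in `t = -ln q` of degree exactly `n - m`, `m = |J|`
      (∀ J : Finset (Fin (n + 1)), J.card ≤ n →
        ∃ P : Polynomial ℂ, P.degree = ((n - J.card : ℕ) : WithBot ℕ) ∧
          ∀ t : ℂ, circleIntegral ((braneOf c s hs J).integrand t) 0 (1 / 3) = P.eval t) ∧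
      -- the A-periods generate the full solution space
      ∀ U : Set (Idx r n → ℂ), IsOpen U → IsConnected U → (∀ x ∈ U, ∀ a, x a ≠ 0) →
        ∀ t w : (Idx r n → ℂ) → ℂ, AnalyticOnNhd ℂ t U → AnalyticOnNhd ℂ w U →
          (∀ x ∈ U, exp (-t x) = qOf c x) → (∀ x ∈ U, w x ^ 2 = ∏ i, x (Sum.inl i)) →
          (∀ x ∈ U, L.InRegion C (t x)) →
          (Submodule.span ℂ (Set.range (hatZ L U t w)) : Set (U → ℂ)) =
            gkzSolutions (gkzMatrix c) (gkzBeta r n) U ∧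
          ∀ J : Fin (n + 1) → Finset (Fin (n + 1)), (∀ m, (J m).card = m) →
            LinearIndependent ℂ (fun m => hatZ L U t w (J m)) ∧
            (Submodule.span ℂ (Set.range fun m => hatZ L U t w (J m)) : Set (U → ℂ)) =
              gkzSolutions (gkzMatrix c) (gkzBeta r n) U := by
  obtain ⟨b, hb, hφ, hper⟩ := exists_integrable_and_hasSum_period c
  set B := ‖(blockPoly c).coeff (n + 1)‖ with hB
  have hB0 : 0 ≤ B := norm_nonneg _
  -- b + 1 covers convergence and the termwise differential equation; B keeps the equation
  -- nonsingular on t(U).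
  refine ⟨b + 1 + B, fun s hs L => ⟨fun t ht J => ?_, fun J J' hJ t => ?_, fun J hJ => ?_, ?_⟩⟩
  · obtain ⟨h1, h2⟩ := hper s hs L _ (by linarith) t ht J
    refine ⟨h1, ?_⟩
    simp only [circleIntegral_integrand_braneOf, h2]
    have htr := ht.1
    have hJ : J.card ≤ n + 1 := by simpa using J.card_le_univ
    exact (hφ _ hJ).hasSum (by linarith) (by linarith)
  · simp only [Brane.period, Brane.pullback, integrand_braneOf_eq_of_card_eq c s hs hJ]
  · obtain ⟨P, hP, hPt⟩ := exists_polynomial_leading_term c hJ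
    refine ⟨P, hP, fun t => ?_⟩
    rw [← hPt, ← circleIntegral_integrand_braneOf c s hs, Nat.cast_zero, mul_zero]
  · intro U hUo hUc hne t w hta hwa hexp hsq hreg
    have h : IsChart c U t w := ⟨hUo, hne, hta, hwa, hexp, hsq⟩
    have hre : ∀ x ∈ U, b + 1 + B < (t x).re := fun x hx => (hreg x hx).1
    have hcard : ∀ J : Finset (Fin (n + 1)), J.card ≤ n + 1 := fun J => by
      simpa using J.card_le_univ
    have hZ : ∀ J (x : U), hatZ L U t w J x =
        (w x)⁻¹ * circleSum (periodWeight c J.card) (t x) := fun J x => by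
      rw [hatZ, (hper s hs L _ (by linarith) _ (hreg x x.2) J).2]
    have hmem : ∀ J, hatZ L U t w J ∈ gkzSubmodule (gkzMatrix c) (gkzBeta r n) hUo := fun J =>
      ⟨_, isGKZSolution_circleSum hb (hφ _ (hcard J)) h
        (fun x hx => by linarith [hre x hx]), hZ J⟩
    have hli : ∀ J : Fin (n + 1) → Finset (Fin (n + 1)), (∀ m, (J m).card = m) →
        LinearIndependent ℂ fun m => hatZ L U t w (J m) := fun J hJ => by
      refine Fintype.linearIndependent_iff.2 fun a ha => congrFun ?_
      refine h.eq_zero_of_sum_eq_zero hUc.nonempty hb (fun m hm => hφ m (by omega))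
        (fun x hx => by linarith [hre x hx]) fun x hx => ?_
      have := congrFun ha ⟨x, hx⟩
      simpa [Finset.sum_apply, hZ, hJ] using this
    have hspan : ∀ J : Fin (n + 1) → Finset (Fin (n + 1)), (∀ m, (J m).card = m) →
        Submodule.span ℂ (Set.range fun m => hatZ L U t w (J m)) =
          gkzSubmodule (gkzMatrix c) (gkzBeta r n) hUo := fun J hJ =>
      h.span_eq_of_linearIndependent hUc (fun x hx => by linarith [hre x hx])
        (fun m => hmem (J m)) (hli J hJ)
    refine ⟨?_, fun J hJ => ⟨hli J hJ, congrArg _ (hspan J hJ)⟩⟩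
    -- One J of each size m ≤ n already spans. The set of all rays, of size n + 1, also gives a
    -- solution, so it adds nothing.
    have hex : ∀ m : Fin (n + 1), ∃ J : Finset (Fin (n + 1)), J.card = m := fun m => by
      obtain ⟨J, -, hJ⟩ := Finset.exists_subset_card_eq
        (s := (Finset.univ : Finset (Fin (n + 1)))) (n := m) (by simp)
      exact ⟨J, hJ⟩
    choose J hJ using hex
    refine congrArg _ (le_antisymm (Submodule.span_le.2 (Set.range_subset_iff.2 hmem)) ?_)
    rw [← hspan J hJ]
    exact Submodule.span_mono (Set.range_comp_subset_range J (hatZ L U t w))
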